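/- **Setting.** Let $\mathcal T\subset\mathbb R^2$ be an open (nondegenerate) equilateral triangle, let $k\ge 1$ be an integer and $p\ge 1$ a real number. For $\Omega\subset\mathbb R^2$ let $h(\Omega)=\inf\{\mathrm{Per}(E)/|E| : E\subseteq\Omega \text{ measurable},\ 0<|E|<\infty\}$ be its Cheeger constant, where $\mathrm{Per}$ is the De Giorgi perimeter; $\Omega$ is *Cheeger of itself* if it attains this infimum. A *$k$-cluster* of $\mathcal T$ is a family of $k$ Borel subsets of $\mathcal T$ with finite perimeter and Lebesgue negligible mutual intersections. A $k$-cluster $\{\Omega_1,\dots,\Omega_k\}$ is *optimal* if it minimizes $\big[\sum_{j} h^p(\Omega_j)\big]^{1/p}$ among all $k$-clusters of $\mathcal T$. Let $\mathcal A$ be the family of Jordan domains $\Omega\subseteq\mathcal T$ of class $C^1$ that are Cheeger of themselves and whose positively oriented boundary is the union of an even number of consecutive nontrivial arcs, alternately a *free arc* and a *junction arc*, where: - a free arc is an arc of circle of algebraic curvature $h(\Omega)$ (positive when convex as seen from $\Omega$) with at least one endpoint in $\mathcal T$; - a junction arc is either an *inner junction arc*, that is, an arc of circle of constant algebraic curvature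 strictly less than $h(\Omega)$ (possibly $0$) with both endpoints in $\mathcal T$, or a *border junction arc*, that is, a curve with both endpoints on $\partial\mathcal T$ which is a finite union of segments lying in $\partial\mathcal T$ and of arcs of circle of curvature $h(\Omega)$. **Proposition (average of the number of junction arcs).** Let $\{\Omega_1,\dots,\Omega_k\}$ be an optimal $k$-cluster of $\mathcal T$ whose cells are simply connected and belong to $\mathcal A$; fix for each $j$ a decomposition of $\partial\Omega_j$ into $2\Lambda_j$ arcs as above, and assume that: - each inner junction arc of $\Omega_j$ is also an inner junction arc of another cell $\Omega_l$, $l\ne j$, and its curvature, seen from $\Omega_j$, is $$K_{j,l}=\frac{\dfrac{h^p(\Omega_j)}{|\Omega_j|}-\dfrac{h^p(\Omega_l)}{|\Omega_l|}}{\dfrac{h^{p-1}(\Omega_j)}{|\Omega_j|}+\dfrac{h^{p-1}(\Omega_l)}{|\Omega_l|}}\,;$$ - each free arc of $\Omega_j$ meets $\bigcup_{l\neq j}\partial\Omega_l$ in at most finitely many points, and any portion (open or closed subarc) of it which contains none of these points has opening angle strictly less than $\pi$. Thus $\Lambda_j$ is the number of junction arcs of $\partial\Omega_j$. Consider the *canonical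 graph* of the cluster: the multigraph with vertices $X_1,\dots,X_k$ (one for each cell) and $X_0$ (for $\mathbb R^2\setminus\overline{\mathcal T}$), with one edge joining $X_j$ and $X_l$ ($j\neq l$) for each inner junction arc shared by $\Omega_j$ and $\Omega_l$ (inner edges), and one edge joining $X_j$ and $X_0$ for each border junction arc of $\Omega_j$ (outer edges). Let $E_{out}$ be the number of its outer edges. Then $$\sum_{j=1}^k\Lambda_j+E_{out}+6\le 6k.$$ -/

import Mathlib

open scoped ENNReal Topology

noncomputable section

namespace CheegerCluster

/-! The plane `ℝ²` is `ℂ`, with its Euclidean norm and Lebesgue measure `volume`;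
multiplication by `Complex.I` is the counterclockwise rotation by a right angle. -/

/-- `T` is the (open) region bounded by a nondegenerate equilateral triangle. -/
def IsEquilateralTriangle (T : Set ℂ) : Prop :=
  ∃ a b c : ℂ, a ≠ b ∧ dist a b = dist b c ∧ dist b c = dist c a ∧
    T = interior (convexHull ℝ {a, b, c})

/-! ### Perimeter, Cheeger constant, optimal clusters -/

/-- The divergence of a vector field of the plane. -/
def divergence (φ : ℂ → ℂ) (z : ℂ) : ℝ :=
  (fderiv ℝ φ z 1).re + (fderiv ℝ φ z Complex.I).im

/-- The perimeter of a planar set in the sense of De Giorgi: the supremum of `∫_E div φ` over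
the `C¹` vector fields `φ` with compact support and `|φ| ≤ 1`. -/
def perimeter (E : Set ℂ) : ℝ≥0∞ :=
  ⨆ (φ : ℂ → ℂ) (_ : ContDiff ℝ 1 φ ∧ HasCompactSupport φ ∧ ∀ z, ‖φ z‖ ≤ 1),
    ENNReal.ofReal (∫ z in E, divergence φ z)

/-- The Cheeger constant: the infimum of `Per E / |E|` over the measurable `E ⊆ Ω` for which the
quotient makes sense (so it is `∞` for negligible `Ω`). -/
def cheegerENN (Ω : Set ℂ) : ℝ≥0∞ :=
  ⨅ (E : Set ℂ) (_ : MeasurableSet E ∧ E ⊆ Ω ∧ MeasureTheory.volume E ≠ 0 ∧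
      MeasureTheory.volume E ≠ ∞),
    perimeter E / MeasureTheory.volume E

/-- The Cheeger constant as a real number. -/
def cheeger (Ω : Set ℂ) : ℝ := (cheegerENN Ω).toReal

/-- The Lebesgue measure of a planar set as a real number. -/
def area (Ω : Set ℂ) : ℝ := (MeasureTheory.volume Ω).toReal

/-- `Ω` attains the infimum which defines its own Cheeger constant. -/
def IsCheegerOfItself (Ω : Set ℂ) : Prop :=
  MeasurableSet Ω ∧ MeasureTheory.volume Ω ≠ 0 ∧ MeasureTheory.volume Ω ≠ ∞ ∧
    perimeter Ω / MeasureTheory.volume Ω = cheegerENN Ω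

/-- `k`-clusters of `T`: families of `k` Borel subsets of `T` with finite perimeter and
Lebesgue negligible mutual intersections. -/
def IsCluster {k : ℕ} (T : Set ℂ) (Ω : Fin k → Set ℂ) : Prop :=
  (∀ j, MeasurableSet (Ω j) ∧ Ω j ⊆ T ∧ perimeter (Ω j) ≠ ∞) ∧
    ∀ j l, j ≠ l → MeasureTheory.volume (Ω j ∩ Ω l) = 0

/-- The functional `(∑ⱼ h(Ωⱼ)ᵖ)^(1/p)`. -/
def energy {k : ℕ} (p : ℝ) (Ω : Fin k → Set ℂ) : ℝ≥0∞ :=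
  (∑ j, cheegerENN (Ω j) ^ p) ^ (1 / p)

/-- `Ω` minimizes `(∑ⱼ h(Ωⱼ)ᵖ)^(1/p)` among the `k`-clusters of `T`. -/
def IsOptimalCluster {k : ℕ} (p : ℝ) (T : Set ℂ) (Ω : Fin k → Set ℂ) : Prop :=
  IsCluster T Ω ∧ ∀ Ω' : Fin k → Set ℂ, IsCluster T Ω' → energy p Ω ≤ energy p Ω'

/-! ### Jordan domains of class `C¹` and arcs of their boundaries -/

/-- `Ω` is a Jordan domain of class `C¹`, together with a periodic arc length parametrization
of its boundary in the positive sense (`Ω` lies locally on the left of the curve, and only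
there). -/
structure C1JordanDomain (Ω : Set ℂ) where
  isOpen : IsOpen Ω
  isConnected : IsConnected Ω
  isBounded : Bornology.IsBounded Ω
  /-- the length of the boundary -/
  length : ℝ
  length_pos : 0 < length
  /-- the parametrization of the boundary -/
  curve : ℝ → ℂ
  contDiff : ContDiff ℝ 1 curve
  unit_speed : ∀ t, ‖deriv curve t‖ = 1
  periodic : Function.Periodic curve length
  injOn : Set.InjOn curve (Set.Ico 0 length)
  range_eq : Set.range curve = frontier Ω
  left_mem : ∀ t, ∀ᶠ ε : ℝ in 𝓝[>] 0, curve t + ε * (Complex.I * deriv curve t) ∈ Ω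
  right_notMem : ∀ t, ∀ᶠ ε : ℝ in 𝓝[>] 0,
    curve t - ε * (Complex.I * deriv curve t) ∉ closure Ω

/-- The unit speed curve `γ`, restricted to `[s, t]`, is an arc of circle of algebraic curvature
`κ` (a segment if `κ = 0`): its unit tangent rotates counterclockwise at the constant rate `κ`.
For a curve which has a domain on its left, the curvature of an arc is positive when the arc is
convex as seen from the domain. -/
def HasCurvature (γ : ℝ → ℂ) (κ s t : ℝ) : Prop :=
  ∀ u ∈ Set.Icc s t, deriv γ u = deriv γ s * Complex.exp (((κ * (u - s) : ℝ) : ℂ) * Complex.I)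

/-- Free arcs: arcs of circle of algebraic curvature `h` with at least one endpoint in `T`
(recall that the triangle `T` is open). -/
def IsFreeArc (T : Set ℂ) (h : ℝ) (γ : ℝ → ℂ) (s t : ℝ) : Prop :=
  HasCurvature γ h s t ∧ (γ s ∈ T ∨ γ t ∈ T)

/-- Arcs of circle of algebraic curvature `κ < h` with both endpoints in `T`. -/
def IsInnerJunctionArc (T : Set ℂ) (h : ℝ) (γ : ℝ → ℂ) (s t : ℝ) : Prop :=
  (∃ κ < h, HasCurvature γ κ s t) ∧ γ s ∈ T ∧ γ t ∈ T

/-- Curves with both endpoints on `∂T`, which are a finite union of segments contained in `∂T` and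
of arcs of circle of curvature `h`. -/
def IsBorderJunctionArc (T : Set ℂ) (h : ℝ) (γ : ℝ → ℂ) (s t : ℝ) : Prop :=
  γ s ∈ frontier T ∧ γ t ∈ frontier T ∧
    ∃ (n : ℕ) (c : ℕ → ℝ), Monotone c ∧ c 0 = s ∧ c n = t ∧ ∀ i < n,
      (HasCurvature γ 0 (c i) (c (i + 1)) ∧
        ∀ u ∈ Set.Icc (c i) (c (i + 1)), γ u ∈ frontier T) ∨
      HasCurvature γ h (c i) (c (i + 1))

/-- A decomposition of the boundary of the `C¹` Jordan domain `Ω` into `2 * numJunction`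
nontrivial consecutive arcs which are alternately free arcs and junction arcs. The nodes are
indexed by `ℤ`, in the order of the orientation; going once around the boundary means raising the
index by `2 * numJunction`. The `i`-th free arc goes from the node `2 * i` to the node
`2 * i + 1`, the `i`-th junction arc from the node `2 * i + 1` to the node `2 * i + 2`. -/
structure ArcDecomposition (T Ω : Set ℂ) extends C1JordanDomain Ω where
  /-- the number of junction arcs (which is also the number of free arcs) -/
  numJunction : ℕ
  /-- the parameters of the endpoints of the arcs -/
  node : ℤ → ℝ
  node_strictMono : StrictMono node
  node_period : ∀ i, node (i + 2 * numJunction) = node i + length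
  free : ∀ i, IsFreeArc T (cheeger Ω) curve (node (2 * i)) (node (2 * i + 1))
  junction : ∀ i,
    IsInnerJunctionArc T (cheeger Ω) curve (node (2 * i + 1)) (node (2 * i + 2)) ∨
    IsBorderJunctionArc T (cheeger Ω) curve (node (2 * i + 1)) (node (2 * i + 2))

namespace ArcDecomposition

variable {T Ω : Set ℂ} (D : ArcDecomposition T Ω)

/-- The `i`-th free arc. -/
def freeArc (i : ℤ) : Set ℂ := D.curve '' Set.Icc (D.node (2 * i)) (D.node (2 * i + 1))

/-- The `i`-th junction arc. -/
def junctionArc (i : ℤ) : Set ℂ := D.curve '' Set.Icc (D.node (2 * i + 1)) (D.node (2 * i + 2))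

/-- The `i`-th junction arc is an inner junction arc. -/
def IsInner (i : ℤ) : Prop :=
  IsInnerJunctionArc T (cheeger Ω) D.curve (D.node (2 * i + 1)) (D.node (2 * i + 2))

/-- The `i`-th junction arc is a border junction arc. -/
def IsBorder (i : ℤ) : Prop :=
  IsBorderJunctionArc T (cheeger Ω) D.curve (D.node (2 * i + 1)) (D.node (2 * i + 2))

/-- The `i`-th junction arc has algebraic curvature `κ`, seen from `Ω`. -/
def JunctionHasCurvature (i : ℤ) (κ : ℝ) : Prop :=
  HasCurvature D.curve κ (D.node (2 * i + 1)) (D.node (2 * i + 2))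

end ArcDecomposition

/-- The family of the `C¹` Jordan domains contained in `T` which are Cheeger sets of themselves
and whose boundary is composed of alternating free arcs and junction arcs. -/
def classA (T : Set ℂ) : Set (Set ℂ) :=
  {Ω | Ω ⊆ T ∧ IsCheegerOfItself Ω ∧ Nonempty (ArcDecomposition T Ω)}

/-- The algebraic curvature, seen from the first cell, of an arc between cells with Cheeger
constants `h₁, h₂` and areas `A₁, A₂`. -/
def junctionCurvature (p h₁ A₁ h₂ A₂ : ℝ) : ℝ :=
  (h₁ ^ p / A₁ - h₂ ^ p / A₂) / (h₁ ^ (p - 1) / A₁ + h₂ ^ (p - 1) / A₂)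

/-- The structure properties of an optimal cluster, with respect to the decompositions `D` of the
boundaries of its cells. -/
structure HasClusterStructure {k : ℕ} (p : ℝ) (T : Set ℂ) (Ω : Fin k → Set ℂ)
    (D : ∀ j, ArcDecomposition T (Ω j)) : Prop where
  simplyConnected : ∀ j, IsSimplyConnected (Ω j)
  mem_classA : ∀ j, Ω j ∈ classA T
  /-- each inner junction arc is shared with another cell, and has the prescribed curvature -/
  inner_shared : ∀ j i, (D j).IsInner i → ∃ l ≠ j,
    (∃ i', (D l).IsInner i' ∧ (D l).junctionArc i' = (D j).junctionArc i) ∧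
    (D j).JunctionHasCurvature i
      (junctionCurvature p (cheeger (Ω j)) (area (Ω j)) (cheeger (Ω l)) (area (Ω l)))
  /-- a free arc meets the boundaries of the other cells at finitely many points -/
  free_finite : ∀ j i, ((D j).freeArc i ∩ ⋃ l ≠ j, frontier (Ω l)).Finite
  /-- portions of free arcs without such points have opening angle less than `π` -/
  free_angle : ∀ j i s t, (D j).node (2 * i) ≤ s → s ≤ t → t ≤ (D j).node (2 * i + 1) →
    (∀ u ∈ Set.Ioo s t, (D j).curve u ∉ ⋃ l ≠ j, frontier (Ω l)) →
    cheeger (Ω j) * (t - s) < Real.pi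

/-! ### The canonical graph -/

/-- The canonical graph of a cluster, as a multigraph: the vertices are the cells (`some j`) and
the exterior of the triangle (`none`); there is an edge between two distinct cells for each inner
junction arc which they share, and an edge between a cell and the exterior for each border
junction arc of that cell. An edge is labelled by the pair of its ends and the arc through which
it is drawn. -/
def canonicalGraph {k : ℕ} {T : Set ℂ} {Ω : Fin k → Set ℂ}
    (D : ∀ j, ArcDecomposition T (Ω j)) :
    Graph (Option (Fin k)) (Sym2 (Option (Fin k)) × Set ℂ) where
  vertexSet := Set.univ
  IsLink e x y := e.1 = s(x, y) ∧
    ((∃ j l i i', j ≠ l ∧ s(x, y) = s(some j, some l) ∧ (D j).IsInner i ∧ (D l).IsInner i' ∧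
        (D j).junctionArc i = e.2 ∧ (D l).junctionArc i' = e.2) ∨
      ∃ j i, s(x, y) = s(some j, none) ∧ (D j).IsBorder i ∧ (D j).junctionArc i = e.2)
  isLink_symm _ _ := ⟨fun x y h => by rwa [Sym2.eq_swap (a := y) (b := x)]⟩
  eq_or_eq_of_isLink_of_isLink e x y v w h h' := by
    have := h.1.symm.trans h'.1
    rw [Sym2.eq_iff] at this
    tauto
  left_mem_of_isLink _ _ _ _ := Set.mem_univ _

/-- The outer edges of the canonical graph: those which join a cell to the exterior. -/
def outerEdges {k : ℕ} {T : Set ℂ} {Ω : Fin k → Set ℂ}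
    (D : ∀ j, ArcDecomposition T (Ω j)) : Set (Sym2 (Option (Fin k)) × Set ℂ) :=
  {e | ∃ j, (canonicalGraph D).IsLink e (some j) none}

end CheegerCluster

end

/-!
The proof counts turns of tangents and does not use planarity of the canonical graph.

Going once around a `C¹` Jordan domain, the tangent makes one turn
(`C1JordanDomain.angle_add_length`). Two disjoint cells have opposite tangents at every common
boundary point, so at most two cells meet at a point, and a shared inner junction arc is traversed in
opposite directions and contributes opposite rotations to its two cells. Removing the inner junction
arcs from the boundary of a cell leaves *runs*: either one free arc, or a free arc, a border junction
arc and a free arc, because a free arc has an endpoint in `T` and cannot join two border junction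
arcs. Hence the rotations of the tangent along all the runs add up to `2πk` (`sum_runTurn`).

A run ends where an inner junction arc begins, and there the other cell along this arc begins a run,
in the opposite direction. Following the runs in this way one goes around the *faces* of the cluster:
the runs fall into closed chains, joined by cusps, each cusp being a half-turn to the right
(`faceChain`). Such a chain may touch itself, but pushing each run into its cell makes it simple, so
its total rotation can be computed as in Hopf's proof of the *Umlaufsatz*, from the arguments of its
secants (`secant_rotation`):
* if a chain contains a point, other than a cusp, at which some line leaves all cells on its left, its
  rotation is `2π` (`faceChain_turning_of_support`). This holds for the face through a lowest point of
  the cluster, and for each face with a border junction arc, since `T` is convex;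
* a chain of `n` free arcs, all convex, has rotation larger than `-nπ`, which is either positive or
  `-2π`. In the latter case `n ≥ 3`, so that in all cases the rotation is at least `-2πn/3`
  (`CuspChain.NonCrossing.le_turning_of_convex`).

Let `N` be the number of runs, which is the number of pairs of a cell and an inner junction arc of it,
and let `B` be the number of runs with a border junction arc. Add `2π/3` to the rotation of a face for
each of its runs that is a single free arc: the sum is nonnegative for every face, and it is at
least `2π` for one of them. Summing over the faces, `2πk - πN + (2π/3)(N - B) ≥ 2π`, that is
`N + 2B + 6 ≤ 6k`. Here `N + B` is the total number of junction arcs, and the canonical graph has at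
most `B` outer edges.

The free arcs are strictly convex because the Cheeger constants of the cells are positive
(`cheeger_pos`): a multiple of the identity, truncated, is a test field which shows that a bounded open
set has positive perimeter.
-/

noncomputable section

namespace CheegerCluster

/-! ### Angles of complex numbers and their continuous determinations -/

/-- The unit complex number of argument `θ`. -/
def cis (θ : ℝ) : ℂ := Complex.exp (θ * Complex.I)

lemma cis_add (a b : ℝ) : cis (a + b) = cis a * cis b := by
  simp [cis, add_mul, Complex.exp_add]

lemma cis_zero : cis 0 = 1 := by simp [cis]

lemma cis_neg_mul_self (a : ℝ) : cis (-a) * cis a = 1 := by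
  rw [← cis_add]; simp [cis_zero]

lemma cis_pi : cis Real.pi = -1 := by simp [cis]

lemma cis_add_pi (a : ℝ) : cis (a + Real.pi) = -cis a := by rw [cis_add, cis_pi]; ring

lemma norm_cis (a : ℝ) : ‖cis a‖ = 1 := Complex.norm_exp_ofReal_mul_I a

lemma cis_ne_zero (a : ℝ) : cis a ≠ 0 := Complex.exp_ne_zero _

lemma cis_re (a : ℝ) : (cis a).re = Real.cos a := Complex.exp_ofReal_mul_I_re a

lemma cis_im (a : ℝ) : (cis a).im = Real.sin a := Complex.exp_ofReal_mul_I_im a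

lemma continuous_cis : Continuous cis := by unfold cis; fun_prop

lemma cis_eq_cis_iff {a b : ℝ} : cis a = cis b ↔ ∃ n : ℤ, a = b + n * (2 * Real.pi) := by
  unfold cis
  rw [Complex.exp_eq_exp_iff_exists_int]
  refine exists_congr fun n => ?_
  rw [show (b : ℂ) * Complex.I + n * (2 * Real.pi * Complex.I)
    = ((b + n * (2 * Real.pi) : ℝ) : ℂ) * Complex.I by push_cast; ring]
  rw [mul_left_inj' Complex.I_ne_zero]
  norm_cast

lemma cis_half_pi : cis (Real.pi / 2) = Complex.I := by
  apply Complex.ext <;> simp [cis_re, cis_im]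

/-- `θ` is an argument of `z`, not necessarily the principal one. -/
def IsAngleOf (θ : ℝ) (z : ℂ) : Prop := z = ‖z‖ * cis θ

lemma isAngleOf_cis (θ : ℝ) : IsAngleOf θ (cis θ) := by
  simp [IsAngleOf, norm_cis]

lemma isAngleOf_arg (z : ℂ) : IsAngleOf z.arg z := (Complex.norm_mul_exp_arg_mul_I z).symm

lemma IsAngleOf.mul {a b : ℝ} {z w : ℂ} (hz : IsAngleOf a z) (hw : IsAngleOf b w) :
    IsAngleOf (a + b) (z * w) := by
  unfold IsAngleOf at *
  rw [cis_add, norm_mul]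
  push_cast
  linear_combination (norm := ring_nf) w * hz + ‖z‖ * cis a * hw

lemma IsAngleOf.neg {a : ℝ} {z : ℂ} (hz : IsAngleOf a z) : IsAngleOf (a + Real.pi) (-z) := by
  have := hz.mul (isAngleOf_cis Real.pi)
  rwa [cis_pi, mul_neg_one] at this

lemma IsAngleOf.cis_eq {a b : ℝ} {z : ℂ} (h : IsAngleOf a z) (h' : IsAngleOf b z) (hz : z ≠ 0) :
    cis a = cis b := by
  have : (‖z‖ : ℂ) ≠ 0 := by simpa using hz
  exact mul_left_cancel₀ this (h.symm.trans h')

lemma IsAngleOf.exists_int {a b : ℝ} {z : ℂ} (h : IsAngleOf a z) (h' : IsAngleOf b z)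
    (hz : z ≠ 0) : ∃ n : ℤ, a = b + n * (2 * Real.pi) :=
  cis_eq_cis_iff.1 (h.cis_eq h' hz)

lemma IsAngleOf.add_arg_div {a : ℝ} {z : ℂ} (h : IsAngleOf a z) (hz : z ≠ 0) (w : ℂ) :
    IsAngleOf (a + (w / z).arg) w := by
  have := h.mul (isAngleOf_arg (w / z))
  rwa [mul_div_cancel₀ _ hz] at this

/-- A nonvanishing continuous function on a simply connected space has a continuous argument. -/
lemma exists_continuous_angle {X : Type*} [TopologicalSpace X] [SimplyConnectedSpace X]
    [LocallyPathConnectedSpace X] {f : X → ℂ} (hf : Continuous f) (h0 : ∀ x, f x ≠ 0) :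
    ∃ A : X → ℝ, Continuous A ∧ ∀ x, IsAngleOf (A x) (f x) := by
  obtain ⟨x₀⟩ : Nonempty X := inferInstance
  obtain ⟨F, ⟨-, hF⟩, -⟩ := Complex.isCoveringMapOn_exp.existsUnique_continuousMap_lifts
    (⟨f, hf⟩ : C(X, ℂ)) (a₀ := x₀) (e₀ := Complex.log (f x₀)) (Complex.exp_log (h0 x₀))
    (fun a => h0 a)
  refine ⟨fun x => (F x).im, by fun_prop, fun x => ?_⟩
  have hx : Complex.exp (F x) = f x := congrFun hF x
  unfold IsAngleOf cis
  rw [← hx, Complex.norm_exp, Complex.ofReal_exp, ← Complex.exp_add, Complex.re_add_im]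

/-- On a connected set, a continuous function with values in `a + 2πℤ` is constant. -/
lemma eq_of_mem_two_pi_int {X : Type*} [TopologicalSpace X] {s : Set X} (hs : IsPreconnected s)
    {f : X → ℝ} (hf : ContinuousOn f s) (a : ℝ)
    (h : ∀ x ∈ s, ∃ n : ℤ, f x = a + n * (2 * Real.pi)) {x y : X} (hx : x ∈ s) (hy : y ∈ s) :
    f x = f y := by
  have hp := Real.two_pi_pos
  have key : ContinuousOn (fun x => (round ((f x - a) / (2 * Real.pi)) : ℤ)) s := by
    intro z hz
    obtain ⟨n, hn⟩ := h z hz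
    have hev : ∀ᶠ w in 𝓝[s] z, dist (f w) (f z) < 2 * Real.pi :=
      (hf z hz) (Metric.ball_mem_nhds _ hp)
    refine ContinuousWithinAt.congr_of_eventuallyEq
      (continuousWithinAt_const (b := (round ((f z - a) / (2 * Real.pi)) : ℤ))) ?_ rfl
    filter_upwards [hev, self_mem_nhdsWithin] with w hw hws
    obtain ⟨m, hm⟩ := h w hws
    rw [hm, hn] at hw ⊢
    rw [Real.dist_eq, show a + m * (2 * Real.pi) - (a + n * (2 * Real.pi))
      = ((m - n : ℤ) : ℝ) * (2 * Real.pi) by push_cast; ring, abs_mul, abs_of_pos hp] at hw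
    have h1 : |((m - n : ℤ) : ℝ)| < 1 := by
      by_contra hcon
      push Not at hcon
      nlinarith
    have h2 : m - n = 0 := by
      rw [← Int.cast_abs] at h1
      exact Int.abs_lt_one_iff.1 (by exact_mod_cast h1)
    rw [show m = n by omega]
  have hc := hs.constant key hx hy
  obtain ⟨n, hn⟩ := h x hx
  obtain ⟨m, hm⟩ := h y hy
  simp only [hn, hm, add_sub_cancel_left, mul_div_assoc, div_self hp.ne', mul_one,
    round_intCast] at hc
  rw [hn, hm, hc]

/-- If `f` stays in a slit plane, the variation of a continuous argument of `f` is the variation of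
the corresponding principal argument. -/
lemma angle_sub_eq_arg_sub {X : Type*} [TopologicalSpace X] {s : Set X} (hs : IsPreconnected s)
    {f : X → ℂ} {A : X → ℝ} (hf : ContinuousOn f s) (hA : ContinuousOn A s)
    (hfA : ∀ x ∈ s, IsAngleOf (A x) (f x)) {w : ℂ}
    (hslit : ∀ x ∈ s, f x * w ∈ Complex.slitPlane) {x y : X} (hx : x ∈ s) (hy : y ∈ s) :
    A y - A x = (f y * w).arg - (f x * w).arg := by
  have hcont : ContinuousOn (fun z => A z - (f z * w).arg) s := by
    refine hA.sub fun z hz => ?_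
    exact ContinuousAt.comp_continuousWithinAt (g := Complex.arg) (f := fun z => f z * w)
      (Complex.continuousAt_arg (hslit z hz)) ((hf z hz).mul continuousWithinAt_const)
  have := eq_of_mem_two_pi_int hs hcont (-w.arg) (fun z hz => ?_) hx hy
  · linarith
  · have h0 : f z * w ≠ 0 := Complex.slitPlane_ne_zero (hslit z hz)
    obtain ⟨n, hn⟩ := ((hfA z hz).mul (isAngleOf_arg w)).exists_int (isAngleOf_arg _) h0
    exact ⟨n, by linarith⟩

lemma arg_mem_of_re_pos {z : ℂ} (h : 0 < z.re) :
    z.arg ∈ Set.Ioo (-(Real.pi / 2)) (Real.pi / 2) :=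
  abs_lt.1 (Complex.abs_arg_lt_pi_div_two_iff.2 (Or.inl h))

lemma mem_slitPlane_of_re_nonneg {z : ℂ} (h : 0 ≤ z.re) (h0 : z ≠ 0) : z ∈ Complex.slitPlane := by
  rw [Complex.mem_slitPlane_iff]
  by_contra hcon
  push Not at hcon
  exact h0 (Complex.ext (le_antisymm hcon.1 h) hcon.2)

lemma false_of_eq_add_int_mul {L δ x t : ℝ} {q : ℤ} (hδ : 0 < δ) (h : t = x + q * L)
    (h1 : x + δ ≤ t) (h2 : t ≤ x + L - δ) : False := by
  have hL : 0 < L := by linarith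
  have h4 : (0 : ℝ) < q := by
    by_contra hcon
    push Not at hcon
    nlinarith
  have h5 : (q : ℝ) < 1 := by
    by_contra hcon
    push Not at hcon
    nlinarith
  have h6 : 0 < q := by exact_mod_cast h4
  have h7 : q < 1 := by exact_mod_cast h5
  omega

/-! ### Total rotation of the short secants of a closed curve -/

/-- The rotation of the secants of a closed curve: the secant map `(s, r) ↦ c (s + r) - c s` has a
continuous argument on the whole strip `δ ≤ r ≤ L - δ`, and exchanging the ends of a secant
changes `r` into `L - r` and its argument by a constant odd multiple of `π`. Exchanging the ends
twice amounts to turning once around the curve. -/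
lemma secant_rotation_of_separated {c : ℝ → ℂ} {L δ : ℝ} (hc : Continuous c)
    (hper : Function.Periodic c L) (hδL : 2 * δ ≤ L)
    (hne : ∀ s t, δ ≤ t - s → t - s ≤ L - δ → c s ≠ c t) {B : ℝ → ℝ} (hB : Continuous B)
    (hBa : ∀ s, IsAngleOf (B s) (c (s + δ) - c s)) (x : ℝ) {E : ℝ → ℝ}
    (hE : ContinuousOn E (Set.Icc (x + δ) (x + L - δ)))
    (hEa : ∀ t ∈ Set.Icc (x + δ) (x + L - δ), IsAngleOf (E t) (c t - c x)) :
    ∃ N : ℤ, E (x + L - δ) - E (x + δ) + (B x - B (x - δ)) = Real.pi * (2 * N + 1) ∧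
      ∀ y, B (y + L) - B y = 2 * (Real.pi * (2 * N + 1)) := by
  set cl : ℝ → ℝ := fun r => max δ (min r (L - δ)) with hcl
  have hcl1 : ∀ r, δ ≤ cl r := fun r => le_max_left _ _
  have hcl2 : ∀ r, cl r ≤ L - δ := fun r => max_le (by linarith) (min_le_right _ _)
  have hcl3 : ∀ r ∈ Set.Icc δ (L - δ), cl r = r := fun r hr => by
    simp only [hcl, min_eq_left hr.2, max_eq_right hr.1]
  set G : ℝ × ℝ → ℂ := fun q => c (q.1 + cl q.2) - c q.1 with hG
  have hGc : Continuous G := by simp only [hG, hcl]; fun_prop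
  have hG0 : ∀ q, G q ≠ 0 := fun q => by
    have := hne q.1 (q.1 + cl q.2) (by linarith [hcl1 q.2]) (by linarith [hcl2 q.2])
    exact sub_ne_zero.2 this.symm
  obtain ⟨A, hA, hAG⟩ := exists_continuous_angle hGc hG0
  have hδm : δ ∈ Set.Icc δ (L - δ) := ⟨le_rfl, by linarith⟩
  have hLm : L - δ ∈ Set.Icc δ (L - δ) := ⟨by linarith, le_rfl⟩
  have hGE : ∀ s, ∀ r ∈ Set.Icc δ (L - δ), G (s, r) = c (s + r) - c s := fun s r hr => by
    simp only [hG, hcl3 r hr]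
  -- exchanging the ends of a secant
  have hswap : ∀ s s', ∀ r ∈ Set.Icc δ (L - δ), ∀ r' ∈ Set.Icc δ (L - δ),
      A (s, L - r) - A (s - r, r) = A (s', L - r') - A (s' - r', r') := by
    intro s s' r hr r' hr'
    have hcn : ContinuousOn (fun q : ℝ × ℝ => A (q.1, L - q.2) - A (q.1 - q.2, q.2))
        (Set.univ ×ˢ Set.Icc δ (L - δ)) := by fun_prop
    refine eq_of_mem_two_pi_int (isPreconnected_univ.prod isPreconnected_Icc) hcn Real.pi
      (fun q hq => ?_) (x := (s, r)) (y := (s', r')) ⟨trivial, hr⟩ ⟨trivial, hr'⟩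
    have hq2 := hq.2
    have h1 := hAG (q.1, L - q.2)
    have h2 := (hAG (q.1 - q.2, q.2)).neg
    rw [hGE _ _ hq2, sub_add_cancel, neg_sub] at h2
    rw [hGE _ _ ⟨by linarith [hq2.2], by linarith [hq2.1]⟩,
      show q.1 + (L - q.2) = q.1 - q.2 + L by ring, hper] at h1
    obtain ⟨n, hn⟩ := h1.exists_int h2 (sub_ne_zero.2
      (hne _ _ (by linarith [hq2.1]) (by linarith [hq2.2])))
    exact ⟨n, by linarith⟩
  have hBA : ∀ s s', B s - A (s, δ) = B s' - A (s', δ) := by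
    intro s s'
    have hcn : ContinuousOn (fun s : ℝ => B s - A (s, δ)) Set.univ := by fun_prop
    refine eq_of_mem_two_pi_int isPreconnected_univ hcn 0 (fun q _ => ?_) trivial trivial
    have h1 := hAG (q, δ)
    rw [hGE _ _ hδm] at h1
    obtain ⟨n, hn⟩ := (hBa q).exists_int h1
      (sub_ne_zero.2 (hne _ _ (by linarith) (by linarith)).symm)
    exact ⟨n, by linarith⟩
  have hEA : E (x + L - δ) - A (x, L - δ) = E (x + δ) - A (x, δ) := by
    have hcn : ContinuousOn (fun t : ℝ => E t - A (x, t - x)) (Set.Icc (x + δ) (x + L - δ)) :=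
      hE.sub (by fun_prop)
    have := eq_of_mem_two_pi_int isPreconnected_Icc hcn 0 (fun t ht => ?_)
      (x := x + L - δ) (y := x + δ) ⟨by linarith, le_rfl⟩ ⟨le_rfl, by linarith⟩
    · simpa [add_sub_assoc] using this
    · have h1 := hAG (x, t - x)
      rw [hGE _ _ ⟨by linarith [ht.1], by linarith [ht.2]⟩, add_sub_cancel] at h1
      obtain ⟨n, hn⟩ := (hEa t ht).exists_int h1
        (sub_ne_zero.2 (hne _ _ (by linarith [ht.1]) (by linarith [ht.2])).symm)
      exact ⟨n, by linarith⟩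
  obtain ⟨N, hN⟩ : ∃ N : ℤ, A (x, L - δ) - A (x - δ, δ) = Real.pi * (2 * N + 1) := by
    have h1 := hAG (x, L - δ)
    have h2 := (hAG (x - δ, δ)).neg
    rw [hGE _ _ hδm, sub_add_cancel, neg_sub] at h2
    rw [hGE _ _ hLm, show x + (L - δ) = x - δ + L by ring, hper] at h1
    obtain ⟨n, hn⟩ := h1.exists_int h2 (sub_ne_zero.2
      (hne _ _ (by linarith) (by linarith)))
    exact ⟨n, by linear_combination hn⟩
  refine ⟨N, ?_, fun y => ?_⟩
  · linarith [hBA x (x - δ)]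
  · have h1 := hswap (y + L) x (L - δ) hLm δ hδm
    have h2 := hswap (y + δ) x δ hδm δ hδm
    rw [sub_sub_cancel, show y + L - (L - δ) = y + δ by ring] at h1
    rw [add_sub_cancel_right] at h2
    linarith [hBA (y + L) y]

/-- `secant_rotation_of_separated` for a curve which is a limit of curves without double points,
provided that its secants of length `δ` and those from the point `c x` do not vanish. -/
lemma secant_rotation {c : ℝ → ℂ} {L δ : ℝ} (hc : Continuous c)
    (hper : Function.Periodic c L) (hL : 0 < L) (hδL : 2 * δ ≤ L)
    (hsep : ∀ η > 0, ∃ c' : ℝ → ℂ, Continuous c' ∧ Function.Periodic c' L ∧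
      (∀ t, ‖c' t - c t‖ < η) ∧ ∀ s t, δ ≤ t - s → t - s ≤ L - δ → c' s ≠ c' t)
    (hshort : ∀ s, c (s + δ) - c s ≠ 0) {B : ℝ → ℝ} (hB : Continuous B)
    (hBa : ∀ s, IsAngleOf (B s) (c (s + δ) - c s)) (x : ℝ)
    (hbase : ∀ t ∈ Set.Icc (x + δ) (x + L - δ), c t - c x ≠ 0) {E : ℝ → ℝ}
    (hE : ContinuousOn E (Set.Icc (x + δ) (x + L - δ)))
    (hEa : ∀ t ∈ Set.Icc (x + δ) (x + L - δ), IsAngleOf (E t) (c t - c x)) :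
    ∃ N : ℤ, E (x + L - δ) - E (x + δ) + (B x - B (x - δ)) = Real.pi * (2 * N + 1) ∧
      ∀ y, B (y + L) - B y = 2 * (Real.pi * (2 * N + 1)) := by
  obtain ⟨m₁, hm₁, hm₁'⟩ : ∃ m > 0, ∀ s, m ≤ ‖c (s + δ) - c s‖ := by
    obtain ⟨s₀, -, hs₀⟩ := (isCompact_Icc (a := (0 : ℝ)) (b := L)).exists_isMinOn
      ⟨0, le_rfl, hL.le⟩ (f := fun s => ‖c (s + δ) - c s‖) (by fun_prop)
    refine ⟨_, norm_pos_iff.2 (hshort s₀), fun s => ?_⟩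
    have hp : Function.Periodic (fun s => ‖c (s + δ) - c s‖) L := fun s => by
      beta_reduce
      rw [add_right_comm, hper, hper]
    obtain ⟨y, hy, hsy⟩ := hp.exists_mem_Ico₀ hL s
    rw [hsy]
    exact hs₀ ⟨hy.1, hy.2.le⟩
  obtain ⟨m₂, hm₂, hm₂'⟩ : ∃ m > 0, ∀ t ∈ Set.Icc (x + δ) (x + L - δ), m ≤ ‖c t - c x‖ := by
    obtain ⟨s₀, h₀, hs₀⟩ := (isCompact_Icc (a := x + δ) (b := x + L - δ)).exists_isMinOn
      ⟨x + δ, le_rfl, by linarith⟩ (f := fun t => ‖c t - c x‖) (by fun_prop)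
    exact ⟨_, norm_pos_iff.2 (hbase s₀ h₀), fun s hs => hs₀ hs⟩
  obtain ⟨c', hc', hper', hclose, hsep'⟩ := hsep (min m₁ m₂ / 2) (by positivity)
  have hre : ∀ z w : ℂ, z ≠ 0 → ‖w - z‖ < ‖z‖ → 0 < (w / z).re := by
    intro z w hz h
    have h1 : ‖w / z - 1‖ < 1 := by
      rw [div_sub_one hz, norm_div, div_lt_one (norm_pos_iff.2 hz)]; exact h
    have h2 := (Complex.abs_re_le_norm (w / z - 1)).trans_lt h1
    rw [Complex.sub_re, Complex.one_re, abs_lt] at h2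
    linarith
  have hd : ∀ s t, ‖c' t - c' s - (c t - c s)‖ < min m₁ m₂ := by
    intro s t
    calc ‖c' t - c' s - (c t - c s)‖ = ‖(c' t - c t) - (c' s - c s)‖ := by ring_nf
      _ ≤ ‖c' t - c t‖ + ‖c' s - c s‖ := norm_sub_le _ _
      _ < min m₁ m₂ := by linarith [hclose s, hclose t]
  have hr1 : ∀ s, 0 < ((c' (s + δ) - c' s) / (c (s + δ) - c s)).re := fun s =>
    hre _ _ (hshort s) ((hd _ _).trans_le ((min_le_left _ _).trans (hm₁' s)))
  have hr2 : ∀ t ∈ Set.Icc (x + δ) (x + L - δ), 0 < ((c' t - c' x) / (c t - c x)).re :=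
    fun t ht => hre _ _ (hbase t ht) ((hd _ _).trans_le ((min_le_right _ _).trans (hm₂' t ht)))
  have hBc : Continuous (fun s => B s + ((c' (s + δ) - c' s) / (c (s + δ) - c s)).arg) := by
    refine hB.add (continuous_iff_continuousAt.2 fun s => ?_)
    refine ContinuousAt.comp (g := Complex.arg)
      (Complex.continuousAt_arg (Complex.mem_slitPlane_iff.2 (Or.inl (hr1 s)))) ?_
    exact ContinuousAt.div (by fun_prop) (by fun_prop) (hshort s)
  have hEc : ContinuousOn (fun t => E t + ((c' t - c' x) / (c t - c x)).arg)
      (Set.Icc (x + δ) (x + L - δ)) := by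
    refine hE.add fun t ht => ContinuousAt.continuousWithinAt ?_
    refine ContinuousAt.comp (g := Complex.arg)
      (Complex.continuousAt_arg (Complex.mem_slitPlane_iff.2 (Or.inl (hr2 t ht)))) ?_
    exact ContinuousAt.div (by fun_prop) (by fun_prop) (hbase t ht)
  obtain ⟨N, h1, h2⟩ := secant_rotation_of_separated hc' hper' hδL hsep' hBc
    (fun s => (hBa s).add_arg_div (hshort s) _) x hEc
    (fun t ht => (hEa t ht).add_arg_div (hbase t ht) _)
  refine ⟨N, ?_, fun y => ?_⟩
  · have e : ∀ c : ℝ → ℂ, Function.Periodic c L → c (x + L - δ) - c x = -(c x - c (x - δ)) := by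
      intro c hp
      rw [show x + L - δ = x - δ + L by ring, hp]; ring
    simp only [e c hper, e c' hper', neg_div_neg_eq, sub_add_cancel] at h1
    linarith
  · have := h2 y
    simp only [show y + L + δ = y + δ + L by ring, hper _, hper' _] at this
    linarith

/-- A closed curve of period `L` which is a uniform limit of closed curves whose points at
parameter distance at least `δ` are distinct, and whose secants of parameter length `δ` do not
vanish. Such a curve may touch itself, but it does not cross itself. -/
structure AlmostSimple (c : ℝ → ℂ) (L δ : ℝ) : Prop where
  continuous : Continuous c
  periodic : Function.Periodic c L
  pos : 0 < δ
  two_mul_le : 2 * δ ≤ L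
  approx : ∀ η > 0, ∃ c' : ℝ → ℂ, Continuous c' ∧ Function.Periodic c' L ∧
      (∀ t, ‖c' t - c t‖ < η) ∧ ∀ s t, δ ≤ t - s → t - s ≤ L - δ → c' s ≠ c' t
  secant_ne : ∀ s, c (s + δ) - c s ≠ 0

/-- If the curve lies in a closed half plane bounded by a line through the point `c x`, which is not
a double point, then the short secants make an odd number of turns, which can be estimated by their
rotation near `x`: the long secants from `c x` rotate by at most a half-turn. -/
lemma AlmostSimple.rotation_of_support {c : ℝ → ℂ} {L δ : ℝ} (h : AlmostSimple c L δ)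
    {B : ℝ → ℝ} (hB : Continuous B) (hBa : ∀ s, IsAngleOf (B s) (c (s + δ) - c s)) {x ψ : ℝ}
    (hhalf : ∀ t, 0 ≤ ((c t - c x) * cis (-ψ)).im)
    (hbase : ∀ t ∈ Set.Icc (x + δ) (x + L - δ), c t - c x ≠ 0) :
    ∃ N : ℤ, (∀ y, B (y + L) - B y = 2 * (Real.pi * (2 * N + 1))) ∧
      |Real.pi * (2 * N + 1) - (B x - B (x - δ))| ≤ Real.pi ∧
      (0 < ((c (x + δ) - c x) * cis (-ψ)).re → 0 < ((c x - c (x - δ)) * cis (-ψ)).re →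
        0 < Real.pi * (2 * N + 1) - (B x - B (x - δ))) := by
  have hδ := h.pos
  have hδL := h.two_mul_le
  have hc := h.continuous
  set z : ℝ → ℂ := fun t => (c t - c x) * cis (-ψ) * (-Complex.I) with hz
  have hzre : ∀ t, (z t).re = ((c t - c x) * cis (-ψ)).im := fun t => by
    simp only [hz, Complex.mul_re, Complex.neg_re, Complex.neg_im, Complex.I_re, Complex.I_im]
    ring
  have hzim : ∀ t, (z t).im = -((c t - c x) * cis (-ψ)).re := fun t => by
    simp only [hz, Complex.mul_im (_ * _), Complex.neg_re, Complex.neg_im, Complex.I_re,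
      Complex.I_im]
    ring
  have hz0 : ∀ t ∈ Set.Icc (x + δ) (x + L - δ), z t ≠ 0 := fun t ht =>
    mul_ne_zero (mul_ne_zero (hbase t ht) (cis_ne_zero _)) (neg_ne_zero.2 Complex.I_ne_zero)
  have harg : ∀ t, |(z t).arg| ≤ Real.pi / 2 := fun t =>
    Complex.abs_arg_le_pi_div_two_iff.2 (by rw [hzre]; exact hhalf t)
  set E : ℝ → ℝ := fun t => (z t).arg + (Real.pi / 2 + ψ) with hE
  have hEc : ContinuousOn E (Set.Icc (x + δ) (x + L - δ)) := by
    refine ContinuousOn.add (fun t ht => ContinuousAt.continuousWithinAt ?_) continuousOn_const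
    refine ContinuousAt.comp (g := Complex.arg) (Complex.continuousAt_arg
      (mem_slitPlane_of_re_nonneg (by rw [hzre]; exact hhalf t) (hz0 t ht))) ?_
    simp only [hz]; fun_prop
  have hEa : ∀ t ∈ Set.Icc (x + δ) (x + L - δ), IsAngleOf (E t) (c t - c x) := by
    intro t ht
    have h1 := (isAngleOf_arg (z t)).mul (isAngleOf_cis (Real.pi / 2 + ψ))
    have h2 : z t * cis (Real.pi / 2 + ψ) = c t - c x := by
      rw [cis_add, cis_half_pi]
      simp only [hz]
      linear_combination (-(c t - c x) * (cis (-ψ) * cis ψ)) * Complex.I_mul_I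
        + (c t - c x) * cis_neg_mul_self ψ
    rwa [h2] at h1
  obtain ⟨N, h1, h2⟩ := secant_rotation hc h.periodic (by linarith) hδL h.approx h.secant_ne hB hBa
    x hbase hEc hEa
  have hEd : Real.pi * (2 * N + 1) - (B x - B (x - δ))
      = (z (x + L - δ)).arg - (z (x + δ)).arg := by
    simp only [hE] at h1; linarith
  refine ⟨N, h2, ?_, fun h3 h4 => ?_⟩
  · rw [hEd]
    have := abs_sub (z (x + L - δ)).arg (z (x + δ)).arg
    linarith [harg (x + L - δ), harg (x + δ)]
  · rw [hEd]
    have e1 : (z (x + δ)).arg < 0 := by rw [Complex.arg_neg_iff, hzim]; linarith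
    have e2 : 0 ≤ (z (x + L - δ)).arg := by
      rw [Complex.arg_nonneg_iff, hzim, show x + L - δ = x - δ + L by ring, h.periodic]
      rw [← neg_sub, neg_mul, Complex.neg_re] at h4
      linarith
    linarith

/-- The tangent of a curve which lies on the left of its tangent line at a simple smooth point makes
exactly one positive turn. -/
lemma AlmostSimple.rotation_eq_two_pi {c : ℝ → ℂ} {L δ : ℝ} (h : AlmostSimple c L δ)
    {B : ℝ → ℝ} (hB : Continuous B) (hBa : ∀ s, IsAngleOf (B s) (c (s + δ) - c s)) {x ψ : ℝ}
    (hhalf : ∀ t, 0 ≤ ((c t - c x) * cis (-ψ)).im)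
    (hbase : ∀ t ∈ Set.Icc (x + δ) (x + L - δ), c t - c x ≠ 0)
    (hwin : ∀ s ∈ Set.Icc (x - δ) x, 0 < ((c (s + δ) - c s) * cis (-ψ)).re) (y : ℝ) :
    B (y + L) - B y = 2 * Real.pi := by
  obtain ⟨N, h1, h2, h3⟩ := h.rotation_of_support hB hBa hhalf hbase
  have hδ := h.pos
  have hc := h.continuous
  have hx1 : x ∈ Set.Icc (x - δ) x := ⟨by linarith, le_rfl⟩
  have hx2 : x - δ ∈ Set.Icc (x - δ) x := ⟨le_rfl, by linarith⟩
  have h4 := hwin _ hx2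
  rw [sub_add_cancel] at h4
  have h3 := h3 (hwin x hx1) h4
  have h5 := angle_sub_eq_arg_sub isPreconnected_Icc (f := fun s => c (s + δ) - c s)
    (by fun_prop) hB.continuousOn (fun s _ => hBa s) (w := cis (-ψ))
    (fun s hs => Complex.mem_slitPlane_iff.2 (Or.inl (hwin s hs))) hx2 hx1
  have h6 := arg_mem_of_re_pos (hwin _ hx1)
  have h7 := arg_mem_of_re_pos (hwin _ hx2)
  have hp := Real.pi_pos
  rw [abs_le] at h2
  have h8 : (-1 : ℝ) < 2 * N + 1 := by
    by_contra hcon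
    push Not at hcon
    nlinarith [h6.1, h7.2]
  have h9 : (2 * N + 1 : ℝ) < 3 := by
    by_contra hcon
    push Not at hcon
    nlinarith [h6.2, h7.1, h2.2]
  have hN : N = 0 := by
    have a1 : (-1 : ℝ) < N := by linarith
    have a2 : (N : ℝ) < 1 := by linarith
    have a3 : -1 < N := by exact_mod_cast a1
    have a4 : N < 1 := by exact_mod_cast a2
    omega
  rw [h1, hN]
  norm_num

/-! ### Secants of curves of controlled direction -/

/-- If the tangent direction makes an acute angle with a direction, so do the secants. -/
lemma re_secant_pos {g : ℝ → ℂ} {φ : ℝ → ℝ} (hg : ∀ t, HasDerivAt g (cis (φ t)) t) {u v ψ : ℝ}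
    (huv : u < v) (hφ : ∀ w ∈ Set.Ioo u v, |φ w - ψ| < Real.pi / 2) :
    0 < ((g v - g u) * cis (-ψ)).re := by
  have hd : ∀ t, HasDerivAt (fun t => (g t * cis (-ψ)).re) (Real.cos (φ t - ψ)) t := by
    intro t
    have h1 := (Complex.reCLM.hasFDerivAt.comp_hasDerivAt t ((hg t).mul_const (cis (-ψ))))
    rw [← cis_add, ← sub_eq_add_neg] at h1
    simpa [cis_re, Function.comp_def] using h1
  obtain ⟨w, hw, hw'⟩ := exists_hasDerivAt_eq_slope _ _ huv
    (fun t _ => (hd t).continuousAt.continuousWithinAt) (fun t _ => hd t)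
  have h2 : 0 < Real.cos (φ w - ψ) := by
    have := abs_lt.1 (hφ w hw)
    exact Real.cos_pos_of_mem_Ioo ⟨by linarith, by linarith⟩
  rw [hw', ← Complex.sub_re, ← sub_mul] at h2
  exact (div_pos_iff_of_pos_right (by linarith)).1 h2

/-- If the tangent direction points to the left of a direction, so do the secants. -/
lemma im_secant_pos {g : ℝ → ℂ} {φ : ℝ → ℝ} (hg : ∀ t, HasDerivAt g (cis (φ t)) t) {u v ψ : ℝ}
    (huv : u < v) (hφ : ∀ w ∈ Set.Ioo u v, 0 < φ w - ψ ∧ φ w - ψ < Real.pi) :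
    0 < ((g v - g u) * cis (-ψ)).im := by
  have h := re_secant_pos hg huv (ψ := ψ + Real.pi / 2) fun w hw => by
    rw [abs_lt]; constructor <;> linarith [(hφ w hw).1, (hφ w hw).2]
  have e : cis (-(ψ + Real.pi / 2)) = cis (-ψ) * (-Complex.I) := by
    have h1 : cis (-(Real.pi / 2)) = -Complex.I := by
      apply Complex.ext <;> simp [cis_re, cis_im]
    rw [neg_add, cis_add, h1]
  rw [e, ← mul_assoc] at h
  simpa [Complex.mul_re (_ * _)] using h

/-! ### Boundaries of `C¹` Jordan domains -/

lemma uniformContinuous_of_periodic {E : Type*} [PseudoMetricSpace E] {f : ℝ → E} {L : ℝ}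
    (hf : Continuous f) (hp : Function.Periodic f L) (hL : 0 < L) : UniformContinuous f := by
  have hK := (isCompact_Icc (a := -L) (b := 2 * L)).uniformContinuousOn_of_continuous hf.continuousOn
  rw [Metric.uniformContinuousOn_iff] at hK
  rw [Metric.uniformContinuous_iff]
  intro ε hε
  obtain ⟨δ, hδ, h⟩ := hK ε hε
  refine ⟨min δ L, lt_min hδ hL, fun {u v} huv => ?_⟩
  rw [lt_min_iff, Real.dist_eq] at huv
  have h1 : u - toIcoDiv hL 0 u * L ∈ Set.Ico 0 L := by
    have := toIcoMod_mem_Ico hL 0 u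
    rwa [toIcoMod, zsmul_eq_mul, zero_add] at this
  have h2 := abs_lt.1 huv.2
  have h3 := h (u - toIcoDiv hL 0 u * L) ⟨by linarith [h1.1], by linarith [h1.2]⟩
    (v - toIcoDiv hL 0 u * L) ⟨by linarith [h1.1], by linarith [h1.2]⟩
    (by rw [Real.dist_eq, sub_sub_sub_cancel_right]; exact huv.1)
  rwa [hp.sub_int_mul_eq, hp.sub_int_mul_eq] at h3

namespace C1JordanDomain

variable {Ω Ω' : Set ℂ} (C : C1JordanDomain Ω) (C' : C1JordanDomain Ω')

lemma continuous_deriv : Continuous (deriv C.curve) := C.contDiff.continuous_deriv le_rfl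

lemma exists_angle : ∃ φ : ℝ → ℝ, Continuous φ ∧ ∀ t, deriv C.curve t = cis (φ t) := by
  obtain ⟨φ, h1, h2⟩ := exists_continuous_angle C.continuous_deriv
    (fun t => norm_ne_zero_iff.1 (by rw [C.unit_speed]; exact one_ne_zero))
  refine ⟨φ, h1, fun t => ?_⟩
  have := h2 t
  unfold IsAngleOf at this
  rwa [C.unit_speed, Complex.ofReal_one, one_mul] at this

/-- A continuous determination of the angle of the tangent to the boundary. -/
def angle : ℝ → ℝ := C.exists_angle.choose

lemma continuous_angle : Continuous C.angle := C.exists_angle.choose_spec.1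

lemma deriv_curve (t : ℝ) : deriv C.curve t = cis (C.angle t) := C.exists_angle.choose_spec.2 t

lemma hasDerivAt (t : ℝ) : HasDerivAt C.curve (cis (C.angle t)) t := by
  rw [← C.deriv_curve]
  exact (C.contDiff.differentiable one_ne_zero t).hasDerivAt

lemma continuous_curve : Continuous C.curve := C.contDiff.continuous

lemma curve_add_int_mul (t : ℝ) (q : ℤ) : C.curve (t + q * C.length) = C.curve t :=
  C.periodic.int_mul q t

lemma periodic_deriv : Function.Periodic (deriv C.curve) C.length := by
  intro t
  rw [← deriv_comp_add_const, show (fun x => C.curve (x + C.length)) = C.curve from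
    funext C.periodic]

lemma cis_angle_periodic : Function.Periodic (fun t => cis (C.angle t)) C.length := by
  intro t
  beta_reduce
  rw [← C.deriv_curve, ← C.deriv_curve]
  exact C.periodic_deriv t

lemma exists_of_curve_eq {s t : ℝ} (h : C.curve s = C.curve t) :
    ∃ q : ℤ, t = s + q * C.length := by
  have hL := C.length_pos
  have h1 : toIcoMod hL 0 s ∈ Set.Ico 0 C.length := by simpa using toIcoMod_mem_Ico hL 0 s
  have h2 : toIcoMod hL 0 t ∈ Set.Ico 0 C.length := by simpa using toIcoMod_mem_Ico hL 0 t
  have e : ∀ x, C.curve (toIcoMod hL 0 x) = C.curve x := fun x => by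
    rw [toIcoMod, zsmul_eq_mul]; exact C.periodic.sub_int_mul_eq _
  have h3 := C.injOn h1 h2 (by rw [e, e, h])
  refine ⟨toIcoDiv hL 0 t - toIcoDiv hL 0 s, ?_⟩
  have a1 := toIcoMod_add_toIcoDiv_zsmul hL 0 s
  have a2 := toIcoMod_add_toIcoDiv_zsmul hL 0 t
  rw [zsmul_eq_mul] at a1 a2
  push_cast
  linarith

lemma angle_add_length_sub (s t : ℝ) :
    C.angle (s + C.length) - C.angle s = C.angle (t + C.length) - C.angle t := by
  have hA := C.continuous_angle
  refine eq_of_mem_two_pi_int isPreconnected_univ (f := fun s => C.angle (s + C.length) - C.angle s)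
    (by fun_prop) 0 (fun u _ => ?_) trivial trivial
  obtain ⟨n, hn⟩ := cis_eq_cis_iff.1 (C.cis_angle_periodic u)
  exact ⟨n, by linarith⟩

lemma uniformContinuous_angle : UniformContinuous C.angle := by
  have hA := C.continuous_angle
  have hL := C.length_pos
  set κ := (C.angle (0 + C.length) - C.angle 0) / C.length with hκ
  have h1 : Function.Periodic (fun t => C.angle t - κ * t) C.length := by
    intro t
    have := C.angle_add_length_sub t 0
    beta_reduce
    have e : κ * C.length = C.angle (0 + C.length) - C.angle 0 := by
      rw [hκ]; field_simp
    linarith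
  have h2 : UniformContinuous (fun t => C.angle t - κ * t) :=
    uniformContinuous_of_periodic (by fun_prop) h1 hL
  have h3 : UniformContinuous (fun t : ℝ => κ * t) := uniformContinuous_const_smul κ
  simpa using h2.add h3

lemma exists_angle_close {ε : ℝ} (hε : 0 < ε) :
    ∃ δ > 0, ∀ u v, |u - v| ≤ δ → |C.angle u - C.angle v| < ε := by
  obtain ⟨δ, hδ, h⟩ := Metric.uniformContinuous_iff.1 C.uniformContinuous_angle ε hε
  exact ⟨δ / 2, by positivity, fun u v huv => h (by rw [Real.dist_eq]; linarith)⟩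

/-- Boundary points which are close in the plane are close along the boundary. -/
lemma exists_param_close {δ : ℝ} (hδ : 0 < δ) :
    ∃ ε > 0, ∀ s t, ‖C.curve s - C.curve t‖ < ε → ∃ q : ℤ, |s + q * C.length - t| < δ := by
  have hL := C.length_pos
  have hc := C.continuous_curve
  set K : Set (ℝ × ℝ) := (Set.Icc 0 C.length ×ˢ Set.Icc (-C.length) (2 * C.length)) ∩
    {p | δ ≤ |p.2 - p.1| ∧ |p.2 - p.1| ≤ C.length - δ} with hK
  have hKc : IsCompact K := by
    have h1 : Continuous fun p : ℝ × ℝ => |p.2 - p.1| := by fun_prop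
    exact (isCompact_Icc.prod isCompact_Icc).inter_right
      ((isClosed_le continuous_const h1).inter (isClosed_le h1 continuous_const))
  have hpos : ∀ p ∈ K, 0 < ‖C.curve p.2 - C.curve p.1‖ := by
    intro p hp
    rw [norm_pos_iff, sub_ne_zero]
    intro he
    obtain ⟨q, hq⟩ := C.exists_of_curve_eq he.symm
    have h1 := hp.2.1
    have h2 := hp.2.2
    rw [show p.2 - p.1 = q * C.length by linarith, abs_mul, abs_of_pos hL] at h1 h2
    have h3 : |(q : ℝ)| < 1 := by
      by_contra hcon
      push Not at hcon
      nlinarith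
    rw [← Int.cast_abs] at h3
    have h4 : q = 0 := Int.abs_lt_one_iff.1 (by exact_mod_cast h3)
    rw [h4] at h1
    simp at h1
    linarith
  obtain ⟨ε, hε, hεK⟩ : ∃ ε > 0, ∀ p ∈ K, ε ≤ ‖C.curve p.2 - C.curve p.1‖ := by
    rcases K.eq_empty_or_nonempty with he | hne
    · exact ⟨1, one_pos, by simp [he]⟩
    · obtain ⟨p, hp, hmin⟩ := hKc.exists_isMinOn hne
        (f := fun p => ‖C.curve p.2 - C.curve p.1‖) (by fun_prop)
      exact ⟨_, hpos p hp, fun p' hp' => hmin hp'⟩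
  refine ⟨ε, hε, fun s t hst => ?_⟩
  by_contra hcon
  push Not at hcon
  -- move both parameters to the fundamental period
  set t' := toIcoMod hL 0 t with ht'
  set s' := toIcoMod hL 0 s with hs'
  have ht : t' ∈ Set.Ico 0 C.length := by simpa using toIcoMod_mem_Ico hL 0 t
  have hs : s' ∈ Set.Ico 0 C.length := by simpa using toIcoMod_mem_Ico hL 0 s
  have et := toIcoMod_add_toIcoDiv_zsmul hL 0 t
  have es := toIcoMod_add_toIcoDiv_zsmul hL 0 s
  rw [zsmul_eq_mul] at et es
  rw [← et, ← es, C.curve_add_int_mul, C.curve_add_int_mul] at hst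
  have key : ∀ m : ℤ, δ ≤ |s' + m * C.length - t'| := fun m => by
    have := hcon (m - toIcoDiv hL 0 s + toIcoDiv hL 0 t)
    push_cast at this
    rwa [show s + (m - toIcoDiv hL 0 s + toIcoDiv hL 0 t) * C.length - t
      = s' + m * C.length - t' by linear_combination et - es] at this
  have k0 := key 0
  have k1 := key 1
  have k2 := key (-1)
  push_cast at k0 k1 k2
  rw [zero_mul, add_zero] at k0
  have : ε ≤ ‖C.curve s' - C.curve t'‖ := by
    refine hεK (t', s') ⟨⟨⟨ht.1, ht.2.le⟩, ⟨by linarith [hs.1], by linarith [hs.2]⟩⟩, k0, ?_⟩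
    show |s' - t'| ≤ C.length - δ
    rw [abs_of_nonneg (by linarith [hs.1, ht.2] : 0 ≤ s' + 1 * C.length - t')] at k1
    rw [abs_of_nonpos (by linarith [hs.2, ht.1] : s' + (-1) * C.length - t' ≤ 0)] at k2
    rw [abs_le]
    constructor <;> linarith
  linarith

/-- Every cone around the left normal is contained in the domain near its vertex, uniformly along
the boundary: the cone is connected, contains points of the domain and does not meet the boundary,
which is close to its tangent. -/
lemma exists_cone {κ : ℝ} (hκ : 0 < κ) : ∃ ε > 0, ∀ t z, z ≠ 0 → ‖z‖ < ε → κ * ‖z‖ ≤ z.im →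
    C.curve t + z * cis (C.angle t) ∈ Ω := by
  set k := min κ 1 with hk
  have hk0 : 0 < k := lt_min hκ one_pos
  have hk1 : k ≤ 1 := min_le_right _ _
  obtain ⟨δ, hδ, hdδ⟩ := Metric.uniformContinuous_iff.1
    (uniformContinuous_of_periodic C.continuous_deriv C.periodic_deriv C.length_pos) (k / 4)
    (by positivity)
  obtain ⟨ε, hε, hεδ⟩ := C.exists_param_close hδ
  refine ⟨ε, hε, ?_⟩
  intro t
  set Z : Set ℂ := {z | (z ≠ 0 ∧ k * ‖z‖ ≤ z.im) ∧ ‖z‖ < ε} with hZ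
  have him : ∀ z ∈ Z, 0 < z.im := fun z hz =>
    lt_of_lt_of_le (mul_pos hk0 (norm_pos_iff.2 hz.1.1)) hz.1.2
  have hconv : Convex ℝ Z := by
    intro z hz w hw a b ha hb hab
    have h1 := him z hz
    have h2 := him w hw
    have hn : ‖a • z + b • w‖ ≤ a * ‖z‖ + b * ‖w‖ := by
      refine (norm_add_le _ _).trans ?_
      rw [norm_smul, norm_smul, Real.norm_of_nonneg ha, Real.norm_of_nonneg hb]
    have hi : (a • z + b • w).im = a * z.im + b * w.im := by simp
    have hp : 0 < a * z.im + b * w.im := by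
      rcases ha.eq_or_lt with h | h
      · have : b = 1 := by linarith
        rw [← h, this]; linarith
      · have := mul_pos h h1
        have := mul_nonneg hb h2.le
        linarith
    refine ⟨⟨fun h0 => ?_, ?_⟩, ?_⟩
    · rw [h0] at hi; simp at hi; linarith
    · rw [hi]
      have := mul_le_mul_of_nonneg_left hn hk0.le
      have := mul_le_mul_of_nonneg_left hz.1.2 ha
      have := mul_le_mul_of_nonneg_left hw.1.2 hb
      linarith
    · refine hn.trans_lt ?_
      rcases ha.eq_or_lt with h | h
      · have : b = 1 := by linarith
        rw [← h, this]; linarith [hw.2]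
      · have := mul_lt_mul_of_pos_left hz.2 h
        have := mul_le_mul_of_nonneg_left hw.2.le hb
        have : a * ε + b * ε = ε := by rw [← add_mul, hab, one_mul]
        linarith
  have hpre : IsPreconnected ((fun z => C.curve t + z * cis (C.angle t)) '' Z) :=
    hconv.isPreconnected.image _ (by fun_prop)
  have hfr : ∀ z ∈ Z, C.curve t + z * cis (C.angle t) ∉ frontier Ω := by
    intro z hz hmem
    rw [← C.range_eq] at hmem
    obtain ⟨s, hs⟩ := hmem
    have hzs : C.curve s - C.curve t = z * cis (C.angle t) := by rw [hs]; ring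
    obtain ⟨q, hq⟩ := hεδ s t (by rw [hzs, norm_mul, norm_cis, mul_one]; exact hz.2)
    set u := s + q * C.length with hu
    have hus : C.curve u = C.curve s := C.curve_add_int_mul s q
    have hmv : ‖C.curve u - C.curve t - (u - t : ℝ) * cis (C.angle t)‖ ≤ k / 4 * |u - t| := by
      have := (convex_uIcc t u).norm_image_sub_le_of_norm_hasDerivWithin_le
        (f := fun x => C.curve x - x * cis (C.angle t)) (C := k / 4)
        (f' := fun x => cis (C.angle x) - cis (C.angle t)) (x := t) (y := u)
        (fun x _ => ((C.hasDerivAt x).sub (by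
          simpa using (Complex.ofRealCLM.hasDerivAt (x := x)).mul_const
            (cis (C.angle t)))).hasDerivWithinAt)
        (fun x hx => by
          rw [← C.deriv_curve, ← C.deriv_curve, ← dist_eq_norm]
          refine (hdδ ?_).le
          rw [Real.dist_eq]
          exact (Set.abs_sub_left_of_mem_uIcc hx).trans_lt hq)
        Set.left_mem_uIcc Set.right_mem_uIcc
      rw [Real.norm_eq_abs] at this
      refine le_trans (le_of_eq ?_) this
      congr 1
      push_cast; ring
    rw [hus, hzs, ← sub_mul, norm_mul, norm_cis, mul_one] at hmv
    have h1 : z.im ≤ k / 4 * |u - t| := by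
      have := (Complex.abs_im_le_norm (z - (u - t : ℝ))).trans hmv
      simp only [Complex.sub_im, Complex.ofReal_im, sub_zero] at this
      exact (le_abs_self _).trans this
    have h2 : |u - t| ≤ ‖z‖ + k / 4 * |u - t| := by
      have := norm_sub_norm_le ((u - t : ℝ) : ℂ) z
      rw [Complex.norm_real, Real.norm_eq_abs, norm_sub_rev] at this
      linarith
    have h3 := hz.1.2
    have h4 := him z hz
    have h5 : 0 < |u - t| := by
      by_contra hcon
      push Not at hcon
      nlinarith
    nlinarith [mul_pos hk0 h5]
  have hsub : (fun z => C.curve t + z * cis (C.angle t)) '' Z ⊆ Ω := by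
    refine hpre.subset_left_of_subset_union C.isOpen (isClosed_closure (s := Ω)).isOpen_compl
      (Set.disjoint_compl_right_iff_subset.2 subset_closure) ?_ ?_
    · rintro _ ⟨z, hz, rfl⟩
      by_cases hcl : C.curve t + z * cis (C.angle t) ∈ closure Ω
      · left
        have := hfr z hz
        rw [C.isOpen.frontier_eq] at this
        by_contra hcon
        exact this ⟨hcl, hcon⟩
      · right; exact hcl
    · have h1 := C.left_mem t
      have h2 : ∀ᶠ η : ℝ in 𝓝[>] 0, η < ε := by
        filter_upwards [Ioo_mem_nhdsGT hε] with η hη using hη.2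
      obtain ⟨η, ⟨ha, hb⟩, hc⟩ := ((h1.and h2).and self_mem_nhdsWithin).exists
      have hc : 0 < η := hc
      rw [C.deriv_curve, ← mul_assoc] at ha
      refine ⟨_, ⟨η * Complex.I, ⟨⟨?_, ?_⟩, ?_⟩, rfl⟩, ha⟩
      · simp [hc.ne']
      · simp [abs_of_pos hc]; nlinarith
      · simp [abs_of_pos hc, hb]
  intro z hz0 hzε hzκ
  refine hsub ⟨z, ⟨⟨hz0, le_trans ?_ hzκ⟩, hzε⟩, rfl⟩
  exact mul_le_mul_of_nonneg_right (min_le_left _ _) (norm_nonneg _)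

/-- Directions pointing strictly to the left of the tangent enter the domain. -/
lemma eventually_mem_of_im_pos {t : ℝ} {v : ℂ} (hv : 0 < (v * cis (-C.angle t)).im) :
    ∀ᶠ η : ℝ in 𝓝[>] 0, C.curve t + η * v ∈ Ω := by
  obtain ⟨z, hz⟩ : ∃ z, z = v * cis (-C.angle t) := ⟨_, rfl⟩
  rw [← hz] at hv
  have hz0 : z ≠ 0 := fun h => by rw [h] at hv; simp at hv
  have hn := norm_pos_iff.2 hz0
  obtain ⟨ε, hε, h⟩ := C.exists_cone (div_pos hv hn)
  filter_upwards [Ioo_mem_nhdsGT (div_pos hε hn)] with η hη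
  have h1 := h t (η * z) (mul_ne_zero (by exact_mod_cast hη.1.ne') hz0)
    (by
      rw [norm_mul, Complex.norm_real, Real.norm_of_nonneg hη.1.le]
      exact (lt_div_iff₀ hn).1 hη.2)
    (by
      rw [norm_mul (η : ℂ) z, Complex.norm_real, Real.norm_of_nonneg hη.1.le, Complex.im_ofReal_mul]
      exact le_of_eq (by field_simp))
  rwa [hz, mul_assoc, mul_assoc, cis_neg_mul_self, mul_one] at h1

end C1JordanDomain

/-! ### Contact points and total rotation of Jordan domains -/

lemma cis_mul_cis_neg_im (a b : ℝ) : (Complex.I * cis a * cis (-b)).im = Real.cos (a - b) := by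
  rw [mul_assoc, ← cis_add, Complex.I_mul_im, cis_re, sub_eq_add_neg]

lemma cos_lt_one_of_cis_ne {a b : ℝ} (h : cis a ≠ cis b) : Real.cos (a - b) < 1 := by
  refine lt_of_le_of_ne (Real.cos_le_one _) fun h1 => h ?_
  obtain ⟨n, hn⟩ := (Real.cos_eq_one_iff _).1 h1
  exact cis_eq_cis_iff.2 ⟨n, by linarith⟩

lemma exists_im_lt_of_isOpen {U : Set ℂ} (hU : IsOpen U) {p : ℂ} (hp : p ∈ U) :
    ∃ z ∈ U, z.im < p.im := by
  obtain ⟨ε, hε, hball⟩ := Metric.isOpen_iff.1 hU p hp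
  have : p - (ε / 2 : ℝ) * Complex.I ∈ Metric.ball p ε := by
    simp [abs_of_pos hε, hε]
  exact ⟨_, hball this, by simp [hε]⟩

namespace C1JordanDomain

variable {Ω Ω' : Set ℂ} (C : C1JordanDomain Ω) (C' : C1JordanDomain Ω')

/-- At a common boundary point of two disjoint domains, the boundaries have opposite directions. -/
lemma cis_angle_eq_neg (hdisj : Disjoint Ω Ω') {s t : ℝ} (h : C.curve s = C'.curve t) :
    cis (C'.angle t) = -cis (C.angle s) := by
  rw [← cis_add_pi]
  by_contra hne
  have hc := cos_lt_one_of_cis_ne hne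
  rw [show C'.angle t - (C.angle s + Real.pi) = C'.angle t - C.angle s - Real.pi by ring,
    Real.cos_sub_pi] at hc
  -- the sum of the left normals points to the left of both curves
  have h1 := C.eventually_mem_of_im_pos (t := s)
    (v := Complex.I * cis (C.angle s) + Complex.I * cis (C'.angle t)) (by
      rw [add_mul, Complex.add_im, cis_mul_cis_neg_im, cis_mul_cis_neg_im, sub_self, Real.cos_zero]
      linarith)
  have h2 := C'.eventually_mem_of_im_pos (t := t)
    (v := Complex.I * cis (C.angle s) + Complex.I * cis (C'.angle t)) (by
      rw [add_mul, Complex.add_im, cis_mul_cis_neg_im, cis_mul_cis_neg_im, sub_self, Real.cos_zero,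
        ← Real.cos_neg, neg_sub]
      linarith)
  obtain ⟨η, h3, h4⟩ := (h1.and h2).exists
  rw [h] at h3
  exact Set.disjoint_left.1 hdisj h3 h4

/-- If the domain lies on the left of an oriented line through a boundary point, then the line is
the tangent at this point, with its orientation. -/
lemma cis_angle_eq_of_support {t ψ : ℝ}
    (h : ∀ x ∈ Ω, 0 ≤ ((x - C.curve t) * cis (-ψ)).im) : cis (C.angle t) = cis ψ := by
  by_contra hne
  have hc := cos_lt_one_of_cis_ne hne
  have h1 := C.eventually_mem_of_im_pos (t := t)
    (v := Complex.I * cis (C.angle t) - Complex.I * cis ψ) (by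
      rw [sub_mul, Complex.sub_im, cis_mul_cis_neg_im, cis_mul_cis_neg_im, sub_self, Real.cos_zero,
        ← Real.cos_neg, neg_sub]
      linarith)
  obtain ⟨η, h2, h3⟩ := (h1.and self_mem_nhdsWithin).exists
  have h3 : 0 < η := h3
  have h4 := h _ h2
  rw [add_sub_cancel_left, mul_assoc, Complex.im_ofReal_mul, sub_mul, Complex.sub_im,
    cis_mul_cis_neg_im, cis_mul_cis_neg_im, sub_self, Real.cos_zero] at h4
  nlinarith

/-- The boundary, pushed slightly along its left normal, lies in the domain. -/
lemma exists_push_mem : ∃ ε > 0, ∀ t, ∀ η : ℝ, 0 < η → η < ε →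
    C.curve t + η * (Complex.I * cis (C.angle t)) ∈ Ω := by
  obtain ⟨ε, hε, h⟩ := C.exists_cone one_pos
  refine ⟨ε, hε, fun t η h0 hη => ?_⟩
  rw [← mul_assoc]
  refine h t _ (mul_ne_zero (by exact_mod_cast h0.ne') Complex.I_ne_zero) ?_ ?_ <;>
    simp [abs_of_pos h0, hη]

lemma mem_frontier (t : ℝ) : C.curve t ∈ frontier Ω := by
  rw [← C.range_eq]; exact Set.mem_range_self t

lemma curve_mem_closure (t : ℝ) : C.curve t ∈ closure Ω := frontier_subset_closure (C.mem_frontier t)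

lemma im_nonneg_of_mem_closure {S : Set ℂ} {p : ℂ} {ψ : ℝ}
    (h : ∀ x ∈ S, 0 ≤ ((x - p) * cis (-ψ)).im) {x : ℂ} (hx : x ∈ closure S) :
    0 ≤ ((x - p) * cis (-ψ)).im := by
  have hcl : IsClosed {x : ℂ | 0 ≤ ((x - p) * cis (-ψ)).im} :=
    isClosed_le continuous_const (by fun_prop)
  exact closure_minimal h hcl hx

lemma almostSimple {δ : ℝ} (hδ : 0 < δ) (hδL : 2 * δ ≤ C.length) :
    AlmostSimple C.curve C.length δ := by
  have hL := C.length_pos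
  have hne : ∀ s t, δ ≤ t - s → t - s ≤ C.length - δ → C.curve s ≠ C.curve t := by
    intro s t h1 h2 h3
    obtain ⟨q, hq⟩ := C.exists_of_curve_eq h3
    exact false_of_eq_add_int_mul hδ hq (by linarith) (by linarith)
  refine ⟨C.continuous_curve, C.periodic, hδ, hδL, fun η hη =>
    ⟨C.curve, C.continuous_curve, C.periodic, by simpa using hη, hne⟩, fun s => ?_⟩
  exact sub_ne_zero.2 (hne s (s + δ) (by linarith) (by linarith)).symm

/-- The *Umlaufsatz*: the tangent to the boundary of a Jordan domain makes one positive turn. -/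
lemma angle_add_length (t : ℝ) : C.angle (t + C.length) = C.angle t + 2 * Real.pi := by
  have hL := C.length_pos
  have hc := C.continuous_curve
  -- a lowest point of the domain
  obtain ⟨p, hp, hmin⟩ := C.isBounded.isCompact_closure.exists_isMinOn C.isConnected.1.closure
    (f := Complex.im) Complex.continuous_im.continuousOn
  have hpΩ : p ∉ Ω := by
    intro hpΩ
    obtain ⟨z, hz, hlt⟩ := exists_im_lt_of_isOpen C.isOpen hpΩ
    exact absurd (hmin (subset_closure hz)) (not_le.2 hlt)
  obtain ⟨x, rfl⟩ : p ∈ Set.range C.curve := by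
    rw [C.range_eq, C.isOpen.frontier_eq]; exact ⟨hp, hpΩ⟩
  have hhalf0 : ∀ y ∈ closure Ω, 0 ≤ ((y - C.curve x) * cis (-0)).im := fun y hy => by
    rw [neg_zero, cis_zero, mul_one, Complex.sub_im, sub_nonneg]
    exact hmin hy
  have hang := C.cis_angle_eq_of_support fun y hy => hhalf0 y (subset_closure hy)
  have hneg : cis (-C.angle x) = cis (-0) := by
    obtain ⟨n, hn⟩ := cis_eq_cis_iff.1 hang
    exact cis_eq_cis_iff.2 ⟨-n, by push_cast; linarith⟩
  obtain ⟨δ₀, hδ₀, hclose⟩ := C.exists_angle_close (half_pos Real.pi_pos)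
  set δ := min δ₀ (C.length / 2) with hδdef
  have hδ : 0 < δ := by positivity
  have hδ1 : δ ≤ δ₀ := min_le_left _ _
  have hδ2 : δ ≤ C.length / 2 := min_le_right _ _
  have hAS := C.almostSimple hδ (by linarith)
  obtain ⟨B, hB, hBa⟩ := exists_continuous_angle (f := fun s => C.curve (s + δ) - C.curve s)
    (by fun_prop) hAS.secant_ne
  have hsec : ∀ s a, |s - a| ≤ δ → |s + δ - a| ≤ δ →
      0 < ((C.curve (s + δ) - C.curve s) * cis (-C.angle a)).re := by
    intro s a h1 h2
    refine re_secant_pos C.hasDerivAt (by linarith) fun w hw => hclose w a ?_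
    rw [abs_le] at *
    constructor <;> linarith [hw.1, hw.2]
  have hW := hAS.rotation_eq_two_pi hB hBa (x := x) (ψ := C.angle x)
    (fun t => by rw [hneg]; exact hhalf0 _ (C.curve_mem_closure t))
    (fun t ht => by
      intro h0
      obtain ⟨q, hq⟩ := C.exists_of_curve_eq (sub_eq_zero.1 h0).symm
      exact false_of_eq_add_int_mul hδ hq ht.1 ht.2)
    (fun s hs => hsec s x (by rw [abs_le]; constructor <;> linarith [hs.1, hs.2])
      (by rw [abs_le]; constructor <;> linarith [hs.1, hs.2]))
  -- the short secants follow the tangent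
  have hA := C.continuous_angle
  have hcis := continuous_cis
  have h1 := angle_sub_eq_arg_sub isPreconnected_univ
    (f := fun s => (C.curve (s + δ) - C.curve s) * cis (-C.angle s)) (A := fun s => B s + -C.angle s)
    (by fun_prop) (by fun_prop) (fun s _ => (hBa s).mul (isAngleOf_cis _)) (w := 1)
    (fun s _ => by
      rw [mul_one]
      exact Complex.mem_slitPlane_iff.2 (Or.inl (hsec s s (by simp [hδ.le]) (by simp [abs_of_pos hδ]))))
    (x := t) (y := t + C.length) trivial trivial
  have h2 : cis (-C.angle (t + C.length)) = cis (-C.angle t) := by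
    obtain ⟨n, hn⟩ := cis_eq_cis_iff.1 (C.cis_angle_periodic t)
    exact cis_eq_cis_iff.2 ⟨-n, by push_cast; linarith⟩
  rw [h2, add_right_comm, C.periodic, C.periodic, sub_self] at h1
  linarith [hW t]

lemma angle_add_int_mul (t : ℝ) (q : ℤ) :
    C.angle (t + q * C.length) = C.angle t + q * (2 * Real.pi) := by
  have h : Function.Periodic (fun t => C.angle t - 2 * Real.pi / C.length * t) C.length := by
    intro t
    have := C.length_pos
    beta_reduce
    rw [C.angle_add_length]
    field_simp
    ring
  have h1 := h.int_mul q t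
  have := C.length_pos
  beta_reduce at h1
  field_simp at h1
  have h2 := mul_left_cancel₀ this.ne' (show C.length * C.angle (t + q * C.length)
    = C.length * (C.angle t + q * (2 * Real.pi)) by linarith)
  exact h2

end C1JordanDomain

/-! ### Closed chains of arcs joined by cusps -/

lemma arg_eq_of_isAngleOf {θ : ℝ} {z : ℂ} (h : IsAngleOf θ z) (hz : z ≠ 0)
    (hθ : θ ∈ Set.Ioc (-Real.pi) Real.pi) : z.arg = θ := by
  rw [h, cis, Complex.exp_mul_I, Complex.arg_mul_cos_add_sin_mul_I (norm_pos_iff.2 hz) hθ]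

/-- A closed chain of `n` unit speed arcs `g m : [0, ℓ m] → ℂ`, indexed by the integers modulo `n`,
with tangent angles `φ m`. The direction of the tangent is reversed between an arc and the next one,
and the arcs are convex on their left near their endpoints. -/
structure CuspChain (n : ℕ) where
  pos : 0 < n
  g : ℤ → ℝ → ℂ
  φ : ℤ → ℝ → ℝ
  ℓ : ℤ → ℝ
  length_pos : ∀ m, 0 < ℓ m
  hasDerivAt : ∀ m t, HasDerivAt (g m) (cis (φ m t)) t
  continuous_angle : ∀ m, Continuous (φ m)
  join : ∀ m, g (m + 1) 0 = g m (ℓ m)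
  cusp : ∀ m, cis (φ (m + 1) 0) = -cis (φ m (ℓ m))
  periodic_g : ∀ m, g (m + n) = g m
  periodic_angle : ∀ m, φ (m + n) = φ m
  periodic_length : ∀ m, ℓ (m + n) = ℓ m
  convex_start : ∀ m, ∃ r > 0, StrictMonoOn (φ m) (Set.Icc 0 r)
  convex_end : ∀ m, ∃ r > 0, StrictMonoOn (φ m) (Set.Icc (ℓ m - r) (ℓ m))

namespace CuspChain

variable {n : ℕ} (K : CuspChain n)

/-- The closed curve which runs along the `m`-th arc, at constant speed, in the time interval
`[m, m + 1]`. -/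
def curve (t : ℝ) : ℂ := K.g ⌊t⌋ (Int.fract t * K.ℓ ⌊t⌋)

/-- The number of turns of the tangent along a chain, times `2π`, each cusp being counted as
a half-turn to the right. -/
def turning : ℝ := ∑ m ∈ Finset.range n, (K.φ m (K.ℓ m) - K.φ m 0 - Real.pi)

lemma curve_eq {m : ℤ} {t : ℝ} (h0 : m ≤ t) (h1 : t ≤ m + 1) :
    K.curve t = K.g m ((t - m) * K.ℓ m) := by
  rcases h1.eq_or_lt with h | h
  · have hf : ⌊t⌋ = m + 1 := by rw [h]; exact_mod_cast Int.floor_intCast (R := ℝ) (m + 1)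
    rw [curve, hf, Int.fract, hf, h]
    push_cast
    rw [sub_self, zero_mul, add_sub_cancel_left, one_mul, K.join]
  · have hf : ⌊t⌋ = m := Int.floor_eq_iff.2 ⟨h0, h⟩
    rw [curve, Int.fract, hf]

lemma curve_intCast (m : ℤ) : K.curve m = K.g m 0 := by
  rw [K.curve_eq le_rfl (by linarith), sub_self, zero_mul]

lemma continuous_of_piecewise {f : ℝ → ℂ} {F : ℤ → ℝ → ℂ} (hF : ∀ m, Continuous (F m))
    (h : ∀ (m : ℤ) (t : ℝ), m ≤ t → t ≤ m + 1 → f t = F m t) : Continuous f := by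
  have hlf : LocallyFinite fun m : ℤ => Set.Icc (m : ℝ) (m + 1) :=
    locallyFinite_Icc_of_tendsto tendsto_intCast_atTop_atTop
      (Filter.tendsto_atBot_add_const_right _ _ (tendsto_intCast_atBot_iff.2 Filter.tendsto_id))
  refine hlf.continuous (Set.eq_univ_of_forall fun t => Set.mem_iUnion.2
    ⟨⌊t⌋, Int.floor_le t, (Int.lt_floor_add_one t).le⟩) (fun m => isClosed_Icc) fun m => ?_
  exact (hF m).continuousOn.congr fun t ht => h m t ht.1 ht.2

lemma continuous_g (m : ℤ) : Continuous (K.g m) :=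
  continuous_iff_continuousAt.2 fun t => (K.hasDerivAt m t).continuousAt

lemma continuous_curve : Continuous K.curve := by
  refine continuous_of_piecewise (F := fun m t => K.g m ((t - m) * K.ℓ m)) (fun m => ?_)
    fun m t h0 h1 => K.curve_eq h0 h1
  have := K.continuous_g m
  fun_prop

lemma periodic_curve : Function.Periodic K.curve n := by
  intro t
  rw [curve, curve, Int.floor_add_natCast, Int.fract_add_natCast, K.periodic_g, K.periodic_length]

/-- A property of the arcs and of a small positive number holds uniformly, because there are
finitely many arcs. -/
lemma exists_uniform {n : ℕ} (hn : 0 < n) {P : ℤ → ℝ → Prop}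
    (hper : ∀ m δ, P (m + n) δ ↔ P m δ)
    (hmono : ∀ m δ δ', 0 < δ' → δ' ≤ δ → P m δ → P m δ') (h : ∀ m, ∃ δ > 0, P m δ) :
    ∃ δ > 0, ∀ m, P m δ := by
  choose δ hδ hP using h
  have hne : (Finset.range n).Nonempty := ⟨0, Finset.mem_range.2 hn⟩
  refine ⟨(Finset.range n).inf' hne fun m => δ m, ?_, fun m => ?_⟩
  · exact (Finset.lt_inf'_iff hne).2 fun m _ => hδ m
  · have hpos : 0 < (Finset.range n).inf' hne fun m => δ m :=
      (Finset.lt_inf'_iff hne).2 fun m _ => hδ m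
    have hn' : (0 : ℤ) < n := by exact_mod_cast hn
    have hperq : ∀ (q : ℤ) (m : ℤ) (δ : ℝ), P (m + q * n) δ ↔ P m δ := by
      intro q
      induction q using Int.induction_on with
      | zero => intro m δ; simp
      | succ i ih => intro m δ; rw [← ih m δ, ← hper (m + i * n) δ]; ring_nf
      | pred i ih => intro m δ; rw [← ih m δ, ← hper (m + (-i - 1) * n) δ]; ring_nf
    have hr := Int.emod_nonneg m hn'.ne'
    have hr' := Int.emod_lt_of_pos m hn'
    have e := Int.emod_add_mul_ediv m n
    rw [← e, mul_comm, hperq]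
    obtain ⟨k, hk⟩ := Int.eq_ofNat_of_zero_le hr
    rw [hk] at hr' ⊢
    refine hmono k (δ k) _ hpos ?_ (hP k)
    exact Finset.inf'_le (fun m : ℕ => δ m) (Finset.mem_range.2 (by exact_mod_cast hr'))

/-- Parameter lengths which are so small that the tangent turns little along every piece of an arc
of this length, and that the pieces of this length at the ends of the arcs are convex. -/
structure IsSmall (δ : ℝ) : Prop where
  pos : 0 < δ
  le : δ ≤ 1 / 4
  close : ∀ m, ∀ u ∈ Set.Icc 0 (K.ℓ m), ∀ v ∈ Set.Icc 0 (K.ℓ m), |u - v| ≤ δ * K.ℓ m →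
    |K.φ m u - K.φ m v| < Real.pi / 2
  convex_start : ∀ m, StrictMonoOn (K.φ m) (Set.Icc 0 (δ * K.ℓ m))
  convex_end : ∀ m, StrictMonoOn (K.φ m) (Set.Icc (K.ℓ m - δ * K.ℓ m) (K.ℓ m))

variable {K} in
lemma IsSmall.mono {δ δ' : ℝ} (h : K.IsSmall δ) (h0 : 0 < δ') (h1 : δ' ≤ δ) : K.IsSmall δ' := by
  have h2 : ∀ m, δ' * K.ℓ m ≤ δ * K.ℓ m := fun m =>
    mul_le_mul_of_nonneg_right h1 (K.length_pos m).le
  exact ⟨h0, h1.trans h.le, fun m u hu v hv huv => h.close m u hu v hv (huv.trans (h2 m)),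
    fun m => (h.convex_start m).mono (Set.Icc_subset_Icc_right (h2 m)),
    fun m => (h.convex_end m).mono (Set.Icc_subset_Icc_left (by linarith [h2 m]))⟩

lemma exists_isSmall : ∃ δ, K.IsSmall δ := by
  obtain ⟨δ, hδ, h⟩ := exists_uniform K.pos
    (P := fun m δ => (∀ u ∈ Set.Icc 0 (K.ℓ m), ∀ v ∈ Set.Icc 0 (K.ℓ m), |u - v| ≤ δ * K.ℓ m →
      |K.φ m u - K.φ m v| < Real.pi / 2) ∧ StrictMonoOn (K.φ m) (Set.Icc 0 (δ * K.ℓ m)) ∧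
      StrictMonoOn (K.φ m) (Set.Icc (K.ℓ m - δ * K.ℓ m) (K.ℓ m)))
    (fun m δ => by rw [K.periodic_angle, K.periodic_length])
    (fun m δ δ' _ h1 h => by
      have h2 : δ' * K.ℓ m ≤ δ * K.ℓ m := mul_le_mul_of_nonneg_right h1 (K.length_pos m).le
      exact ⟨fun u hu v hv huv => h.1 u hu v hv (huv.trans h2),
        h.2.1.mono (Set.Icc_subset_Icc_right h2),
        h.2.2.mono (Set.Icc_subset_Icc_left (by linarith))⟩)
    (fun m => by
      have hℓ := K.length_pos m
      obtain ⟨r, hr, h1⟩ := K.convex_start m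
      obtain ⟨r', hr', h2⟩ := K.convex_end m
      have huc := (isCompact_Icc (a := 0) (b := K.ℓ m)).uniformContinuousOn_of_continuous
        (K.continuous_angle m).continuousOn
      obtain ⟨d, hd, h3⟩ := Metric.uniformContinuousOn_iff.1 huc _ (half_pos Real.pi_pos)
      refine ⟨min (d / 2) (min r r') / K.ℓ m, by positivity, ?_⟩
      rw [div_mul_cancel₀ _ hℓ.ne']
      have e1 : min (d / 2) (min r r') ≤ d / 2 := min_le_left _ _
      have e2 : min (d / 2) (min r r') ≤ r := (min_le_right _ _).trans (min_le_left _ _)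
      have e3 : min (d / 2) (min r r') ≤ r' := (min_le_right _ _).trans (min_le_right _ _)
      exact ⟨fun u hu v hv huv => h3 u hu v hv (by rw [Real.dist_eq]; linarith),
        h1.mono (Set.Icc_subset_Icc_right e2), h2.mono (Set.Icc_subset_Icc_left (by linarith))⟩)
  refine ⟨min δ (1 / 4), lt_min hδ (by norm_num), min_le_right _ _, ?_, ?_, ?_⟩
  all_goals
    have h2 : ∀ m, min δ (1 / 4) * K.ℓ m ≤ δ * K.ℓ m := fun m =>
      mul_le_mul_of_nonneg_right (min_le_left _ _) (K.length_pos m).le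
  · exact fun m u hu v hv huv => (h m).1 u hu v hv (huv.trans (h2 m))
  · exact fun m => (h m).2.1.mono (Set.Icc_subset_Icc_right (h2 m))
  · exact fun m => (h m).2.2.mono (Set.Icc_subset_Icc_left (by linarith [h2 m]))

/-- The parameter on the `m`-th arc of a time in `[m, m + 1]`. -/
lemma param_mem {m : ℤ} {t : ℝ} (h0 : m ≤ t) (h1 : t ≤ m + 1) :
    (t - m) * K.ℓ m ∈ Set.Icc 0 (K.ℓ m) := by
  have hℓ := K.length_pos m
  constructor <;> nlinarith

variable {K}

lemma IsSmall.re_secant_pos {δ : ℝ} (h : K.IsSmall δ) {m : ℤ} {s t a : ℝ} (hs : m ≤ s) (hst : s < t)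
    (ht : t ≤ m + 1) (ha : m ≤ a) (ha' : a ≤ m + 1) (h1 : |s - a| ≤ δ) (h2 : |t - a| ≤ δ) :
    0 < ((K.curve t - K.curve s) * cis (-K.φ m ((a - m) * K.ℓ m))).re := by
  have hℓ := K.length_pos m
  rw [K.curve_eq hs (hst.le.trans ht), K.curve_eq (hs.trans hst.le) ht]
  refine CheegerCluster.re_secant_pos (K.hasDerivAt m)
    (mul_lt_mul_of_pos_right (by linarith) hℓ) fun w hw => h.close m w ?_ _ (K.param_mem ha ha') ?_
  · exact ⟨(K.param_mem hs (hst.le.trans ht)).1.trans hw.1.le,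
      hw.2.le.trans (K.param_mem (hs.trans hst.le) ht).2⟩
  · rw [abs_le] at *
    constructor <;> nlinarith [hw.1, hw.2]

/-- A secant across a cusp points to the right of the tangent at the cusp. -/
lemma IsSmall.im_secant_neg {δ : ℝ} (h : K.IsSmall δ) {m : ℤ} {s t : ℝ}
    (hs : m + 1 - δ ≤ s) (hs' : s ≤ m + 1) (ht : m + 1 ≤ t) (ht' : t ≤ m + 1 + δ) (hst : s < t) :
    ((K.curve t - K.curve s) * cis (-K.φ m (K.ℓ m))).im < 0 := by
  have hδ := h.pos
  have hδ' := h.le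
  have e : ((m + 1 : ℤ) : ℝ) = m + 1 := by push_cast; ring
  have hA : s < m + 1 →
      ((K.curve (m + 1 : ℤ) - K.curve s) * cis (-K.φ m (K.ℓ m))).im < 0 := by
    intro hs1
    have hℓ := K.length_pos m
    have h1 := CheegerCluster.im_secant_pos (K.hasDerivAt m) (u := (s - m) * K.ℓ m) (v := K.ℓ m)
      (ψ := K.φ m (K.ℓ m) - Real.pi) (by nlinarith) fun w hw => by
        have hw1 : K.ℓ m - δ * K.ℓ m ≤ w := by nlinarith [hw.1]
        have hm := h.convex_end m ⟨hw1, hw.2.le⟩ ⟨by nlinarith, le_rfl⟩ hw.2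
        have hc := abs_lt.1 (h.close m w ⟨by nlinarith, hw.2.le⟩ (K.ℓ m) ⟨hℓ.le, le_rfl⟩
          (by rw [abs_le]; constructor <;> linarith [hw.2]))
        constructor <;> linarith [Real.pi_pos]
    rw [K.curve_intCast, K.join, K.curve_eq (by linarith) hs']
    have e2 : cis (-(K.φ m (K.ℓ m) - Real.pi)) = -cis (-K.φ m (K.ℓ m)) := by
      rw [neg_sub, sub_eq_neg_add, cis_add_pi]
    rw [e2, mul_neg, Complex.neg_im] at h1
    linarith
  have hB : m + 1 < t →
      ((K.curve t - K.curve (m + 1 : ℤ)) * cis (-K.φ m (K.ℓ m))).im < 0 := by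
    intro ht1
    have hℓ := K.length_pos (m + 1)
    have h1 := CheegerCluster.im_secant_pos (K.hasDerivAt (m + 1)) (u := 0)
      (v := (t - (m + 1 : ℤ)) * K.ℓ (m + 1))
      (ψ := K.φ (m + 1) 0) (mul_pos (by rw [e]; linarith) hℓ) fun w hw => by
        have hw2 : w ≤ δ * K.ℓ (m + 1) := by
          have := hw.2
          rw [e] at this
          nlinarith
        have hm := h.convex_start (m + 1) ⟨le_rfl, by nlinarith⟩ ⟨hw.1.le, hw2⟩ hw.1
        have hc := abs_lt.1 (h.close (m + 1) w ⟨hw.1.le, by nlinarith⟩ 0 ⟨le_rfl, hℓ.le⟩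
          (by rw [sub_zero, abs_of_pos hw.1]; exact hw2))
        constructor <;> linarith [Real.pi_pos]
    rw [K.curve_intCast, K.curve_eq (m := m + 1) (by rw [e]; exact ht) (by rw [e]; linarith)]
    have e2 : cis (-K.φ (m + 1) 0) = -cis (-K.φ m (K.ℓ m)) := by
      obtain ⟨k, hk⟩ := cis_eq_cis_iff.1 ((K.cusp m).trans (cis_add_pi _).symm)
      rw [← cis_add_pi]
      exact cis_eq_cis_iff.2 ⟨-k - 1, by push_cast; linarith⟩
    rw [e2, mul_neg, Complex.neg_im] at h1
    linarith
  have esum : K.curve t - K.curve s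
      = (K.curve t - K.curve (m + 1 : ℤ)) + (K.curve (m + 1 : ℤ) - K.curve s) := by ring
  rw [esum, add_mul, Complex.add_im]
  rcases hs'.eq_or_lt with h1 | h1
  · have h2 : m + 1 < t := by linarith
    have e3 : K.curve (m + 1 : ℤ) - K.curve s = 0 := by rw [h1, e, sub_self]
    rw [e3, zero_mul, Complex.zero_im]
    linarith [hB h2]
  · rcases ht.eq_or_lt with h2 | h2
    · have e3 : K.curve t - K.curve (m + 1 : ℤ) = 0 := by rw [← h2, e, sub_self]
      rw [e3, zero_mul, Complex.zero_im]
      linarith [hA h1]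
    · linarith [hA h1, hB h2]

lemma IsSmall.secant_ne {δ : ℝ} (h : K.IsSmall δ) (s : ℝ) : K.curve (s + δ) - K.curve s ≠ 0 := by
  have hδ := h.pos
  have hδ' := h.le
  have h1 := Int.floor_le s
  have h2 := Int.lt_floor_add_one s
  intro h0
  rcases le_total (s + δ) (⌊s⌋ + 1) with h3 | h3
  · have := h.re_secant_pos h1 (by linarith) h3 h1 h2.le (by simpa using hδ.le)
      (by simp [abs_of_pos hδ])
    rw [h0, zero_mul] at this
    simp at this
  · have := h.im_secant_neg (m := ⌊s⌋) (s := s) (t := s + δ) (by linarith) h2.le h3 (by linarith)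
      (by linarith)
    rw [h0, zero_mul] at this
    simp at this

/-- The rotation of the short secants across a cusp, in terms of principal arguments: these secants
stay on the right of the tangent. -/
lemma IsSmall.abs_window_lt {δ : ℝ} (h : K.IsSmall δ) {B : ℝ → ℝ} (hB : Continuous B)
    (hBa : ∀ s, IsAngleOf (B s) (K.curve (s + δ) - K.curve s)) (m : ℤ) :
    B (m + 1) - B (m + 1 - δ) = ((K.curve (m + 1 + δ) - K.curve (m + 1)) *
      cis (-K.φ m (K.ℓ m))).arg - ((K.curve (m + 1) - K.curve (m + 1 - δ)) *
      cis (-K.φ m (K.ℓ m))).arg ∧ |B (m + 1) - B (m + 1 - δ)| < Real.pi := by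
  have hδ := h.pos
  have hc := K.continuous_curve
  have hneg : ∀ s ∈ Set.Icc (m + 1 - δ : ℝ) (m + 1),
      ((K.curve (s + δ) - K.curve s) * cis (-K.φ m (K.ℓ m))).im < 0 := fun s hs =>
    h.im_secant_neg hs.1 hs.2 (by linarith [hs.1]) (by linarith [hs.2]) (by linarith)
  have h1 : (m + 1 - δ : ℝ) ∈ Set.Icc (m + 1 - δ : ℝ) (m + 1) := ⟨le_rfl, by linarith⟩
  have h2 : (m + 1 : ℝ) ∈ Set.Icc (m + 1 - δ : ℝ) (m + 1) := ⟨by linarith, le_rfl⟩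
  have h3 := angle_sub_eq_arg_sub isPreconnected_Icc (f := fun s => K.curve (s + δ) - K.curve s)
    (by fun_prop) hB.continuousOn (fun s _ => hBa s) (w := cis (-K.φ m (K.ℓ m)))
    (fun s hs => Complex.mem_slitPlane_iff.2 (Or.inr (hneg s hs).ne)) h1 h2
  have h4 := Complex.arg_neg_iff.2 (hneg _ h1)
  have h5 := Complex.arg_neg_iff.2 (hneg _ h2)
  have h6 := Complex.neg_pi_lt_arg ((K.curve (m + 1 - δ + δ) - K.curve (m + 1 - δ)) *
    cis (-K.φ m (K.ℓ m)))
  have h7 := Complex.neg_pi_lt_arg ((K.curve (m + 1 + δ) - K.curve (m + 1)) *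
    cis (-K.φ m (K.ℓ m)))
  refine ⟨by rw [h3, sub_add_cancel], ?_⟩
  rw [h3, abs_lt]
  constructor <;> linarith

/-- The rotation of the short secants along an arc and the following cusp is that of the tangent, up
to a term which cancels in the sum over the chain. -/
lemma IsSmall.rotation_step {δ : ℝ} (h : K.IsSmall δ) {B : ℝ → ℝ} (hB : Continuous B)
    (hBa : ∀ s, IsAngleOf (B s) (K.curve (s + δ) - K.curve s)) (m : ℤ) :
    B (m + 1) - B m = K.φ m (K.ℓ m) - K.φ m 0 - Real.pi +
      (((K.curve ((m + 1 : ℤ) + δ) - K.curve (m + 1 : ℤ)) * cis (-K.φ (m + 1) 0)).arg -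
        ((K.curve (m + δ) - K.curve m) * cis (-K.φ m 0)).arg) := by
  have hδ := h.pos
  have hδ' := h.le
  have hc := K.continuous_curve
  have hA := K.continuous_angle m
  have hcis := continuous_cis
  have hℓ := K.length_pos m
  have e : ((m + 1 : ℤ) : ℝ) = m + 1 := by push_cast; ring
  -- along the arc
  have h1 : (m : ℝ) ∈ Set.Icc (m : ℝ) (m + 1 - δ) := ⟨le_rfl, by linarith⟩
  have h2 : (m + 1 - δ : ℝ) ∈ Set.Icc (m : ℝ) (m + 1 - δ) := ⟨by linarith, le_rfl⟩
  have hpos : ∀ s ∈ Set.Icc (m : ℝ) (m + 1 - δ),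
      0 < ((K.curve (s + δ) - K.curve s) * cis (-K.φ m ((s - m) * K.ℓ m))).re := fun s hs =>
    h.re_secant_pos hs.1 (by linarith) (by linarith [hs.2]) hs.1 (by linarith [hs.2])
      (by simpa using hδ.le) (by simp [abs_of_pos hδ])
  have h3 := angle_sub_eq_arg_sub isPreconnected_Icc
    (f := fun s => (K.curve (s + δ) - K.curve s) * cis (-K.φ m ((s - m) * K.ℓ m)))
    (A := fun s => B s + -K.φ m ((s - m) * K.ℓ m)) (by fun_prop) (by fun_prop)
    (fun s _ => (hBa s).mul (isAngleOf_cis _)) (w := 1)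
    (fun s hs => by rw [mul_one]; exact Complex.mem_slitPlane_iff.2 (Or.inl (hpos s hs))) h1 h2
  have h4 := hpos _ h2
  rw [sub_add_cancel] at h3 h4
  simp only [mul_one, sub_self, zero_mul] at h3
  -- across the cusp
  have h5 := (h.abs_window_lt hB hBa m).1
  have h6 : ((K.curve (m + 1 + δ) - K.curve (m + 1)) * cis (-K.φ m (K.ℓ m))).arg
      = ((K.curve (m + 1 + δ) - K.curve (m + 1)) * cis (-K.φ (m + 1) 0)).arg - Real.pi := by
    have e2 : cis (-K.φ m (K.ℓ m)) = -cis (-K.φ (m + 1) 0) := by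
      obtain ⟨k, hk⟩ := cis_eq_cis_iff.1 ((K.cusp m).trans (cis_add_pi _).symm)
      rw [← cis_add_pi]
      exact cis_eq_cis_iff.2 ⟨k, by linarith⟩
    have h7 := h.im_secant_neg (m := m) (s := m + 1) (t := m + 1 + δ) (by linarith) le_rfl
      (by linarith) le_rfl (by linarith)
    rw [e2, mul_neg] at h7 ⊢
    rw [Complex.neg_im] at h7
    exact Complex.arg_neg_eq_arg_sub_pi_of_im_pos (by linarith)
  set Y := (K.curve (m + 1) - K.curve (m + 1 - δ)) * cis (-K.φ m ((m + 1 - δ - m) * K.ℓ m)) with hY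
  have h8 : ((K.curve (m + 1) - K.curve (m + 1 - δ)) * cis (-K.φ m (K.ℓ m))).arg
      = Y.arg + (K.φ m ((m + 1 - δ - m) * K.ℓ m) - K.φ m (K.ℓ m)) := by
    have e3 : (K.curve (m + 1) - K.curve (m + 1 - δ)) * cis (-K.φ m (K.ℓ m))
        = Y * cis (K.φ m ((m + 1 - δ - m) * K.ℓ m) - K.φ m (K.ℓ m)) := by
      rw [hY, sub_eq_add_neg (K.φ m _) (K.φ m (K.ℓ m)), cis_add]
      linear_combination (-(K.curve (m + 1) - K.curve (m + 1 - δ)) * cis (-K.φ m (K.ℓ m))) *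
        cis_neg_mul_self (K.φ m ((m + 1 - δ - m) * K.ℓ m))
    rw [e3]
    have h9 := arg_mem_of_re_pos h4
    have h10 := abs_lt.1 (h.close m ((m + 1 - δ - m) * K.ℓ m) ⟨by nlinarith, by nlinarith⟩ (K.ℓ m)
      ⟨hℓ.le, le_rfl⟩ (by rw [abs_le]; constructor <;> nlinarith))
    have hY0 : Y ≠ 0 := fun h0 => by rw [h0] at h4; simp at h4
    refine arg_eq_of_isAngleOf ((isAngleOf_arg Y).mul (isAngleOf_cis _))
      (mul_ne_zero hY0 (cis_ne_zero _)) ⟨by linarith [h9.1], by linarith [h9.2]⟩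
  rw [e]
  linarith

/-- The short secants of a chain rotate in total as much as its tangent. -/
lemma IsSmall.rotation_eq_turning {δ : ℝ} (h : K.IsSmall δ) {B : ℝ → ℝ} (hB : Continuous B)
    (hBa : ∀ s, IsAngleOf (B s) (K.curve (s + δ) - K.curve s)) :
    B (0 + n) - B 0 = K.turning := by
  set e : ℤ → ℝ := fun m => ((K.curve (m + δ) - K.curve m) * cis (-K.φ m 0)).arg with he
  have hind : ∀ k : ℕ, B k - B 0 = ∑ m ∈ Finset.range k,
      (K.φ m (K.ℓ m) - K.φ m 0 - Real.pi) + (e k - e 0) := by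
    intro k
    induction k with
    | zero => simp
    | succ k ih =>
      have h1 := h.rotation_step hB hBa k
      rw [Finset.sum_range_succ]
      push_cast at h1 ⊢
      simp only [he] at ih ⊢
      push_cast at h1 ih ⊢
      linarith
  have hn : e n = e 0 := by
    have h2 : K.φ n = K.φ 0 := by simpa using K.periodic_angle 0
    have h3 := K.periodic_curve δ
    have h4 := K.periodic_curve 0
    rw [zero_add] at h4
    simp only [he, Int.cast_natCast, Int.cast_zero, zero_add, h2]
    rw [add_comm (n : ℝ) δ, h3, h4]
  rw [zero_add, hind n, hn, sub_self, add_zero, turning]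

end CuspChain

/-! ### The turning of chains which do not cross themselves -/

namespace CuspChain

/-- The chain may touch itself, at interior points of its arcs and with opposite directions, but it
does not cross itself. -/
structure NonCrossing {n : ℕ} (K : CuspChain n) : Prop where
  approx : ∀ δ > (0 : ℝ), ∀ η > (0 : ℝ), ∃ c' : ℝ → ℂ, Continuous c' ∧ Function.Periodic c' n ∧
      (∀ t, ‖c' t - K.curve t‖ < η) ∧ ∀ s t, δ ≤ t - s → t - s ≤ n - δ → c' s ≠ c' t
  cusp_simple : ∀ (m : ℤ) (t : ℝ), K.curve t = K.curve m → ∃ q : ℤ, t = m + q * n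
  double : ∀ (m m' : ℤ) (s t : ℝ), s ∈ Set.Ioo (m : ℝ) (m + 1) → t ∈ Set.Ioo (m' : ℝ) (m' + 1) →
    K.curve s = K.curve t → (∃ q : ℤ, t = s + q * n) ∨
      cis (K.φ m' ((t - m') * K.ℓ m')) = -cis (K.φ m ((s - m) * K.ℓ m))

variable {n : ℕ} {K : CuspChain n}

lemma NonCrossing.almostSimple (hK : K.NonCrossing) {δ : ℝ} (h : K.IsSmall δ) :
    AlmostSimple K.curve n δ := by
  have hn : (1 : ℝ) ≤ n := by exact_mod_cast K.pos
  exact ⟨K.continuous_curve, K.periodic_curve, h.pos, by linarith [h.le], hK.approx δ h.pos,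
    h.secant_ne⟩

/-- If a chain lies on the left of its tangent at a simple smooth point, its turning is `2π`. -/
lemma NonCrossing.turning_eq_two_pi (hK : K.NonCrossing) {m : ℤ} {x : ℝ}
    (hx : x ∈ Set.Ioo (m : ℝ) (m + 1))
    (hhalf : ∀ t, 0 ≤ ((K.curve t - K.curve x) * cis (-K.φ m ((x - m) * K.ℓ m))).im)
    (hsimple : ∀ t, K.curve t = K.curve x → ∃ q : ℤ, t = x + q * n) :
    K.turning = 2 * Real.pi := by
  obtain ⟨δ₀, h₀⟩ := K.exists_isSmall
  have hx1 := sub_pos.2 hx.1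
  have hx2 := sub_pos.2 hx.2
  have h := h₀.mono (δ' := min δ₀ (min (x - m) (m + 1 - x))) (lt_min h₀.pos (lt_min hx1 hx2))
    (min_le_left _ _)
  have hδ1 : min δ₀ (min (x - m) (m + 1 - x)) ≤ x - m := (min_le_right _ _).trans (min_le_left _ _)
  have hδ2 : min δ₀ (min (x - m) (m + 1 - x)) ≤ m + 1 - x :=
    (min_le_right _ _).trans (min_le_right _ _)
  set δ := min δ₀ (min (x - m) (m + 1 - x))
  have hδ := h.pos
  have hAS := hK.almostSimple h
  have hc := K.continuous_curve
  obtain ⟨B, hB, hBa⟩ := exists_continuous_angle (f := fun s => K.curve (s + δ) - K.curve s)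
    (by fun_prop) hAS.secant_ne
  rw [← h.rotation_eq_turning hB hBa]
  refine hAS.rotation_eq_two_pi hB hBa hhalf (fun t ht h0 => ?_) (fun s hs => ?_) 0
  · obtain ⟨q, hq⟩ := hsimple t (sub_eq_zero.1 h0)
    exact false_of_eq_add_int_mul hδ hq ht.1 ht.2
  · refine h.re_secant_pos (by linarith [hs.1]) (by linarith) (by linarith [hs.2]) hx.1.le hx.2.le
      ?_ ?_ <;> rw [abs_le] <;> constructor <;> linarith [hs.1, hs.2]

/-- If a chain lies on one side of a line through one of its cusps, its turning is an odd multiple of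
`2π`, and it is at least `-2π`. -/
lemma NonCrossing.turning_of_cusp (hK : K.NonCrossing) {m : ℤ} {ψ : ℝ}
    (hhalf : ∀ t, 0 ≤ ((K.curve t - K.curve m) * cis (-ψ)).im) :
    ∃ N : ℤ, -1 ≤ N ∧ K.turning = 2 * (Real.pi * (2 * N + 1)) := by
  obtain ⟨δ, h⟩ := K.exists_isSmall
  have hδ := h.pos
  have hAS := hK.almostSimple h
  have hc := K.continuous_curve
  obtain ⟨B, hB, hBa⟩ := exists_continuous_angle (f := fun s => K.curve (s + δ) - K.curve s)
    (by fun_prop) hAS.secant_ne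
  obtain ⟨N, h1, h2, -⟩ := hAS.rotation_of_support hB hBa hhalf (fun t ht h0 => by
    obtain ⟨q, hq⟩ := hK.cusp_simple m t (sub_eq_zero.1 h0)
    exact false_of_eq_add_int_mul hδ hq ht.1 ht.2)
  refine ⟨N, ?_, by rw [← h.rotation_eq_turning hB hBa, h1]⟩
  have h3 := (h.abs_window_lt hB hBa (m - 1)).2
  have e : ((m - 1 : ℤ) : ℝ) + 1 = m := by push_cast; ring
  rw [e] at h3
  have h4 := (abs_le.1 h2).1
  have h5 := (abs_lt.1 h3).1
  have h6 : (-2 : ℝ) < 2 * N + 1 := by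
    by_contra hcon
    push Not at hcon
    nlinarith [Real.pi_pos]
  have h7 : ((-2 : ℤ) : ℝ) < ((2 * N + 1 : ℤ) : ℝ) := by push_cast; exact h6
  have h8 : -2 < 2 * N + 1 := by exact_mod_cast h7
  omega

/-- A chain of arcs which are all convex on their left has turning at least `-2nπ/3`: its turning is
at least `-2π`, and if it is `-2π`, then there are at least three cusps. -/
lemma NonCrossing.le_turning_of_convex (hK : K.NonCrossing)
    (hconv : ∀ m, StrictMonoOn (K.φ m) (Set.Icc 0 (K.ℓ m))) :
    -(2 * Real.pi / 3) * n ≤ K.turning := by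
  have hn : (0 : ℝ) < n := by exact_mod_cast K.pos
  have hπ := Real.pi_pos
  -- a lowest point of the chain
  obtain ⟨x, hx⟩ : ∃ x, ∀ t, (K.curve x).im ≤ (K.curve t).im := by
    obtain ⟨x, -, hx⟩ := (isCompact_Icc (a := (0 : ℝ)) (b := n)).exists_isMinOn
      ⟨0, le_rfl, hn.le⟩ (Complex.continuous_im.comp K.continuous_curve).continuousOn
    refine ⟨x, fun t => ?_⟩
    obtain ⟨y, hy, hty⟩ := K.periodic_curve.exists_mem_Ico₀ hn t
    rw [hty]
    exact hx ⟨hy.1, hy.2.le⟩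
  by_cases hint : ∃ m : ℤ, x = m
  · obtain ⟨m, rfl⟩ := hint
    obtain ⟨N, hN, hN'⟩ := hK.turning_of_cusp (m := m) (ψ := 0) fun t => by
      rw [neg_zero, cis_zero, mul_one, Complex.sub_im, sub_nonneg]; exact hx t
    have hlt : -(n * Real.pi) < K.turning := by
      have h1 : ∑ m ∈ Finset.range n, (-Real.pi) < K.turning :=
        Finset.sum_lt_sum_of_nonempty ⟨0, Finset.mem_range.2 K.pos⟩ fun m _ => by
          have := hconv m ⟨le_rfl, (K.length_pos m).le⟩ ⟨(K.length_pos m).le, le_rfl⟩ (K.length_pos m)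
          linarith
      simpa using h1
    rcases hN.eq_or_lt with h | h
    · rw [← h] at hN'
      push_cast at hN'
      have h2 : (2 : ℝ) < n := by
        by_contra hcon
        push Not at hcon
        nlinarith
      have h3 : (3 : ℝ) ≤ n := by
        have : 2 < n := by exact_mod_cast h2
        exact_mod_cast this
      nlinarith
    · have h0 : (0 : ℝ) ≤ N := by exact_mod_cast (by omega : 0 ≤ N)
      rw [hN']
      have : 0 ≤ Real.pi * (2 * N + 1) := by positivity
      nlinarith
  · -- at a smooth lowest point the tangent is horizontal, and convexity determines its orientation
    have hlow : ∀ (m : ℤ) (y : ℝ), y ∈ Set.Ioo (m : ℝ) (m + 1) → (K.curve y).im = (K.curve x).im →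
        cis (K.φ m ((y - m) * K.ℓ m)) = 1 := by
      intro m y hy hyx
      have hℓ := K.length_pos m
      set u := (y - m) * K.ℓ m with hu
      have hu0 : 0 < u := mul_pos (sub_pos.2 hy.1) hℓ
      have hu1 : u < K.ℓ m := by nlinarith [hy.2]
      have hgm : ∀ w ∈ Set.Icc 0 (K.ℓ m), (K.g m u).im ≤ (K.g m w).im := by
        intro w hw
        have e1 : K.curve (m + w / K.ℓ m) = K.g m w := by
          rw [K.curve_eq (m := m) (by have := div_nonneg hw.1 hℓ.le; linarith)
            (by have := (div_le_one hℓ).2 hw.2; linarith), add_sub_cancel_left,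
            div_mul_cancel₀ _ hℓ.ne']
        have e2 : K.curve y = K.g m u := K.curve_eq hy.1.le hy.2.le
        rw [← e1, ← e2, hyx]
        exact hx _
      have hd : HasDerivAt (fun w => (K.g m w).im) (cis (K.φ m u)).im u :=
        Complex.imCLM.hasFDerivAt.comp_hasDerivAt u (K.hasDerivAt m u)
      have hmin : IsLocalMin (fun w => (K.g m w).im) u := by
        filter_upwards [Icc_mem_nhds hu0 hu1] with w hw using hgm w hw
      have h0 := hmin.hasDerivAt_eq_zero hd
      rw [cis_im] at h0
      have hcos := Real.sin_sq_add_cos_sq (K.φ m u)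
      rw [h0] at hcos
      have hfac : (Real.cos (K.φ m u) - 1) * (Real.cos (K.φ m u) + 1) = 0 := by linarith
      rcases mul_eq_zero.1 hfac with h1 | h1
      · apply Complex.ext
        · rw [cis_re, Complex.one_re]; linarith
        · rw [cis_im, Complex.one_im, h0]
      · exfalso
        obtain ⟨δ, hδ⟩ := K.exists_isSmall
        have hδ0 := hδ.pos
        set v := min (K.ℓ m) (u + δ * K.ℓ m) with hv
        have huv : u < v := lt_min hu1 (by nlinarith)
        have hv1 : v ≤ K.ℓ m := min_le_left _ _
        have hv2 : v ≤ u + δ * K.ℓ m := min_le_right _ _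
        have h2 := im_secant_pos (K.hasDerivAt m) (ψ := K.φ m u) huv fun w hw => by
          have hw1 : w ≤ K.ℓ m := hw.2.le.trans hv1
          have hw0 : 0 ≤ w := hu0.le.trans hw.1.le
          have h3 := hconv m ⟨hu0.le, hu1.le⟩ ⟨hw0, hw1⟩ hw.1
          have h4 := abs_lt.1 (hδ.close m w ⟨hw0, hw1⟩ u ⟨hu0.le, hu1.le⟩
            (by rw [abs_le]; constructor <;> linarith [hw.1, hw.2]))
          constructor <;> linarith
        have h3 : cis (-K.φ m u) = -1 := by
          apply Complex.ext
          · rw [cis_re, Real.cos_neg, Complex.neg_re, Complex.one_re]; linarith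
          · rw [cis_im, Real.sin_neg, h0]; simp
        rw [h3, mul_neg_one, Complex.neg_im, Complex.sub_im] at h2
        linarith [hgm v ⟨hu0.le.trans huv.le, hv1⟩]
    have hmem : ∀ y : ℝ, (¬ ∃ m : ℤ, y = m) → y ∈ Set.Ioo (⌊y⌋ : ℝ) (⌊y⌋ + 1) := fun y hy =>
      ⟨lt_of_le_of_ne (Int.floor_le y) fun h => hy ⟨_, h.symm⟩, Int.lt_floor_add_one y⟩
    have hxm := hmem x hint
    have h1 := hlow _ x hxm rfl
    have h2 : K.turning = 2 * Real.pi := by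
      refine hK.turning_eq_two_pi hxm (fun t => ?_) fun t ht => ?_
      · have h3 : cis (-K.φ ⌊x⌋ ((x - ⌊x⌋) * K.ℓ ⌊x⌋)) = 1 := by
          have := cis_neg_mul_self (K.φ ⌊x⌋ ((x - ⌊x⌋) * K.ℓ ⌊x⌋))
          rwa [h1, mul_one] at this
        rw [h3, mul_one, Complex.sub_im, sub_nonneg]
        exact hx t
      · have htint : ¬ ∃ m : ℤ, t = m := by
          rintro ⟨m, rfl⟩
          obtain ⟨q, hq⟩ := hK.cusp_simple m x ht.symm
          exact hint ⟨m + q * n, by push_cast; exact hq⟩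
        have htm := hmem t htint
        rcases hK.double _ _ x t hxm htm ht.symm with h3 | h3
        · exact h3
        · rw [h1, hlow _ t htm (by rw [ht])] at h3
          norm_num at h3
    rw [h2]
    nlinarith

end CuspChain

/-! ### Sums over one period of a cyclic sequence -/

/-- The successor of `i` among the integers satisfying `p`, when no two consecutive integers
violate `p`. -/
def nextIndex (p : ℤ → Prop) (i : ℤ) : ℤ :=
  open Classical in if p (i + 1) then i + 1 else i + 2

lemma sum_range_succ_shift {Λ : ℕ} {F : ℤ → ℝ} (hF : ∀ i, F (i + Λ) = F i) :
    ∑ i ∈ Finset.range Λ, F (i + 1) = ∑ i ∈ Finset.range Λ, F i := by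
  have h1 := Finset.sum_range_succ (fun i : ℕ => F i) Λ
  have h2 := Finset.sum_range_succ' (fun i : ℕ => F i) Λ
  have h3 := hF 0
  rw [zero_add] at h3
  push_cast at h1 h2
  linarith

open Classical in
/-- The increments of `g` between successive indices satisfying `p` add up to its increment over
a period. -/
lemma sum_nextIndex_sub {Λ : ℕ} {p : ℤ → Prop} (hp : ∀ i, p (i + Λ) ↔ p i)
    (hp' : ∀ i, ¬ p (i + 1) → p i) {g : ℤ → ℝ} {c : ℝ} (hg : ∀ i, g (i + Λ) = g i + c) :
    ∑ i ∈ (Finset.range Λ).filter (fun i : ℕ => p i), (g (nextIndex p i) - g i) = c := by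
  set F : ℤ → ℝ := fun i => if p i then 0 else g (i + 1) - g i with hF
  have hFp : ∀ i, F (i + Λ) = F i := fun i => by
    simp only [hF, hp, add_right_comm i (Λ : ℤ) 1, hg]
    split_ifs <;> ring
  have h1 : ∀ i : ℕ, (if p i then g (nextIndex p i) - g i else 0)
      = (g (i + 1) - g i) - F i + F (i + 1) := by
    intro i
    simp only [hF, nextIndex]
    by_cases h : p i
    · by_cases h' : p (i + 1)
      · simp [h, h']
      · simp only [h, h', if_true, if_false]; rw [add_assoc]; norm_num
    · have h' : p (i + 1) := by
        by_contra h'; exact h (hp' i h')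
      simp [h, h']
  rw [Finset.sum_filter, Finset.sum_congr rfl fun i _ => h1 i, Finset.sum_add_distrib,
    Finset.sum_sub_distrib, sum_range_succ_shift hFp]
  have h2 := Finset.sum_range_sub (fun i : ℕ => g i) Λ
  have h3 := hg 0
  rw [zero_add] at h3
  push_cast at h2
  linarith

open Classical in
/-- Each index violating `p` is counted through its predecessor. -/
lemma sum_not_succ {Λ : ℕ} {p : ℤ → Prop} (hp : ∀ i, p (i + Λ) ↔ p i)
    (hp' : ∀ i, ¬ p (i + 1) → p i) :
    ∑ i ∈ (Finset.range Λ).filter (fun i : ℕ => p i), (if p (i + 1) then (0 : ℝ) else 1)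
      = ((Finset.range Λ).filter (fun i : ℕ => ¬ p i)).card := by
  set F : ℤ → ℝ := fun i => if p i then 0 else 1 with hF
  have hFp : ∀ i, F (i + Λ) = F i := fun i => by simp only [hF, hp]
  have h1 : ∀ i : ℕ, (if p i then (if p (i + 1) then (0 : ℝ) else 1) else 0) = F (i + 1) := by
    intro i
    simp only [hF]
    by_cases h : p i
    · simp [h]
    · have h' : p (i + 1) := by
        by_contra h'; exact h (hp' i h')
      simp [h, h']
  rw [Finset.sum_filter, Finset.sum_congr rfl fun i _ => h1 i, sum_range_succ_shift hFp,
    Finset.card_filter]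
  push_cast
  refine Finset.sum_congr rfl fun i _ => ?_
  simp only [hF]
  by_cases h : p i <;> simp [h]

/-! ### Runs: the boundary pieces between successive inner junction arcs -/

namespace ArcDecomposition

variable {T Ω : Set ℂ} (D : ArcDecomposition T Ω)

lemma numJunction_pos : 0 < D.numJunction := by
  rw [Nat.pos_iff_ne_zero]
  intro h
  have h1 := D.node_period 0
  have := D.length_pos
  rw [h] at h1
  simp at h1
  linarith

lemma node_add_mul (i q : ℤ) : D.node (i + 2 * (q * D.numJunction)) = D.node i + q * D.length := by
  induction q using Int.induction_on with
  | zero => simp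
  | succ q ih =>
    rw [show i + 2 * ((q + 1 : ℤ) * (D.numJunction : ℤ))
      = i + 2 * (q * D.numJunction) + 2 * D.numJunction by ring, D.node_period, ih]
    push_cast; ring
  | pred q ih =>
    have h := D.node_period (i + 2 * ((-q - 1 : ℤ) * (D.numJunction : ℤ)))
    rw [show i + 2 * ((-q - 1 : ℤ) * (D.numJunction : ℤ)) + 2 * D.numJunction
      = i + 2 * (-q * D.numJunction) by ring, ih] at h
    push_cast at h ⊢
    linarith

lemma exists_of_curve_node_eq {i j : ℤ} (h : D.curve (D.node i) = D.curve (D.node j)) :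
    ∃ q : ℤ, j = i + 2 * (q * D.numJunction) := by
  obtain ⟨q, hq⟩ := D.exists_of_curve_eq h
  exact ⟨q, D.node_strictMono.injective (by rw [hq, D.node_add_mul])⟩

lemma hasCurvature_shift {κ s t : ℝ} (q : ℤ) (h : HasCurvature D.curve κ s t) :
    HasCurvature D.curve κ (s + q * D.length) (t + q * D.length) := by
  intro u hu
  have h1 := h (u - q * D.length) ⟨by linarith [hu.1], by linarith [hu.2]⟩
  have h2 := D.periodic_deriv.int_mul q (u - q * D.length)
  have h3 := D.periodic_deriv.int_mul q s
  rw [sub_add_cancel] at h2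
  rw [h2, h3, h1, sub_sub, add_comm s]

lemma isInner_add_mul (i q : ℤ) : D.IsInner (i + q * D.numJunction) ↔ D.IsInner i := by
  have key : ∀ i q : ℤ, D.IsInner i → D.IsInner (i + q * D.numJunction) := by
    rintro i q ⟨⟨κ, hκ, h1⟩, h2, h3⟩
    unfold IsInner
    rw [show 2 * (i + q * D.numJunction) + 1 = 2 * i + 1 + 2 * (q * D.numJunction) by ring,
      show 2 * (i + q * D.numJunction) + 2 = 2 * i + 2 + 2 * (q * D.numJunction) by ring,
      D.node_add_mul, D.node_add_mul]
    refine ⟨⟨κ, hκ, D.hasCurvature_shift q h1⟩, ?_, ?_⟩ <;> rw [D.curve_add_int_mul] <;> assumption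
  refine ⟨fun h => ?_, key i q⟩
  have := key _ (-q) h
  rwa [neg_mul, add_neg_cancel_right] at this

lemma isInner_add (i : ℤ) : D.IsInner (i + D.numJunction) ↔ D.IsInner i := by
  have := D.isInner_add_mul i 1
  rwa [one_mul] at this

lemma junctionArc_add_mul (i q : ℤ) :
    D.junctionArc (i + q * D.numJunction) = D.junctionArc i := by
  unfold junctionArc
  rw [show 2 * (i + q * D.numJunction) + 1 = 2 * i + 1 + 2 * (q * D.numJunction) by ring,
    show 2 * (i + q * D.numJunction) + 2 = 2 * i + 2 + 2 * (q * D.numJunction) by ring,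
    D.node_add_mul, D.node_add_mul, ← Set.image_add_const_Icc, Set.image_image]
  simp only [D.curve_add_int_mul]

variable {D}

lemma IsBorder.not_isInner (hT : IsOpen T) {i : ℤ} (h : D.IsBorder i) : ¬ D.IsInner i := by
  intro h'
  have h1 := h.1
  rw [hT.frontier_eq] at h1
  exact h1.2 h'.2.1

lemma isBorder_of_not_isInner {i : ℤ} (h : ¬ D.IsInner i) : D.IsBorder i :=
  (D.junction i).resolve_left h

/-- A free arc has an endpoint in the triangle, so it cannot have a border junction arc on either
side. -/
lemma isInner_of_not_isInner_succ (hT : IsOpen T) {i : ℤ} (h : ¬ D.IsInner (i + 1)) :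
    D.IsInner i := by
  by_contra h'
  have h1 := (isBorder_of_not_isInner h).1
  have h2 := (isBorder_of_not_isInner h').2.1
  rw [hT.frontier_eq] at h1 h2
  have h3 := (D.free (i + 1)).2
  rw [show 2 * (i + 1) = 2 * i + 2 by ring] at h3
  rw [show 2 * (i + 1) + 1 = 2 * i + 2 + 1 by ring] at h1
  exact h3.elim h2.2 h1.2

/-- The index of the next inner junction arc. -/
def nextInner (D : ArcDecomposition T Ω) (i : ℤ) : ℤ := nextIndex D.IsInner i

lemma nextInner_of_isInner {i : ℤ} (h : D.IsInner (i + 1)) : D.nextInner i = i + 1 := by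
  simp [nextInner, nextIndex, h]

lemma nextInner_of_not_isInner {i : ℤ} (h : ¬ D.IsInner (i + 1)) : D.nextInner i = i + 2 := by
  simp [nextInner, nextIndex, h]

lemma isInner_nextInner (hT : IsOpen T) (i : ℤ) : D.IsInner (D.nextInner i) := by
  by_cases h : D.IsInner (i + 1)
  · rwa [nextInner_of_isInner h]
  · rw [nextInner_of_not_isInner h]
    by_contra h'
    rw [show i + 2 = i + 1 + 1 by ring] at h'
    exact h (isInner_of_not_isInner_succ hT h')

lemma lt_nextInner (i : ℤ) : i < D.nextInner i := by
  by_cases h : D.IsInner (i + 1)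
  · rw [nextInner_of_isInner h]; omega
  · rw [nextInner_of_not_isInner h]; omega

lemma nextInner_le {i i' : ℤ} (hi' : D.IsInner i') (h : i < i') : D.nextInner i ≤ i' := by
  by_cases h1 : D.IsInner (i + 1)
  · rw [nextInner_of_isInner h1]; omega
  · rw [nextInner_of_not_isInner h1]
    have : i' ≠ i + 1 := fun h2 => h1 (h2 ▸ hi')
    omega

lemma nextInner_add_mul (i q : ℤ) :
    D.nextInner (i + q * D.numJunction) = D.nextInner i + q * D.numJunction := by
  have e : i + q * D.numJunction + 1 = i + 1 + q * D.numJunction := by ring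
  by_cases h : D.IsInner (i + 1)
  · rw [nextInner_of_isInner h, nextInner_of_isInner (by rwa [e, D.isInner_add_mul]), e]
  · rw [nextInner_of_not_isInner h, nextInner_of_not_isInner (by rwa [e, D.isInner_add_mul])]
    ring

variable (D)

/-- The run after the `i`-th (inner) junction arc starts at the end of this arc. -/
def runStart (i : ℤ) : ℝ := D.node (2 * i + 2)

/-- The run after the `i`-th (inner) junction arc ends at the beginning of the next inner junction
arc. -/
def runEnd (i : ℤ) : ℝ := D.node (2 * D.nextInner i + 1)

/-- The rotation of the tangent along a run. -/
def runTurn (i : ℤ) : ℝ := D.angle (D.runEnd i) - D.angle (D.runStart i)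

/-- The rotation of the tangent along a junction arc. -/
def junctionTurn (i : ℤ) : ℝ := D.angle (D.node (2 * i + 2)) - D.angle (D.node (2 * i + 1))

lemma runStart_lt_runEnd (i : ℤ) : D.runStart i < D.runEnd i :=
  D.node_strictMono (by have := D.lt_nextInner i; omega)

open Classical in
/-- Junction arcs and runs together make up the boundary, along which the tangent makes one turn. -/
lemma sum_junctionTurn_add_runTurn (hT : IsOpen T) :
    ∑ i ∈ (Finset.range D.numJunction).filter (fun i : ℕ => D.IsInner i),
      (D.junctionTurn i + D.runTurn i) = 2 * Real.pi := by
  rw [← sum_nextIndex_sub (p := D.IsInner) (g := fun i => D.angle (D.node (2 * i + 1)))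
    (Λ := D.numJunction) D.isInner_add (fun i => isInner_of_not_isInner_succ hT) (c := 2 * Real.pi)]
  · refine Finset.sum_congr rfl fun i _ => ?_
    rw [junctionTurn, runTurn, runEnd, runStart, nextInner]
    ring
  · intro i
    have h := D.node_add_mul (2 * i + 1) 1
    rw [show 2 * (i + (D.numJunction : ℤ)) + 1 = 2 * i + 1 + 2 * (1 * D.numJunction) by ring, h]
    rw [D.angle_add_int_mul]
    simp

lemma angle_freeArc {i : ℤ} {u : ℝ} (hu : u ∈ Set.Icc (D.node (2 * i)) (D.node (2 * i + 1))) :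
    D.angle u = D.angle (D.node (2 * i)) + cheeger Ω * (u - D.node (2 * i)) := by
  have hA := D.continuous_angle
  have h1 := eq_of_mem_two_pi_int (isPreconnected_Icc (a := D.node (2 * i))
    (b := D.node (2 * i + 1))) (f := fun u => D.angle u - cheeger Ω * (u - D.node (2 * i)))
    (by fun_prop) (D.angle (D.node (2 * i))) (fun v hv => ?_) hu
    ⟨le_rfl, (D.node_strictMono (by omega)).le⟩
  · beta_reduce at h1
    rw [sub_self, mul_zero, sub_zero] at h1
    linarith
  · have h2 := (D.free i).1 v hv
    rw [D.deriv_curve, D.deriv_curve] at h2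
    have h3 : cis (D.angle v)
        = cis (D.angle (D.node (2 * i)) + cheeger Ω * (v - D.node (2 * i))) := by
      rw [cis_add]; exact h2
    obtain ⟨n, hn⟩ := cis_eq_cis_iff.1 h3
    exact ⟨n, by linarith⟩

lemma strictMonoOn_angle_freeArc (hh : 0 < cheeger Ω) (i : ℤ) :
    StrictMonoOn D.angle (Set.Icc (D.node (2 * i)) (D.node (2 * i + 1))) := by
  intro u hu v hv huv
  rw [D.angle_freeArc hu, D.angle_freeArc hv]
  have := mul_lt_mul_of_pos_left huv hh
  linarith

/-- Every boundary parameter lies in an inner junction arc or in a run. -/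
lemma exists_isInner_or_run (hT : IsOpen T) (u : ℝ) :
    (∃ i, D.IsInner i ∧ u ∈ Set.Icc (D.node (2 * i + 1)) (D.node (2 * i + 2))) ∨
      ∃ i, D.IsInner i ∧ u ∈ Set.Ioo (D.runStart i) (D.runEnd i) := by
  -- the last node before `u`
  obtain ⟨N, hN, hN'⟩ : ∃ N, D.node N ≤ u ∧ u < D.node (N + 1) := by
    have hL := D.length_pos
    obtain ⟨a, ha⟩ := exists_int_lt ((u - D.node 0) / D.length)
    obtain ⟨b, hb⟩ := exists_int_gt ((u - D.node 0) / D.length)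
    rw [lt_div_iff₀ hL] at ha
    rw [div_lt_iff₀ hL] at hb
    have ha' := D.node_add_mul 0 a
    have hb' := D.node_add_mul 0 b
    obtain ⟨N, h1, h2⟩ := Int.exists_greatest_of_bdd (P := fun N => D.node N ≤ u)
      ⟨0 + 2 * (b * D.numJunction), fun z hz => by
        by_contra hcon
        push Not at hcon
        have := D.node_strictMono hcon
        linarith⟩ ⟨0 + 2 * (a * D.numJunction), by linarith⟩
    refine ⟨N, h1, ?_⟩
    by_contra hcon
    push Not at hcon
    have := h2 _ hcon
    omega
  by_cases hin : ∃ i, D.IsInner i ∧ u ∈ Set.Icc (D.node (2 * i + 1)) (D.node (2 * i + 2))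
  · exact Or.inl hin
  right
  push Not at hin
  have hrun : ∀ i, D.IsInner i → 2 * i + 2 ≤ N → N + 1 ≤ 2 * D.nextInner i + 1 →
      u ∈ Set.Ioo (D.runStart i) (D.runEnd i) := by
    intro i hi h1 h2
    have h3 := D.node_strictMono.monotone h1
    have h4 := D.node_strictMono.monotone h2
    refine ⟨lt_of_le_of_ne (h3.trans hN) fun h => ?_, hN'.trans_le h4⟩
    refine hin i hi ⟨?_, ?_⟩ <;> rw [← h]
    · exact (D.node_strictMono (by omega)).le
    · exact le_rfl
  rcases Int.even_or_odd' N with ⟨a, h | h⟩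
  · -- `u` lies on a free arc
    by_cases h1 : D.IsInner (a - 1)
    · exact ⟨a - 1, h1, hrun _ h1 (by omega) (by have := D.lt_nextInner (a - 1); omega)⟩
    · have h2 : D.IsInner (a - 2) := isInner_of_not_isInner_succ hT (by
        rwa [show a - 2 + 1 = a - 1 by ring])
      refine ⟨a - 2, h2, hrun _ h2 (by omega) ?_⟩
      rw [nextInner_of_not_isInner (by rwa [show a - 2 + 1 = a - 1 by ring])]
      omega
  · -- `u` lies on a junction arc
    have h1 : ¬ D.IsInner a := fun h1 => by
      refine hin a h1 ⟨by rw [← h]; exact hN, ?_⟩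
      rw [show 2 * a + 2 = N + 1 by omega]
      exact hN'.le
    have h2 : D.IsInner (a - 1) := isInner_of_not_isInner_succ hT (by rwa [sub_add_cancel])
    refine ⟨a - 1, h2, hrun _ h2 (by omega) ?_⟩
    rw [nextInner_of_not_isInner (by rwa [sub_add_cancel])]
    omega

/-- Inside a run, there are no points of the inner junction arcs. -/
lemma curve_run_ne {i i' : ℤ} (hi' : D.IsInner i') {u v : ℝ}
    (hu : u ∈ Set.Ioo (D.runStart i) (D.runEnd i))
    (hv : v ∈ Set.Icc (D.node (2 * i' + 1)) (D.node (2 * i' + 2))) : D.curve u ≠ D.curve v := by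
  intro h
  obtain ⟨q, hq⟩ := D.exists_of_curve_eq h.symm
  have h1 := D.node_add_mul (2 * i' + 1) q
  have h2 := D.node_add_mul (2 * i' + 2) q
  have h3 : D.node (2 * i' + 1 + 2 * (q * D.numJunction)) < D.runEnd i := by
    linarith [hv.1, hu.2]
  have h4 : D.runStart i < D.node (2 * i' + 2 + 2 * (q * D.numJunction)) := by
    linarith [hv.2, hu.1]
  rw [runEnd, D.node_strictMono.lt_iff_lt] at h3
  rw [runStart, D.node_strictMono.lt_iff_lt] at h4
  have h5 := nextInner_le ((D.isInner_add_mul i' q).2 hi') (i := i) (by omega)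
  omega

/-- Different runs are disjoint. -/
lemma exists_of_curve_run_eq {i i' : ℤ} (hi : D.IsInner i) (hi' : D.IsInner i') {u v : ℝ}
    (hu : u ∈ Set.Icc (D.runStart i) (D.runEnd i)) (hv : v ∈ Set.Icc (D.runStart i') (D.runEnd i'))
    (h : D.curve u = D.curve v) :
    ∃ q : ℤ, i' = i + q * D.numJunction ∧ v = u + q * D.length := by
  obtain ⟨q, hq⟩ := D.exists_of_curve_eq h
  refine ⟨q, ?_, hq⟩
  have hiq := (D.isInner_add_mul i q).2 hi
  have h1 := D.node_add_mul (2 * i + 2) q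
  have h2 := D.node_add_mul (2 * D.nextInner i + 1) q
  have h3 : D.node (2 * i + 2 + 2 * (q * D.numJunction)) ≤ D.runEnd i' := by
    have := hu.1; rw [runStart] at this; linarith [hv.2]
  have h4 : D.runStart i' ≤ D.node (2 * D.nextInner i + 1 + 2 * (q * D.numJunction)) := by
    have := hu.2; rw [runEnd] at this; linarith [hv.1]
  rw [runEnd, D.node_strictMono.le_iff_le] at h3
  rw [runStart, D.node_strictMono.le_iff_le] at h4
  have h5 := D.nextInner_add_mul i q
  rcases lt_trichotomy i' (i + q * D.numJunction) with h6 | h6 | h6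
  · have := nextInner_le hiq h6; omega
  · exact h6
  · have := nextInner_le hi' h6; omega

end ArcDecomposition

/-! ### Common boundary arcs of two disjoint domains -/

namespace C1JordanDomain

variable {Ω Ω' : Set ℂ} {C : C1JordanDomain Ω} {C' : C1JordanDomain Ω'}

lemma injOn_Icc {s₀ s₁ : ℝ} (h : s₁ - s₀ < C.length) : Set.InjOn C.curve (Set.Icc s₀ s₁) := by
  intro s hs t ht hst
  obtain ⟨q, hq⟩ := C.exists_of_curve_eq hst
  have hL := C.length_pos
  have h1 : |((q : ℤ) : ℝ)| < 1 := by
    by_contra hcon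
    push Not at hcon
    have h2 : C.length ≤ |t - s| := by
      rw [hq, add_sub_cancel_left, abs_mul, abs_of_pos hL]
      nlinarith
    have h3 : |t - s| ≤ s₁ - s₀ := by
      rw [abs_le]; constructor <;> linarith [hs.1, hs.2, ht.1, ht.2]
    linarith
  rw [← Int.cast_abs] at h1
  have h4 : q = 0 := Int.abs_lt_one_iff.1 (by exact_mod_cast h1)
  rw [hq, h4]
  simp

/-- A common boundary arc of two disjoint domains is traversed in opposite directions, and the
tangents of the two boundaries rotate along it by opposite amounts. -/
lemma reverse_of_image_eq (hdisj : Disjoint Ω Ω') {s₀ s₁ t₀ t₁ : ℝ} (hs : s₀ < s₁) (ht : t₀ < t₁)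
    (hsL : s₁ - s₀ < C.length) (htL : t₁ - t₀ < C'.length)
    (him : C'.curve '' Set.Icc t₀ t₁ = C.curve '' Set.Icc s₀ s₁) :
    C'.curve t₀ = C.curve s₁ ∧ C'.curve t₁ = C.curve s₀ ∧
      C'.angle t₁ - C'.angle t₀ = -(C.angle s₁ - C.angle s₀) := by
  -- the change of parameter
  have hemb : Topology.IsClosedEmbedding (fun t : Set.Icc t₀ t₁ => C'.curve t) :=
    Continuous.isClosedEmbedding (C'.continuous_curve.comp continuous_subtype_val)
      fun t t' h => Subtype.ext (injOn_Icc htL t.2 t'.2 h)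
  have hex : ∀ s : Set.Icc s₀ s₁, ∃ t : Set.Icc t₀ t₁, C'.curve t = C.curve s := by
    intro s
    have : C.curve s ∈ C'.curve '' Set.Icc t₀ t₁ := by
      rw [him]; exact Set.mem_image_of_mem _ s.2
    obtain ⟨t, ht, hts⟩ := this
    exact ⟨⟨t, ht⟩, hts⟩
  choose ρ₀ hρ₀ using hex
  have hρ₀c : Continuous ρ₀ := by
    rw [hemb.isInducing.continuous_iff]
    exact (C.continuous_curve.comp continuous_subtype_val).congr fun s => (hρ₀ s).symm
  set ρ : ℝ → ℝ := fun s => ρ₀ (Set.projIcc s₀ s₁ hs.le s) with hρdef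
  have hρc : Continuous ρ := continuous_subtype_val.comp (hρ₀c.comp continuous_projIcc)
  have hρm : ∀ s, ρ s ∈ Set.Icc t₀ t₁ := fun s => (ρ₀ _).2
  have hρ : ∀ s ∈ Set.Icc s₀ s₁, C'.curve (ρ s) = C.curve s := fun s hs' => by
    simp only [hρdef, hρ₀, Set.projIcc_of_mem hs.le hs']
  have hinj : Set.InjOn ρ (Set.Icc s₀ s₁) := fun s hs' s' hs'' h =>
    injOn_Icc hsL hs' hs'' (by rw [← hρ s hs', ← hρ s' hs'', h])
  have hopp : ∀ s ∈ Set.Icc s₀ s₁, cis (C'.angle (ρ s)) = -cis (C.angle s) := fun s hs' =>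
    C.cis_angle_eq_neg C' hdisj (hρ s hs').symm
  have hanti : StrictAntiOn ρ (Set.Icc s₀ s₁) := by
    refine (ContinuousOn.strictMonoOn_of_injOn_Icc' hs.le hρc.continuousOn hinj).resolve_left
      fun hmono => ?_
    -- otherwise both tangents would point in the direction of the same short secants
    obtain ⟨δ, hδ, hcl⟩ := C.exists_angle_close (half_pos Real.pi_pos)
    obtain ⟨δ', hδ', hcl'⟩ := C'.exists_angle_close (half_pos Real.pi_pos)
    obtain ⟨r, hr, hrc⟩ := Metric.continuousAt_iff.1 (hρc.continuousAt (x := s₀)) δ' hδ'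
    set s := s₀ + min (min δ (r / 2)) (s₁ - s₀) with hsdef
    have e1 : min (min δ (r / 2)) (s₁ - s₀) ≤ δ := (min_le_left _ _).trans (min_le_left _ _)
    have e2 : min (min δ (r / 2)) (s₁ - s₀) ≤ r / 2 := (min_le_left _ _).trans (min_le_right _ _)
    have e3 : min (min δ (r / 2)) (s₁ - s₀) ≤ s₁ - s₀ := min_le_right _ _
    have e0 : 0 < min (min δ (r / 2)) (s₁ - s₀) :=
      lt_min (lt_min hδ (by linarith)) (by linarith)
    have hs0 : s₀ ∈ Set.Icc s₀ s₁ := ⟨le_rfl, hs.le⟩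
    have hsm : s ∈ Set.Icc s₀ s₁ := ⟨by linarith, by linarith⟩
    have h1 := re_secant_pos C.hasDerivAt (u := s₀) (v := s) (ψ := C.angle s₀) (by linarith)
      fun w hw => hcl w s₀ (by rw [abs_le]; constructor <;> linarith [hw.1, hw.2])
    have hd := hrc (x := s) (by rw [Real.dist_eq, abs_lt]; constructor <;> linarith)
    rw [Real.dist_eq, abs_lt] at hd
    have h2 := re_secant_pos C'.hasDerivAt (u := ρ s₀) (v := ρ s) (ψ := C'.angle (ρ s₀))
      (hmono hs0 hsm (by linarith))
      fun w hw => hcl' w (ρ s₀) (by rw [abs_le]; constructor <;> linarith [hw.1, hw.2])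
    rw [hρ s hsm, hρ s₀ hs0] at h2
    have h3 : cis (-C'.angle (ρ s₀)) = -cis (-C.angle s₀) := by
      obtain ⟨k, hk⟩ := cis_eq_cis_iff.1 ((hopp s₀ hs0).trans (cis_add_pi _).symm)
      rw [← cis_add_pi]
      exact cis_eq_cis_iff.2 ⟨-k - 1, by push_cast; linarith⟩
    rw [h3, mul_neg, Complex.neg_re] at h2
    linarith
  have hs0 : s₀ ∈ Set.Icc s₀ s₁ := ⟨le_rfl, hs.le⟩
  have hs1 : s₁ ∈ Set.Icc s₀ s₁ := ⟨hs.le, le_rfl⟩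
  have hsurj : ∀ t ∈ Set.Icc t₀ t₁, ∃ s ∈ Set.Icc s₀ s₁, ρ s = t := by
    intro t ht'
    have : C'.curve t ∈ C.curve '' Set.Icc s₀ s₁ := by
      rw [← him]; exact Set.mem_image_of_mem _ ht'
    obtain ⟨s, hs', hst⟩ := this
    exact ⟨s, hs', injOn_Icc htL (hρm s) ht' (by rw [hρ s hs', hst])⟩
  have hρ0 : ρ s₀ = t₁ := by
    obtain ⟨s, hs', hst⟩ := hsurj t₁ ⟨ht.le, le_rfl⟩
    have := hanti.antitoneOn hs0 hs' hs'.1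
    exact le_antisymm (hρm s₀).2 (hst ▸ this)
  have hρ1 : ρ s₁ = t₀ := by
    obtain ⟨s, hs', hst⟩ := hsurj t₀ ⟨le_rfl, ht.le⟩
    have := hanti.antitoneOn hs' hs1 hs'.2
    exact le_antisymm (hst ▸ this) (hρm s₁).1
  refine ⟨by rw [← hρ1, hρ s₁ hs1], by rw [← hρ0, hρ s₀ hs0], ?_⟩
  have hA := C.continuous_angle
  have hA' := C'.continuous_angle
  have h1 := eq_of_mem_two_pi_int isPreconnected_Icc (f := fun s => C'.angle (ρ s) - C.angle s)
    (by fun_prop) Real.pi (fun s hs' => by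
      obtain ⟨k, hk⟩ := cis_eq_cis_iff.1 ((hopp s hs').trans (cis_add_pi _).symm)
      exact ⟨k, by linarith⟩) hs0 hs1
  beta_reduce at h1
  rw [hρ0, hρ1] at h1
  linarith

end C1JordanDomain

/-! ### The permutation of the inner junction arcs along the faces -/

lemma ArcDecomposition.junction_length_lt {T Ω : Set ℂ} (D : ArcDecomposition T Ω) (i : ℤ) :
    D.node (2 * i + 2) - D.node (2 * i + 1) < D.length := by
  have h := D.node_add_mul (2 * i + 1) 1
  have h1 : D.node (2 * i + 2) < D.node (2 * i + 1 + 2 * (1 * D.numJunction)) :=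
    D.node_strictMono (by have := D.numJunction_pos; omega)
  rw [h] at h1
  push_cast at h1
  linarith

/-- The properties of a cluster on which the count of junction arcs relies: its cells are disjoint
subdomains of an open convex set, with positive Cheeger constants, and each inner junction arc
belongs to two cells. -/
structure IsCellSystem {k : ℕ} {T : Set ℂ} {Ω : Fin k → Set ℂ}
    (D : ∀ j, ArcDecomposition T (Ω j)) : Prop where
  isOpen : IsOpen T
  convex : Convex ℝ T
  subset : ∀ j, Ω j ⊆ T
  disjoint : ∀ j l, j ≠ l → Disjoint (Ω j) (Ω l)
  cheeger_pos : ∀ j, 0 < cheeger (Ω j)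
  shared : ∀ j i, (D j).IsInner i → ∃ l ≠ j, ∃ i', (D l).IsInner i' ∧
    (D l).junctionArc i' = (D j).junctionArc i

variable {k : ℕ} {T : Set ℂ} {Ω : Fin k → Set ℂ} {D : ∀ j, ArcDecomposition T (Ω j)}

open Classical in
/-- The inner junction arcs of all cells; an arc shared by two cells appears twice. -/
def innerJunctions (D : ∀ j, ArcDecomposition T (Ω j)) : Finset (Σ _ : Fin k, ℕ) :=
  Finset.univ.sigma fun j => (Finset.range (D j).numJunction).filter fun i : ℕ => (D j).IsInner i

/-- An inner junction arc of a cell. -/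
abbrev Junction (D : ∀ j, ArcDecomposition T (Ω j)) := {x // x ∈ innerJunctions D}

namespace Junction

/-- The cell to which the arc belongs. -/
def cell (x : Junction D) : Fin k := x.1.1

/-- The index of the arc in the decomposition of the boundary of its cell. -/
def idx (x : Junction D) : ℤ := x.1.2

/-- The decomposition of the boundary of the cell to which the arc belongs. -/
def dec (x : Junction D) : ArcDecomposition T (Ω x.cell) := D x.cell

open Classical in
lemma idx_lt_and_isInner (x : Junction D) :
    x.1.2 < x.dec.numJunction ∧ x.dec.IsInner x.idx := by
  obtain ⟨h1, h2⟩ := Finset.mem_filter.1 (Finset.mem_sigma.1 x.2).2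
  exact ⟨Finset.mem_range.1 h1, h2⟩

lemma isInner (x : Junction D) : x.dec.IsInner x.idx := x.idx_lt_and_isInner.2

lemma idx_nonneg (x : Junction D) : 0 ≤ x.idx := Int.natCast_nonneg _

lemma idx_lt (x : Junction D) : x.idx < x.dec.numJunction :=
  Int.ofNat_lt.2 x.idx_lt_and_isInner.1

lemma exists_eq (j : Fin k) {i : ℤ} (hi : (D j).IsInner i) :
    ∃ x : Junction D, x.cell = j ∧ ∃ q : ℤ, i = x.idx + q * (D j).numJunction := by
  classical
  have hΛ : (0 : ℤ) < (D j).numJunction := by exact_mod_cast (D j).numJunction_pos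
  obtain ⟨r, hr⟩ := Int.eq_ofNat_of_zero_le (Int.emod_nonneg i hΛ.ne')
  have hlt := Int.emod_lt_of_pos i hΛ
  have e := Int.emod_add_mul_ediv i (D j).numJunction
  rw [hr] at hlt e
  have hr' : (D j).IsInner r := by
    rw [← (D j).isInner_add_mul r (i / (D j).numJunction), mul_comm, e]
    exact hi
  refine ⟨⟨⟨j, r⟩, Finset.mem_sigma.2 ⟨Finset.mem_univ _, Finset.mem_filter.2
    ⟨Finset.mem_range.2 (by exact_mod_cast hlt), hr'⟩⟩⟩, rfl, i / (D j).numJunction, ?_⟩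
  show i = r + _
  rw [mul_comm]
  exact e.symm

lemma eq_of_idx_eq {x y : Junction D} (h : x.cell = y.cell) {q : ℤ}
    (hq : y.idx = x.idx + q * x.dec.numJunction) : x = y ∧ q = 0 := by
  have h1 := x.idx_lt
  have h2 := y.idx_lt
  have h3 := x.idx_nonneg
  have h4 := y.idx_nonneg
  have h5 : y.dec.numJunction = x.dec.numJunction := by
    show (D y.cell).numJunction = (D x.cell).numJunction
    rw [h]
  rw [h5] at h2
  have hq0 : q = 0 := by
    have a1 : q < 1 := by
      by_contra hcon
      push Not at hcon
      nlinarith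
    have a2 : -1 < q := by
      by_contra hcon
      push Not at hcon
      nlinarith
    omega
  refine ⟨Subtype.ext (Sigma.ext h (heq_of_eq ?_)), hq0⟩
  rw [hq0, zero_mul, add_zero] at hq
  exact (Int.ofNat_inj.1 hq).symm

/-- The initial point of the arc, seen from its cell. -/
def startPt (x : Junction D) : ℂ := x.dec.curve (x.dec.node (2 * x.idx + 1))

/-- The final point of the arc, at which the run after the arc starts. -/
def endPt (x : Junction D) : ℂ := x.dec.curve (x.dec.runStart x.idx)

/-- The point at which the run after the arc ends. -/
def nextPt (x : Junction D) : ℂ := x.dec.curve (x.dec.runEnd x.idx)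

end Junction

namespace IsCellSystem

variable (hD : IsCellSystem D)
include hD

lemma curve_notMem (j l : Fin k) (u : ℝ) : (D j).curve u ∉ Ω l := by
  intro h
  by_cases hjl : j = l
  · subst hjl
    have h1 := (D j).mem_frontier u
    rw [(D j).isOpen.frontier_eq] at h1
    exact h1.2 h
  · obtain ⟨z, hz, hz'⟩ := mem_closure_iff.1 ((D j).curve_mem_closure u) _ (D l).isOpen h
    exact Set.disjoint_left.1 (hD.disjoint j l hjl) hz' hz

lemma cis_angle_eq_neg {j l : Fin k} (hjl : j ≠ l) {s t : ℝ} (h : (D j).curve s = (D l).curve t) :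
    cis ((D l).angle t) = -cis ((D j).angle s) :=
  (D j).toC1JordanDomain.cis_angle_eq_neg (D l).toC1JordanDomain (hD.disjoint j l hjl) h

/-- A point belongs to the boundaries of at most two cells. -/
lemma not_three {j l m : Fin k} (h1 : j ≠ l) (h2 : j ≠ m) (h3 : l ≠ m) {s t r : ℝ}
    (h4 : (D j).curve s = (D l).curve t) (h5 : (D j).curve s = (D m).curve r) : False := by
  have a1 := hD.cis_angle_eq_neg h1 h4
  have a2 := hD.cis_angle_eq_neg h2 h5
  have a3 := hD.cis_angle_eq_neg h3 (h4.symm.trans h5)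
  rw [a1, a2, neg_neg] at a3
  exact cis_ne_zero _ (self_eq_neg.1 a3.symm)

/-- Every inner junction arc is traversed in the opposite direction by another cell. -/
lemma exists_partner (j : Fin k) {i : ℤ} (hi : (D j).IsInner i) : ∃ y : Junction D, y.cell ≠ j ∧
    y.endPt = (D j).curve ((D j).node (2 * i + 1)) ∧
    y.startPt = (D j).curve ((D j).node (2 * i + 2)) ∧
    y.dec.junctionTurn y.idx = -(D j).junctionTurn i ∧
    y.dec.junctionArc y.idx = (D j).junctionArc i := by
  obtain ⟨l, hl, i', hi', harc⟩ := hD.shared j i hi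
  obtain ⟨y, rfl, q, hq⟩ := Junction.exists_eq l hi'
  rw [hq, (D y.cell).junctionArc_add_mul] at harc
  obtain ⟨h1, h2, h3⟩ := C1JordanDomain.reverse_of_image_eq (hD.disjoint j y.cell hl.symm)
    ((D j).node_strictMono (by omega)) (y.dec.node_strictMono (by omega))
    ((D j).junction_length_lt i) (y.dec.junction_length_lt y.idx) harc
  exact ⟨y, hl, h2, h1, h3, harc⟩

/-- The interior of a run does not meet the inner junction arcs, of any cell. -/
lemma run_ne (y : Junction D) {u : ℝ} (hu : u ∈ Set.Ioo (y.dec.runStart y.idx) (y.dec.runEnd y.idx))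
    (l : Fin k) {i : ℤ} (hi : (D l).IsInner i) {v : ℝ}
    (hv : v ∈ Set.Icc ((D l).node (2 * i + 1)) ((D l).node (2 * i + 2))) :
    y.dec.curve u ≠ (D l).curve v := by
  intro h
  by_cases hl : y.cell = l
  · subst hl
    exact (D y.cell).curve_run_ne hi hu hv h
  · obtain ⟨z, hz, -, -, -, harc⟩ := hD.exists_partner l hi
    have hmem : (D l).curve v ∈ z.dec.junctionArc z.idx := by
      rw [harc]; exact Set.mem_image_of_mem _ hv
    obtain ⟨w, hw, hw'⟩ := hmem
    by_cases hyz : y.cell = z.cell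
    · obtain ⟨⟨j, iz⟩, hmz⟩ := z
      obtain ⟨⟨j', iy⟩, hmy⟩ := y
      change j' = j at hyz
      subst hyz
      exact (D j').curve_run_ne (Junction.isInner ⟨⟨j', iz⟩, hmz⟩) hu hw (h.trans hw'.symm)
    · exact hD.not_three hl hyz (Ne.symm hz) h (h.trans hw'.symm)

/-- At the final point of an inner junction arc, the second cell is at the initial point of its copy
of the arc, and there is no third cell. -/
lemma endPt_injective : Function.Injective (Junction.endPt (D := D)) := by
  intro x x' h
  by_cases hc : x.cell = x'.cell
  · obtain ⟨⟨j, i⟩, hx⟩ := x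
    obtain ⟨⟨j', i'⟩, hx'⟩ := x'
    change j = j' at hc
    subst hc
    obtain ⟨q, hq⟩ := (D j).exists_of_curve_node_eq h
    exact (Junction.eq_of_idx_eq (x := ⟨⟨j, i⟩, hx⟩) (y := ⟨⟨j, i'⟩, hx'⟩) rfl (q := q) (by
      change (2 * (i' : ℤ) + 2 : ℤ) = 2 * (i : ℤ) + 2 + _ at hq
      change (i' : ℤ) = i + q * (D j).numJunction
      linarith)).1
  · exfalso
    obtain ⟨y, hy, -, hy2, -⟩ := hD.exists_partner x.cell x.isInner
    by_cases hyc : y.cell = x'.cell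
    · obtain ⟨⟨j, i⟩, hy'⟩ := y
      obtain ⟨⟨j', i'⟩, hx'⟩ := x'
      change j = j' at hyc
      subst hyc
      have h2 : (D j).curve ((D j).node (2 * i + 1)) = (D j).curve ((D j).node (2 * i' + 2)) :=
        hy2.trans h
      obtain ⟨q, hq⟩ := (D j).exists_of_curve_node_eq h2
      omega
    · exact hD.not_three hc (Ne.symm hy) (Ne.symm hyc) h hy2.symm

/-- The partner of an inner junction arc: the same arc, as an arc of the other cell. -/
lemma exists_partner_map : ∃ pr : Junction D → Junction D, Function.Involutive pr ∧
    ∀ x, (pr x).dec.junctionTurn (pr x).idx = -x.dec.junctionTurn x.idx := by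
  choose pr h1 h2 h3 h4 h5 using fun x : Junction D => hD.exists_partner x.cell x.isInner
  exact ⟨pr, fun x => hD.endPt_injective ((h2 (pr x)).trans (h3 x)), h4⟩

/-- The cell which takes over at the end of a run: following the runs in this way, one goes around
the faces of the cluster. -/
lemma exists_next : ∃ σ : Equiv.Perm (Junction D), ∀ x, (σ x).cell ≠ x.cell ∧
    (σ x).endPt = x.nextPt := by
  have hex : ∀ x : Junction D, ∃ y : Junction D, y.cell ≠ x.cell ∧ y.endPt = x.nextPt := by
    intro x
    obtain ⟨y, h1, h2, -⟩ := hD.exists_partner x.cell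
      (ArcDecomposition.isInner_nextInner (D := x.dec) hD.isOpen x.idx)
    exact ⟨y, h1, h2⟩
  choose f h1 h2 using hex
  have hinj : Function.Injective f := by
    intro x x' h
    have h3 : x.nextPt = x'.nextPt := by rw [← h2, ← h2, h]
    by_cases hc : x.cell = x'.cell
    · have h4 := x.isInner
      have h5 := x'.isInner
      obtain ⟨⟨j, i⟩, hx⟩ := x
      obtain ⟨⟨j', i'⟩, hx'⟩ := x'
      change j = j' at hc
      subst hc
      obtain ⟨q, hq, -⟩ := (D j).exists_of_curve_run_eq h4 h5
        ⟨((D j).runStart_lt_runEnd i).le, le_rfl⟩ ⟨((D j).runStart_lt_runEnd i').le, le_rfl⟩ h3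
      exact (Junction.eq_of_idx_eq (x := ⟨⟨j, i⟩, hx⟩) (y := ⟨⟨j, i'⟩, hx'⟩) rfl (q := q) hq).1
    · exact (hD.not_three hc (h1 x).symm (by rw [h]; exact (h1 x').symm) h3 (h2 x).symm).elim
  exact ⟨Equiv.ofBijective f (Finite.injective_iff_bijective.1 hinj), fun x => ⟨h1 x, h2 x⟩⟩

end IsCellSystem

/-! ### The chain of runs around a face -/

/-- The permutation `σ` of the inner junction arcs sends an arc to the one which ends at the end of
the run after it, in another cell. -/
def IsNextMap (σ : Equiv.Perm (Junction D)) : Prop :=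
  ∀ x, (σ x).cell ≠ x.cell ∧ (σ x).endPt = x.nextPt

lemma zpow_add_minimalPeriod {α : Type*} (σ : Equiv.Perm α) (x : α) (m : ℤ) :
    (σ ^ (m + Function.minimalPeriod σ x)) x = (σ ^ m) x := by
  rw [zpow_add, Equiv.Perm.mul_apply, zpow_natCast, ← Equiv.Perm.iterate_eq_pow,
    Function.iterate_minimalPeriod]

lemma exists_of_zpow_eq {α : Type*} {σ : Equiv.Perm α} {x : α} {m m' : ℤ}
    (h : (σ ^ m) x = (σ ^ m') x) : ∃ q : ℤ, m' = m + q * Function.minimalPeriod σ x := by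
  have h1 : σ ^ (m' - m) • x = x := by
    rw [Equiv.Perm.smul_def, sub_eq_neg_add, zpow_add, Equiv.Perm.mul_apply, ← h,
      ← Equiv.Perm.mul_apply, ← zpow_add, neg_add_cancel, zpow_zero, Equiv.Perm.one_apply]
  obtain ⟨q, hq⟩ := MulAction.zpow_smul_eq_iff_minimalPeriod_dvd.1 h1
  refine ⟨q, ?_⟩
  change m' - m = Function.minimalPeriod σ x * q at hq
  linarith

lemma minimalPeriod_pos {α : Type*} [Finite α] (σ : Equiv.Perm α) (x : α) :
    0 < Function.minimalPeriod σ x :=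
  Function.minimalPeriod_pos_of_mem_periodicPts (σ.injective.mem_periodicPts x)

/-- The closed chain formed by the runs around a face of the cluster. -/
def faceChain (hD : IsCellSystem D) {σ : Equiv.Perm (Junction D)} (hσ : IsNextMap σ)
    (x : Junction D) : CuspChain (Function.minimalPeriod σ x) where
  pos := minimalPeriod_pos σ x
  g m t := ((σ ^ m) x).dec.curve (((σ ^ m) x).dec.runStart ((σ ^ m) x).idx + t)
  φ m t := ((σ ^ m) x).dec.angle (((σ ^ m) x).dec.runStart ((σ ^ m) x).idx + t)
  ℓ m := ((σ ^ m) x).dec.runEnd ((σ ^ m) x).idx - ((σ ^ m) x).dec.runStart ((σ ^ m) x).idx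
  length_pos m := sub_pos.2 (((σ ^ m) x).dec.runStart_lt_runEnd _)
  hasDerivAt m t := (((σ ^ m) x).dec.hasDerivAt _).comp_const_add _ _
  continuous_angle m := ((σ ^ m) x).dec.continuous_angle.comp (by fun_prop)
  join m := by
    rw [add_zero, add_sub_cancel, add_comm m 1, zpow_one_add, Equiv.Perm.mul_apply]
    exact (hσ ((σ ^ m) x)).2
  cusp m := by
    rw [add_zero, add_sub_cancel, add_comm m 1, zpow_one_add, Equiv.Perm.mul_apply]
    exact hD.cis_angle_eq_neg (hσ ((σ ^ m) x)).1.symm (hσ ((σ ^ m) x)).2.symm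
  periodic_g m := congrArg (fun (y : Junction D) (t : ℝ) => y.dec.curve (y.dec.runStart y.idx + t))
    (zpow_add_minimalPeriod σ x m)
  periodic_angle m :=
    congrArg (fun (y : Junction D) (t : ℝ) => y.dec.angle (y.dec.runStart y.idx + t))
      (zpow_add_minimalPeriod σ x m)
  periodic_length m := congrArg (fun y : Junction D => y.dec.runEnd y.idx - y.dec.runStart y.idx)
    (zpow_add_minimalPeriod σ x m)
  convex_start m := by
    set y := (σ ^ m) x
    have h := y.dec.strictMonoOn_angle_freeArc (hD.cheeger_pos y.cell) (y.idx + 1)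
    rw [show 2 * (y.idx + 1) = 2 * y.idx + 2 by ring] at h
    refine ⟨y.dec.node (2 * y.idx + 2 + 1) - y.dec.runStart y.idx,
      sub_pos.2 (y.dec.node_strictMono (by omega)), fun u hu v hv huv => h ?_ ?_ (by linarith)⟩
    · exact ⟨le_add_of_nonneg_right hu.1, by linarith [hu.2]⟩
    · exact ⟨le_add_of_nonneg_right hv.1, by linarith [hv.2]⟩
  convex_end m := by
    set y := (σ ^ m) x
    have h := y.dec.strictMonoOn_angle_freeArc (hD.cheeger_pos y.cell) (y.dec.nextInner y.idx)
    refine ⟨y.dec.runEnd y.idx - y.dec.node (2 * y.dec.nextInner y.idx),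
      sub_pos.2 (y.dec.node_strictMono (by omega)), fun u hu v hv huv => h ?_ ?_ (by linarith)⟩
    · exact ⟨by linarith [hu.1], by change _ ≤ y.dec.runEnd y.idx; linarith [hu.2]⟩
    · exact ⟨by linarith [hv.1], by change _ ≤ y.dec.runEnd y.idx; linarith [hv.2]⟩

section

variable (hD : IsCellSystem D) {σ : Equiv.Perm (Junction D)} (hσ : IsNextMap σ) (x : Junction D)

lemma faceChain_curve_intCast (m : ℤ) : (faceChain hD hσ x).curve m = ((σ ^ m) x).endPt := by
  rw [CuspChain.curve_intCast]
  show ((σ ^ m) x).dec.curve (((σ ^ m) x).dec.runStart ((σ ^ m) x).idx + 0) = _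
  rw [add_zero]
  rfl

lemma faceChain_curve {m : ℤ} {t : ℝ} (h0 : m ≤ t) (h1 : t ≤ m + 1) :
    (faceChain hD hσ x).curve t = ((σ ^ m) x).dec.curve (((σ ^ m) x).dec.runStart ((σ ^ m) x).idx
      + (t - m) * (faceChain hD hσ x).ℓ m) :=
  (faceChain hD hσ x).curve_eq h0 h1

lemma faceChain_param_mem_Icc {m : ℤ} {t : ℝ} (h0 : m ≤ t) (h1 : t ≤ m + 1) :
    ((σ ^ m) x).dec.runStart ((σ ^ m) x).idx + (t - m) * (faceChain hD hσ x).ℓ m ∈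
      Set.Icc (((σ ^ m) x).dec.runStart ((σ ^ m) x).idx)
        (((σ ^ m) x).dec.runEnd ((σ ^ m) x).idx) := by
  have h := (faceChain hD hσ x).param_mem h0 h1
  have e : (faceChain hD hσ x).ℓ m = ((σ ^ m) x).dec.runEnd ((σ ^ m) x).idx
    - ((σ ^ m) x).dec.runStart ((σ ^ m) x).idx := rfl
  constructor <;> linarith [h.1, h.2]

lemma faceChain_param_mem_Ioo {m : ℤ} {t : ℝ} (ht : t ∈ Set.Ioo (m : ℝ) (m + 1)) :
    ((σ ^ m) x).dec.runStart ((σ ^ m) x).idx + (t - m) * (faceChain hD hσ x).ℓ m ∈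
      Set.Ioo (((σ ^ m) x).dec.runStart ((σ ^ m) x).idx)
        (((σ ^ m) x).dec.runEnd ((σ ^ m) x).idx) := by
  have hℓ := (faceChain hD hσ x).length_pos m
  have e : (faceChain hD hσ x).ℓ m = ((σ ^ m) x).dec.runEnd ((σ ^ m) x).idx
    - ((σ ^ m) x).dec.runStart ((σ ^ m) x).idx := rfl
  have h1 := mul_pos (sub_pos.2 ht.1) hℓ
  have h2 := mul_pos (sub_pos.2 ht.2) hℓ
  constructor <;> linarith

lemma faceChain_cusp_simple (m : ℤ) (t : ℝ)
    (h : (faceChain hD hσ x).curve t = (faceChain hD hσ x).curve m) :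
    ∃ q : ℤ, t = m + q * Function.minimalPeriod σ x := by
  rw [faceChain_curve_intCast] at h
  by_cases hint : ∃ m' : ℤ, t = m'
  · obtain ⟨m', rfl⟩ := hint
    rw [faceChain_curve_intCast] at h
    obtain ⟨q, hq⟩ := exists_of_zpow_eq (hD.endPt_injective h.symm)
    exact ⟨q, by exact_mod_cast hq⟩
  · exfalso
    have htm : t ∈ Set.Ioo (⌊t⌋ : ℝ) (⌊t⌋ + 1) :=
      ⟨lt_of_le_of_ne (Int.floor_le t) fun h => hint ⟨_, h.symm⟩, Int.lt_floor_add_one t⟩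
    rw [faceChain_curve hD hσ x htm.1.le htm.2.le] at h
    exact hD.run_ne _ (faceChain_param_mem_Ioo hD hσ x htm) _ ((σ ^ m) x).isInner
      ⟨(((σ ^ m) x).dec.node_strictMono (by omega)).le, le_rfl⟩ h

/-- Points of a face chain on runs of the same cell are distinct. -/
lemma faceChain_exists_of_eq {m m' : ℤ} {s t : ℝ} (hs : s ∈ Set.Icc (m : ℝ) (m + 1))
    (ht : t ∈ Set.Icc (m' : ℝ) (m' + 1)) (hc : ((σ ^ m) x).cell = ((σ ^ m') x).cell)
    (h : (faceChain hD hσ x).curve s = (faceChain hD hσ x).curve t) :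
    ∃ q : ℤ, t = s + q * Function.minimalPeriod σ x := by
  rw [faceChain_curve hD hσ x hs.1 hs.2, faceChain_curve hD hσ x ht.1 ht.2] at h
  have hu := faceChain_param_mem_Icc hD hσ x hs.1 hs.2
  have hv := faceChain_param_mem_Icc hD hσ x ht.1 ht.2
  have hℓ := (faceChain hD hσ x).length_pos m
  have hkey : ∀ y y' : Junction D, y.cell = y'.cell → ∀ u ∈ Set.Icc (y.dec.runStart y.idx)
      (y.dec.runEnd y.idx), ∀ v ∈ Set.Icc (y'.dec.runStart y'.idx) (y'.dec.runEnd y'.idx),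
      y.dec.curve u = y'.dec.curve v → y = y' ∧ u = v := by
    intro y y' hc u hu v hv h
    have h1 := y.isInner
    have h2 := y'.isInner
    obtain ⟨⟨j, i⟩, hy⟩ := y
    obtain ⟨⟨j', i'⟩, hy'⟩ := y'
    change j = j' at hc
    subst hc
    obtain ⟨q, hq, hq'⟩ := (D j).exists_of_curve_run_eq h1 h2 hu hv h
    have h3 := Junction.eq_of_idx_eq (x := ⟨⟨j, i⟩, hy⟩) (y := ⟨⟨j, i'⟩, hy'⟩) rfl hq
    refine ⟨h3.1, ?_⟩
    rw [h3.2] at hq'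
    simpa using hq'.symm
  obtain ⟨h1, h2⟩ := hkey _ _ hc _ hu _ hv h
  obtain ⟨q, hq⟩ := exists_of_zpow_eq h1
  have e : (faceChain hD hσ x).ℓ m' = (faceChain hD hσ x).ℓ m := by
    show ((σ ^ m') x).dec.runEnd _ - _ = ((σ ^ m) x).dec.runEnd _ - _
    rw [h1]
  rw [← h1, e, add_right_inj] at h2
  have h3 := mul_right_cancel₀ hℓ.ne' h2
  refine ⟨q, ?_⟩
  have h4 : (m' : ℝ) = m + q * Function.minimalPeriod σ x := by exact_mod_cast hq
  linarith

lemma faceChain_double (m m' : ℤ) (s t : ℝ) (hs : s ∈ Set.Ioo (m : ℝ) (m + 1))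
    (ht : t ∈ Set.Ioo (m' : ℝ) (m' + 1))
    (h : (faceChain hD hσ x).curve s = (faceChain hD hσ x).curve t) :
    (∃ q : ℤ, t = s + q * Function.minimalPeriod σ x) ∨
      cis ((faceChain hD hσ x).φ m' ((t - m') * (faceChain hD hσ x).ℓ m'))
        = -cis ((faceChain hD hσ x).φ m ((s - m) * (faceChain hD hσ x).ℓ m)) := by
  by_cases hc : ((σ ^ m) x).cell = ((σ ^ m') x).cell
  · exact Or.inl (faceChain_exists_of_eq hD hσ x ⟨hs.1.le, hs.2.le⟩ ⟨ht.1.le, ht.2.le⟩ hc h)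
  · right
    rw [faceChain_curve hD hσ x hs.1.le hs.2.le, faceChain_curve hD hσ x ht.1.le ht.2.le] at h
    exact hD.cis_angle_eq_neg hc h

/-- Points of a face chain which belong to the same cell and are not close along the chain are not
close in the plane. -/
lemma faceChain_exists_dist {δ : ℝ} (hδ : 0 < δ) : ∃ ρ > 0, ∀ (m m' : ℤ) (s t : ℝ),
    s ∈ Set.Icc (m : ℝ) (m + 1) → t ∈ Set.Icc (m' : ℝ) (m' + 1) →
    ((σ ^ m) x).cell = ((σ ^ m') x).cell → δ ≤ t - s →
    t - s ≤ Function.minimalPeriod σ x - δ →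
    ρ ≤ ‖(faceChain hD hσ x).curve t - (faceChain hD hσ x).curve s‖ := by
  set n := Function.minimalPeriod σ x with hn
  have hc := (faceChain hD hσ x).continuous_curve
  have hn0 : (0 : ℝ) < n := by exact_mod_cast minimalPeriod_pos σ x
  set I : Set (ℤ × ℤ) := {p | p ∈ Set.Icc (0 : ℤ) n ×ˢ Set.Icc (0 : ℤ) (2 * n + 1) ∧
    ((σ ^ p.1) x).cell = ((σ ^ p.2) x).cell} with hI
  have hIfin : I.Finite :=
    ((Set.finite_Icc (0 : ℤ) n).prod (Set.finite_Icc (0 : ℤ) (2 * n + 1))).subset fun p hp => hp.1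
  set F : ℤ × ℤ → Set (ℝ × ℝ) := fun p => (Set.Icc (p.1 : ℝ) (p.1 + 1) ×ˢ
    Set.Icc (p.2 : ℝ) (p.2 + 1)) ∩ {q | δ ≤ q.2 - q.1 ∧ q.2 - q.1 ≤ n - δ} with hF
  have hFc : IsCompact (⋃ p ∈ I, F p) := by
    refine hIfin.isCompact_biUnion fun p _ => ?_
    have h1 : Continuous fun q : ℝ × ℝ => q.2 - q.1 := by fun_prop
    exact (isCompact_Icc.prod isCompact_Icc).inter_right
      ((isClosed_le continuous_const h1).inter (isClosed_le h1 continuous_const))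
  have hpos : ∀ q ∈ ⋃ p ∈ I, F p,
      0 < ‖(faceChain hD hσ x).curve q.2 - (faceChain hD hσ x).curve q.1‖ := by
    intro q hq
    simp only [Set.mem_iUnion] at hq
    obtain ⟨p, hp, hqp⟩ := hq
    rw [norm_pos_iff, sub_ne_zero]
    intro he
    obtain ⟨r, hr⟩ := faceChain_exists_of_eq hD hσ x hqp.1.1 hqp.1.2 hp.2 he.symm
    exact false_of_eq_add_int_mul hδ hr (by linarith [hqp.2.1]) (by linarith [hqp.2.2])
  obtain ⟨ρ, hρ, hρF⟩ : ∃ ρ > 0, ∀ q ∈ ⋃ p ∈ I, F p,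
      ρ ≤ ‖(faceChain hD hσ x).curve q.2 - (faceChain hD hσ x).curve q.1‖ := by
    rcases (⋃ p ∈ I, F p).eq_empty_or_nonempty with he | hne
    · exact ⟨1, one_pos, fun q hq => by rw [he] at hq; exact hq.elim⟩
    · obtain ⟨p, hp, hmin⟩ := hFc.exists_isMinOn hne
        (f := fun q => ‖(faceChain hD hσ x).curve q.2 - (faceChain hD hσ x).curve q.1‖)
        (by fun_prop)
      exact ⟨_, hpos p hp, fun p' hp' => hmin hp'⟩
  refine ⟨ρ, hρ, fun m m' s t hs ht hcell h1 h2 => ?_⟩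
  -- move the first point to the first period
  set a := m / (n : ℤ) with ha
  have hnz : (0 : ℤ) < n := by exact_mod_cast minimalPeriod_pos σ x
  have e := Int.emod_add_mul_ediv m n
  have r0 := Int.emod_nonneg m hnz.ne'
  have r1 := Int.emod_lt_of_pos m hnz
  rw [← ha] at e
  have hshift : ∀ m : ℤ, (σ ^ (m - a * n)) x = (σ ^ m) x := by
    intro m
    have hz : ∀ b : ℤ, (σ ^ (b * n)) x = x := by
      intro b
      have h3 : σ ^ (b * n) • x = x := MulAction.zpow_smul_eq_iff_minimalPeriod_dvd.2
        (Dvd.intro_left b rfl)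
      exact h3
    rw [sub_eq_add_neg, zpow_add, Equiv.Perm.mul_apply, ← neg_mul, hz]
  have hper : ∀ t, (faceChain hD hσ x).curve (t - a * n) = (faceChain hD hσ x).curve t := fun t =>
    (faceChain hD hσ x).periodic_curve.sub_int_mul_eq a
  rw [← hper t, ← hper s]
  have hm'1 : (m : ℝ) < m' + 1 := by linarith [hs.1, ht.2]
  have hm'2 : (m' : ℝ) < m + 1 + n := by linarith [hs.2, ht.1]
  have hm'1 : m < m' + 1 := by exact_mod_cast hm'1
  have hm'2 : m' < m + 1 + n := by exact_mod_cast hm'2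
  refine hρF (s - a * n, t - a * n) (Set.mem_iUnion₂.2 ⟨(m - a * n, m' - a * n), ⟨⟨⟨?_, ?_⟩,
    ⟨?_, ?_⟩⟩, ?_⟩, ⟨⟨?_, ?_⟩, ?_⟩⟩)
  · show 0 ≤ m - a * n; linarith
  · show m - a * n ≤ n; linarith
  · show 0 ≤ m' - a * n; linarith
  · show m' - a * n ≤ 2 * n + 1; linarith
  · show ((σ ^ (m - a * n)) x).cell = ((σ ^ (m' - a * n)) x).cell
    rw [hshift, hshift]; exact hcell
  · push_cast
    constructor <;> linarith [hs.1, hs.2]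
  · push_cast
    constructor <;> linarith [ht.1, ht.2]
  · constructor <;> simp only <;> linarith

/-- Pushing the runs of a face chain into their cells, while keeping the cusps fixed, removes its
double points. -/
lemma faceChain_approx {δ : ℝ} (hδ : 0 < δ) {η : ℝ} (hη : 0 < η) :
    ∃ c' : ℝ → ℂ, Continuous c' ∧ Function.Periodic c' (Function.minimalPeriod σ x) ∧
      (∀ t, ‖c' t - (faceChain hD hσ x).curve t‖ < η) ∧
      ∀ s t, δ ≤ t - s → t - s ≤ Function.minimalPeriod σ x - δ → c' s ≠ c' t := by
  set n := Function.minimalPeriod σ x with hn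
  obtain ⟨ρ, hρ, hdist⟩ := faceChain_exists_dist hD hσ x hδ
  obtain ⟨ε, hε, hpush⟩ : ∃ ε > 0, ∀ j t, ∀ η : ℝ, 0 < η → η < ε →
      (D j).curve t + η * (Complex.I * cis ((D j).angle t)) ∈ Ω j := by
    choose ε hε h using fun j => (D j).exists_push_mem
    have hne : (Finset.univ : Finset (Fin k)).Nonempty := ⟨x.cell, Finset.mem_univ _⟩
    refine ⟨Finset.univ.inf' hne ε, (Finset.lt_inf'_iff hne).2 fun j _ => hε j,
      fun j t η h0 h1 => h j t η h0 (h1.trans_le (Finset.inf'_le _ (Finset.mem_univ j)))⟩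
  -- the size of the push
  obtain ⟨b, hb, hb1, hb2, hb3⟩ : ∃ b > 0, b < η ∧ b < ε ∧ 2 * b < ρ := by
    refine ⟨min η (min ε (ρ / 2)) / 2, by positivity, ?_, ?_, ?_⟩
    · linarith [min_le_left η (min ε (ρ / 2))]
    · linarith [min_le_right η (min ε (ρ / 2)), min_le_left ε (ρ / 2)]
    · linarith [min_le_right η (min ε (ρ / 2)), min_le_right ε (ρ / 2)]
  set w : ℝ → ℝ := fun t => b * |Real.sin (Real.pi * t)| with hw
  have hw0 : ∀ t, 0 ≤ w t := fun t => mul_nonneg hb.le (abs_nonneg _)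
  have hwb : ∀ t, w t ≤ b := fun t => mul_le_of_le_one_right hb.le (Real.abs_sin_le_one _)
  have hwint : ∀ m : ℤ, w m = 0 := fun m => by
    simp only [hw]
    rw [mul_comm Real.pi, Real.sin_int_mul_pi, abs_zero, mul_zero]
  have hwpos : ∀ t : ℝ, (¬ ∃ m : ℤ, t = m) → 0 < w t := by
    intro t ht
    refine mul_pos hb (abs_pos.2 fun h0 => ht ?_)
    obtain ⟨m, hm⟩ := Real.sin_eq_zero_iff.1 h0
    exact ⟨m, mul_left_cancel₀ Real.pi_ne_zero (by rw [← hm]; ring)⟩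
  set K := faceChain hD hσ x with hK
  set c' : ℝ → ℂ := fun t => K.curve t +
    w t * (Complex.I * cis (K.φ ⌊t⌋ ((t - ⌊t⌋) * K.ℓ ⌊t⌋))) with hc'
  have hc'eq : ∀ (m : ℤ) (t : ℝ), m ≤ t → t ≤ m + 1 → c' t = K.g m ((t - m) * K.ℓ m) +
      w t * (Complex.I * cis (K.φ m ((t - m) * K.ℓ m))) := by
    intro m t h0 h1
    simp only [hc', K.curve_eq h0 h1]
    rcases h1.eq_or_lt with h | h
    · have : w t = 0 := by rw [h]; exact_mod_cast hwint (m + 1)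
      simp [this]
    · rw [Int.floor_eq_iff.2 ⟨h0, h⟩]
  have hclose : ∀ t, ‖c' t - K.curve t‖ ≤ b := fun t => by
    simp only [hc', add_sub_cancel_left, norm_mul, Complex.norm_I, norm_cis, mul_one,
      Complex.norm_real, Real.norm_of_nonneg (hw0 t)]
    exact hwb t
  have hmem : ∀ t : ℝ, (¬ ∃ m : ℤ, t = m) → c' t ∈ Ω ((σ ^ ⌊t⌋) x).cell := by
    intro t ht
    rw [hc'eq ⌊t⌋ t (Int.floor_le t) (Int.lt_floor_add_one t).le]
    exact hpush _ _ _ (hwpos t ht) ((hwb t).trans_lt hb2)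
  have hint : ∀ m : ℤ, c' m = ((σ ^ m) x).endPt := fun m => by
    simp only [hc', hwint, Complex.ofReal_zero, zero_mul, add_zero]
    exact faceChain_curve_intCast hD hσ x m
  have hnint : ∀ (m : ℤ) (t : ℝ), (¬ ∃ m : ℤ, t = m) → c' m ≠ c' t := by
    intro m t ht h
    have h1 := hmem t ht
    rw [← h, hint] at h1
    exact hD.curve_notMem _ _ _ h1
  refine ⟨c', ?_, ?_, fun t => (hclose t).trans_lt hb1, ?_⟩
  · refine CuspChain.continuous_of_piecewise (F := fun m t => K.g m ((t - m) * K.ℓ m) +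
      w t * (Complex.I * cis (K.φ m ((t - m) * K.ℓ m)))) (fun m => ?_) hc'eq
    have h1 := K.continuous_g m
    have h2 := K.continuous_angle m
    have h3 := continuous_cis
    fun_prop
  · intro t
    have h1 : w (t + n) = w t := by
      have : Function.Periodic w 1 := fun t => by
        simp only [hw]
        rw [mul_add, mul_one, Real.sin_add_pi, abs_neg]
      simpa using this.nat_mul n t
    simp only [hc']
    rw [h1, K.periodic_curve, Int.floor_add_natCast, K.periodic_angle, K.periodic_length]
    push_cast
    rw [add_sub_add_right_eq_sub]
  · intro s t h1 h2 h
    by_cases hs : ∃ m : ℤ, s = m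
    · obtain ⟨m, rfl⟩ := hs
      by_cases ht : ∃ m : ℤ, t = m
      · obtain ⟨m', rfl⟩ := ht
        rw [hint, hint, ← faceChain_curve_intCast hD hσ, ← faceChain_curve_intCast hD hσ] at h
        obtain ⟨q, hq⟩ := faceChain_cusp_simple hD hσ x m m' h.symm
        exact false_of_eq_add_int_mul hδ hq (by linarith) (by linarith)
      · exact hnint m t ht h
    · by_cases ht : ∃ m : ℤ, t = m
      · obtain ⟨m, rfl⟩ := ht
        exact hnint m s hs h.symm
      · by_cases hcell : ((σ ^ ⌊s⌋) x).cell = ((σ ^ ⌊t⌋) x).cell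
        · have h3 := hdist ⌊s⌋ ⌊t⌋ s t ⟨Int.floor_le s, (Int.lt_floor_add_one s).le⟩
            ⟨Int.floor_le t, (Int.lt_floor_add_one t).le⟩ hcell h1 h2
          have h4 : K.curve t - K.curve s = (c' s - K.curve s) - (c' t - K.curve t) := by
            rw [h]; ring
          have h5 := norm_sub_le (c' s - K.curve s) (c' t - K.curve t)
          rw [h4] at h3
          linarith [hclose s, hclose t]
        · have h3 := hmem s hs
          rw [h] at h3
          exact Set.disjoint_left.1 (hD.disjoint _ _ hcell) h3 (hmem t ht)

lemma faceChain_nonCrossing : (faceChain hD hσ x).NonCrossing where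
  approx _ hδ _ hη := faceChain_approx hD hσ x hδ hη
  cusp_simple := faceChain_cusp_simple hD hσ x
  double := faceChain_double hD hσ x

lemma faceChain_turning : (faceChain hD hσ x).turning
    = ∑ m ∈ Finset.range (Function.minimalPeriod σ x),
      (((σ ^ m) x).dec.runTurn ((σ ^ m) x).idx - Real.pi) := by
  refine Finset.sum_congr rfl fun m _ => ?_
  show ((σ ^ (m : ℤ)) x).dec.angle (_ + (_ - _)) - ((σ ^ (m : ℤ)) x).dec.angle (_ + 0) - _ = _
  rw [add_sub_cancel, add_zero, zpow_natCast]
  rfl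

/-- If a run contains a point at which a line supports all the cells, then its face chain has
turning `2π`. -/
lemma faceChain_turning_of_support {u : ℝ}
    (hu : u ∈ Set.Ioo (x.dec.runStart x.idx) (x.dec.runEnd x.idx)) {ψ : ℝ}
    (hψ : ∀ l, ∀ z ∈ Ω l, 0 ≤ ((z - x.dec.curve u) * cis (-ψ)).im) :
    (faceChain hD hσ x).turning = 2 * Real.pi := by
  set K := faceChain hD hσ x with hK
  have hℓ : K.ℓ 0 = x.dec.runEnd x.idx - x.dec.runStart x.idx := rfl
  have hℓ0 := K.length_pos 0
  set t := (u - x.dec.runStart x.idx) / K.ℓ 0 with ht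
  have ht0 : t ∈ Set.Ioo ((0 : ℤ) : ℝ) ((0 : ℤ) + 1) := by
    rw [Int.cast_zero, zero_add]
    exact ⟨div_pos (by linarith [hu.1]) hℓ0, (div_lt_one hℓ0).2 (by linarith [hu.2])⟩
  have htℓ : (t - (0 : ℤ)) * K.ℓ 0 = u - x.dec.runStart x.idx := by
    rw [Int.cast_zero, sub_zero, ht, div_mul_cancel₀ _ hℓ0.ne']
  have hcurve : K.curve t = x.dec.curve u := by
    have := faceChain_curve hD hσ x ht0.1.le ht0.2.le
    rw [← hK, htℓ] at this
    rw [this]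
    show x.dec.curve (x.dec.runStart x.idx + (u - x.dec.runStart x.idx)) = _
    rw [add_sub_cancel]
  have hφ : K.φ 0 ((t - (0 : ℤ)) * K.ℓ 0) = x.dec.angle u := by
    rw [htℓ]
    show x.dec.angle (x.dec.runStart x.idx + (u - x.dec.runStart x.idx)) = _
    rw [add_sub_cancel]
  have hang := x.dec.cis_angle_eq_of_support (hψ x.cell)
  have hneg : cis (-x.dec.angle u) = cis (-ψ) := by
    obtain ⟨q, hq⟩ := cis_eq_cis_iff.1 hang
    exact cis_eq_cis_iff.2 ⟨-q, by push_cast; linarith⟩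
  have hns := faceChain_nonCrossing hD hσ x
  refine hns.turning_eq_two_pi ht0 (fun s => ?_) fun s hs => ?_
  · rw [← hK, hφ, hneg, hcurve]
    refine C1JordanDomain.im_nonneg_of_mem_closure (hψ ((σ ^ ⌊s⌋) x).cell) ?_
    rw [hK, faceChain_curve hD hσ x (Int.floor_le s) (Int.lt_floor_add_one s).le]
    exact C1JordanDomain.curve_mem_closure _ _
  · by_cases hint : ∃ m : ℤ, s = m
    · obtain ⟨m, rfl⟩ := hint
      obtain ⟨q, hq⟩ := hns.cusp_simple m t hs.symm
      exfalso
      have h1 := ht0.1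
      have h2 := ht0.2
      rw [hq] at h1 h2
      have h3 : (0 : ℤ) < m + q * Function.minimalPeriod σ x := by exact_mod_cast h1
      have h4 : m + q * Function.minimalPeriod σ x < (0 : ℤ) + 1 := by exact_mod_cast h2
      omega
    · have hsm : s ∈ Set.Ioo (⌊s⌋ : ℝ) (⌊s⌋ + 1) :=
        ⟨lt_of_le_of_ne (Int.floor_le s) fun h => hint ⟨_, h.symm⟩, Int.lt_floor_add_one s⟩
      rcases hns.double _ _ t s ht0 hsm hs.symm with h1 | h1
      · exact h1
      · exfalso
        rw [← hK, hφ, hang] at h1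
        have hs' : ((σ ^ ⌊s⌋) x).dec.curve (((σ ^ ⌊s⌋) x).dec.runStart ((σ ^ ⌊s⌋) x).idx
            + (s - ⌊s⌋) * K.ℓ ⌊s⌋) = x.dec.curve u := by
          rw [← hcurve, ← hs]
          exact (faceChain_curve hD hσ x hsm.1.le hsm.2.le).symm
        have h2 := ((σ ^ ⌊s⌋) x).dec.cis_angle_eq_of_support
          (t := ((σ ^ ⌊s⌋) x).dec.runStart ((σ ^ ⌊s⌋) x).idx + (s - ⌊s⌋) * K.ℓ ⌊s⌋) (ψ := ψ) (by
            rw [hs']; exact hψ _)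
        have h3 : cis ψ = -cis ψ := h2.symm.trans h1
        exact cis_ne_zero _ (self_eq_neg.1 h3)

end

/-! ### Sums over the cycles of a permutation -/

section

variable {α : Type*} [Fintype α] (σ : Equiv.Perm α)

open Classical in
lemma sum_range_minimalPeriod (f : α → ℝ) (x : α) :
    ∑ m ∈ Finset.range (Function.minimalPeriod σ x), f ((σ ^ m) x)
      = ∑ y ∈ Finset.univ.filter (σ.SameCycle x), f y := by
  rw [← Finset.sum_image (f := f) (g := fun m : ℕ => (σ ^ m) x)]
  · refine Finset.sum_congr (Finset.ext fun y => ?_) fun _ _ => rfl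
    simp only [Finset.mem_image, Finset.mem_range, Finset.mem_filter, Finset.mem_univ, true_and]
    constructor
    · rintro ⟨m, -, rfl⟩
      exact ⟨m, by rw [zpow_natCast]⟩
    · intro h
      obtain ⟨m, rfl⟩ := h.exists_nat_pow_eq
      refine ⟨m % Function.minimalPeriod σ x, Nat.mod_lt _ (minimalPeriod_pos σ x), ?_⟩
      rw [← Equiv.Perm.iterate_eq_pow, ← Equiv.Perm.iterate_eq_pow,
        Function.iterate_mod_minimalPeriod_eq]
  · intro m hm m' hm' h
    simp only [← Equiv.Perm.iterate_eq_pow] at h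
    exact Function.iterate_injOn_Iio_minimalPeriod (Finset.mem_range.1 hm)
      (Finset.mem_range.1 hm') h

lemma sum_range_minimalPeriod_eq_of_sameCycle (f : α → ℝ) {x y : α} (h : σ.SameCycle x y) :
    ∑ m ∈ Finset.range (Function.minimalPeriod σ x), f ((σ ^ m) x)
      = ∑ m ∈ Finset.range (Function.minimalPeriod σ y), f ((σ ^ m) y) := by
  classical
  rw [sum_range_minimalPeriod, sum_range_minimalPeriod]
  refine Finset.sum_congr (Finset.filter_congr fun z _ => ?_) fun _ _ => rfl
  exact ⟨fun h' => h.symm.trans h', fun h' => h.trans h'⟩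

/-- If the sum of `f` is nonnegative over each cycle, its sum over one cycle is at most its total
sum. -/
lemma sum_range_minimalPeriod_le_sum (f : α → ℝ)
    (hf : ∀ x, 0 ≤ ∑ m ∈ Finset.range (Function.minimalPeriod σ x), f ((σ ^ m) x)) (x : α) :
    ∑ m ∈ Finset.range (Function.minimalPeriod σ x), f ((σ ^ m) x) ≤ ∑ y, f y := by
  classical
  have hclass : ∀ x : α, ∑ y ∈ Finset.univ.filter (fun y =>
      (Quotient.mk (Equiv.Perm.SameCycle.setoid σ) y) = Quotient.mk _ x), f y
      = ∑ m ∈ Finset.range (Function.minimalPeriod σ x), f ((σ ^ m) x) := by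
    intro x
    rw [sum_range_minimalPeriod]
    refine Finset.sum_congr (Finset.filter_congr fun y _ => ?_) fun _ _ => rfl
    rw [Quotient.eq]
    exact ⟨fun h => Equiv.Perm.SameCycle.symm h, fun h => Equiv.Perm.SameCycle.symm h⟩
  rw [← Finset.sum_fiberwise Finset.univ (Quotient.mk (Equiv.Perm.SameCycle.setoid σ)) f,
    ← hclass x]
  refine Finset.single_le_sum (f := fun c => ∑ y ∈ Finset.univ.filter (fun y =>
      (Quotient.mk (Equiv.Perm.SameCycle.setoid σ) y) = c), f y) (fun c _ => ?_)
    (Finset.mem_univ (Quotient.mk (Equiv.Perm.SameCycle.setoid σ) x))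
  induction c using Quotient.inductionOn with
  | h y => rw [hclass y]; exact hf y

end

/-! ### The turning of the faces -/

/-- A line through a point outside an open convex set leaves the set on its left. -/
lemma exists_supporting_angle {T : Set ℂ} (hT : IsOpen T) (hc : Convex ℝ T) {q : ℂ} (hq : q ∉ T) :
    ∃ ψ : ℝ, ∀ z ∈ T, 0 ≤ ((z - q) * cis (-ψ)).im := by
  obtain ⟨f, hf⟩ := geometric_hahn_banach_open_point hc hT hq
  set v : ℂ := ⟨-f Complex.I, f 1⟩ with hv
  refine ⟨v.arg, fun z hz => ?_⟩
  have hfz : ∀ w : ℂ, f w = w.re * f 1 + w.im * f Complex.I := fun w => by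
    have hw : w = w.re • (1 : ℂ) + w.im • Complex.I := by simp
    calc f w = f (w.re • (1 : ℂ) + w.im • Complex.I) := congrArg f hw
      _ = _ := by simp only [map_add, map_smul, smul_eq_mul]
  have h1 : ‖v‖ * Real.cos v.arg = -f Complex.I := Complex.norm_mul_cos_arg v
  have h2 : ‖v‖ * Real.sin v.arg = f 1 := Complex.norm_mul_sin_arg v
  have h3 := hf z hz
  rw [← sub_neg, ← map_sub, hfz, ← h2] at h3
  have h4 : 0 < ‖v‖ * ((z - q) * cis (-v.arg)).im := by
    rw [Complex.mul_im, cis_re, cis_im, Real.cos_neg, Real.sin_neg]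
    have h5 : f Complex.I = -(‖v‖ * Real.cos v.arg) := by rw [h1, neg_neg]
    rw [h5] at h3
    linarith
  exact (pos_of_mul_pos_right h4 (norm_nonneg v)).le

/-- A face which contains a border junction arc has turning `2π`, since a line supports the whole
triangle at an endpoint of this arc. -/
lemma faceChain_turning_of_border (hD : IsCellSystem D) {σ : Equiv.Perm (Junction D)}
    (hσ : IsNextMap σ) (x : Junction D) (hx : ¬ x.dec.IsInner (x.idx + 1)) :
    (faceChain hD hσ x).turning = 2 * Real.pi := by
  have h1 := (ArcDecomposition.isBorder_of_not_isInner hx).1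
  rw [hD.isOpen.frontier_eq] at h1
  obtain ⟨ψ, hψ⟩ := exists_supporting_angle hD.isOpen hD.convex h1.2
  refine faceChain_turning_of_support hD hσ x ⟨?_, ?_⟩ fun l z hz => hψ z (hD.subset l hz)
  · exact x.dec.node_strictMono (by omega)
  · refine x.dec.node_strictMono ?_
    rw [ArcDecomposition.nextInner_of_not_isInner hx]
    omega

/-- The face below the cluster has turning `2π`. -/
lemma exists_faceChain_turning_eq (hD : IsCellSystem D) {σ : Equiv.Perm (Junction D)}
    (hσ : IsNextMap σ) (hk : 1 ≤ k) :
    ∃ x, (faceChain hD hσ x).turning = 2 * Real.pi := by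
  -- a lowest point of the cluster
  obtain ⟨q, hq, hmin⟩ : ∃ q ∈ ⋃ j, closure (Ω j), ∀ z ∈ ⋃ j, closure (Ω j), q.im ≤ z.im := by
    have hK : IsCompact (⋃ j, closure (Ω j)) :=
      isCompact_iUnion fun j => (D j).isBounded.isCompact_closure
    have hne : (⋃ j, closure (Ω j)).Nonempty := by
      obtain ⟨z, hz⟩ := (D ⟨0, hk⟩).isConnected.1.closure
      exact ⟨z, Set.mem_iUnion.2 ⟨_, hz⟩⟩
    obtain ⟨q, hq, h⟩ := hK.exists_isMinOn hne (f := Complex.im) Complex.continuous_im.continuousOn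
    exact ⟨q, hq, fun z hz => h hz⟩
  obtain ⟨j, hj⟩ := Set.mem_iUnion.1 hq
  have hmem : ∀ l, ∀ z ∈ Ω l, q.im ≤ z.im := fun l z hz =>
    hmin z (Set.mem_iUnion.2 ⟨l, subset_closure hz⟩)
  have hqf : q ∈ frontier (Ω j) := by
    rw [(D j).isOpen.frontier_eq]
    refine ⟨hj, fun h => ?_⟩
    obtain ⟨z, hz, hz'⟩ := exists_im_lt_of_isOpen (D j).isOpen h
    linarith [hmem j z hz]
  rw [← (D j).range_eq] at hqf
  obtain ⟨u, rfl⟩ := hqf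
  have hsupp : ∀ l, ∀ z ∈ Ω l, 0 ≤ ((z - (D j).curve u) * cis (-0)).im := by
    intro l z hz
    rw [neg_zero, cis_zero, mul_one, Complex.sub_im]
    linarith [hmem l z hz]
  rcases (D j).exists_isInner_or_run hD.isOpen u with ⟨i, hi, hu⟩ | ⟨i, hi, hu⟩
  · -- the two cells along an inner junction arc cannot both be above their tangent
    exfalso
    obtain ⟨l, hl, i', -, harc⟩ := hD.shared j i hi
    obtain ⟨v, -, hv⟩ : (D j).curve u ∈ (D l).junctionArc i' := by
      rw [harc]; exact Set.mem_image_of_mem _ hu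
    have h1 := (D j).cis_angle_eq_of_support (hsupp j)
    have h2 := (D l).cis_angle_eq_of_support (t := v) (ψ := 0) (by rw [hv]; exact hsupp l)
    have h3 := hD.cis_angle_eq_neg hl.symm hv.symm
    rw [h1, h2] at h3
    exact cis_ne_zero _ (self_eq_neg.1 h3)
  · obtain ⟨x, rfl, r, hr⟩ := Junction.exists_eq j hi
    refine ⟨x, faceChain_turning_of_support hD hσ x (u := u + (-r : ℤ) * x.dec.length) (ψ := 0)
      ⟨?_, ?_⟩ fun l z hz => ?_⟩
    · have h1 := x.dec.node_add_mul (2 * x.idx + 2) r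
      have h2 : x.dec.node (2 * i + 2) < u := hu.1
      rw [show 2 * i + 2 = 2 * x.idx + 2 + 2 * (r * x.dec.numJunction) by
        rw [hr]; unfold Junction.dec; ring, h1] at h2
      rw [ArcDecomposition.runStart]
      push_cast
      linarith
    · have h1 := x.dec.node_add_mul (2 * x.dec.nextInner x.idx + 1) r
      have h2 : u < x.dec.node (2 * x.dec.nextInner i + 1) := hu.2
      have h3 : x.dec.nextInner i = x.dec.nextInner x.idx + r * x.dec.numJunction := by
        rw [hr]; exact x.dec.nextInner_add_mul _ _
      rw [show 2 * x.dec.nextInner i + 1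
        = 2 * x.dec.nextInner x.idx + 1 + 2 * (r * x.dec.numJunction) by rw [h3]; ring, h1] at h2
      rw [ArcDecomposition.runEnd]
      push_cast
      linarith
    · rw [x.dec.curve_add_int_mul]
      exact hsupp l z hz

open Classical in
/-- The contribution of a run to the count: its turning, the turning `-π` of the cusp at its end,
and a correction `2π/3` if the run is a single free arc. -/
def runWeight (x : Junction D) : ℝ :=
  x.dec.runTurn x.idx - Real.pi
    + 2 * Real.pi / 3 * (1 - if x.dec.IsInner (x.idx + 1) then 0 else 1)

lemma two_pi_le_sum_runWeight_of_turning (hD : IsCellSystem D) {σ : Equiv.Perm (Junction D)}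
    (hσ : IsNextMap σ) {x : Junction D}
    (hx : (faceChain hD hσ x).turning = 2 * Real.pi) :
    2 * Real.pi ≤ ∑ m ∈ Finset.range (Function.minimalPeriod σ x), runWeight ((σ ^ m) x) := by
  rw [← hx, faceChain_turning]
  refine Finset.sum_le_sum fun m _ => ?_
  have := Real.pi_pos
  unfold runWeight
  split_ifs <;> linarith

/-- The total weight of the runs around a face is nonnegative: if the face contains a border
junction arc, it has turning `2π`, and otherwise its runs are convex. -/
lemma sum_runWeight_nonneg (hD : IsCellSystem D) {σ : Equiv.Perm (Junction D)}
    (hσ : IsNextMap σ) (x : Junction D) :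
    0 ≤ ∑ m ∈ Finset.range (Function.minimalPeriod σ x), runWeight ((σ ^ m) x) := by
  by_cases hb : ∃ m : ℤ, ¬ ((σ ^ m) x).dec.IsInner (((σ ^ m) x).idx + 1)
  · obtain ⟨m, hm⟩ := hb
    rw [sum_range_minimalPeriod_eq_of_sameCycle σ runWeight ⟨m, rfl⟩]
    exact (by have := Real.pi_pos; positivity : 0 ≤ 2 * Real.pi).trans
      (two_pi_le_sum_runWeight_of_turning hD hσ (faceChain_turning_of_border hD hσ _ hm))
  · push Not at hb
    have hconv := (faceChain_nonCrossing hD hσ x).le_turning_of_convex fun m => by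
      set y := (σ ^ m) x with hy
      have h := y.dec.strictMonoOn_angle_freeArc (hD.cheeger_pos y.cell) (y.idx + 1)
      have hend : y.dec.runEnd y.idx = y.dec.node (2 * (y.idx + 1) + 1) := by
        rw [ArcDecomposition.runEnd, ArcDecomposition.nextInner_of_isInner (hb m)]
      rw [← hend, show 2 * (y.idx + 1) = 2 * y.idx + 2 by ring] at h
      intro u hu v hv huv
      have hu2 : u ≤ y.dec.runEnd y.idx - y.dec.runStart y.idx := hu.2
      have hv2 : v ≤ y.dec.runEnd y.idx - y.dec.runStart y.idx := hv.2
      exact h ⟨le_add_of_nonneg_right hu.1, by change y.dec.runStart y.idx + u ≤ _; linarith⟩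
        ⟨le_add_of_nonneg_right hv.1, by change y.dec.runStart y.idx + v ≤ _; linarith⟩
        (add_lt_add_right huv _)
    have h1 : ∀ m : ℕ, runWeight ((σ ^ m) x)
        = (((σ ^ m) x).dec.runTurn ((σ ^ m) x).idx - Real.pi) + 2 * Real.pi / 3 := by
      intro m
      have := hb m
      rw [zpow_natCast] at this
      rw [runWeight, if_pos this, sub_zero, mul_one]
    rw [Finset.sum_congr rfl fun m _ => h1 m, Finset.sum_add_distrib, ← faceChain_turning hD hσ,
      Finset.sum_const, Finset.card_range, nsmul_eq_mul]
    linarith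

lemma two_pi_le_sum_runWeight (hD : IsCellSystem D) (hk : 1 ≤ k) : 2 * Real.pi ≤ ∑ x : Junction D, runWeight x := by
  obtain ⟨σ, hσ⟩ := hD.exists_next
  obtain ⟨x, hx⟩ := exists_faceChain_turning_eq hD hσ hk
  exact (two_pi_le_sum_runWeight_of_turning hD hσ hx).trans
    (sum_range_minimalPeriod_le_sum σ runWeight (sum_runWeight_nonneg hD hσ) x)

/-! ### Counting the junction arcs -/

lemma sum_junction (f : ∀ _ : Fin k, ℤ → ℝ) :
    ∑ x : Junction D, f x.cell x.idx = ∑ x ∈ innerJunctions D, f x.1 x.2 :=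
  Finset.sum_coe_sort (innerJunctions D) fun x => f x.1 x.2

open Classical in
/-- The border junction arcs of all cells. -/
def borderJunctions (D : ∀ j, ArcDecomposition T (Ω j)) : Finset (Σ _ : Fin k, ℕ) :=
  Finset.univ.sigma fun j => (Finset.range (D j).numJunction).filter fun i : ℕ => ¬ (D j).IsInner i

lemma card_innerJunctions_add_card_borderJunctions :
    (innerJunctions D).card + (borderJunctions D).card = ∑ j, (D j).numJunction := by
  classical
  rw [innerJunctions, borderJunctions, Finset.card_sigma, Finset.card_sigma,
    ← Finset.sum_add_distrib]
  refine Finset.sum_congr rfl fun j _ => ?_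
  rw [Finset.card_filter_add_card_filter_not, Finset.card_range]

lemma ncard_outerEdges_le (hT : IsOpen T) : (outerEdges D).ncard ≤ (borderJunctions D).card := by
  classical
  set F : (Σ _ : Fin k, ℕ) → Sym2 (Option (Fin k)) × Set ℂ :=
    fun x => (s(some x.1, none), (D x.1).junctionArc x.2) with hF
  refine le_trans ?_ (Finset.card_image_le (s := borderJunctions D) (f := F))
  rw [← Set.ncard_coe_finset]
  refine Set.ncard_le_ncard ?_ (Finset.finite_toSet _)
  rintro ⟨e, S⟩ ⟨j, he, h⟩
  rcases h with ⟨j₁, l, i, i', -, h, -⟩ | ⟨j₁, i, h, hi, hS⟩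
  · exfalso
    rw [Sym2.eq_iff] at h
    simp at h
  · obtain rfl : j = j₁ := by
      rw [Sym2.eq_iff] at h
      simpa using h
    change e = _ at he
    change _ = S at hS
    subst he hS
    have hΛ : (0 : ℤ) < (D j).numJunction := by exact_mod_cast (D j).numJunction_pos
    obtain ⟨r, hr⟩ := Int.eq_ofNat_of_zero_le (Int.emod_nonneg i hΛ.ne')
    have hlt := Int.emod_lt_of_pos i hΛ
    have ediv := Int.emod_add_mul_ediv i (D j).numJunction
    rw [hr, mul_comm] at ediv
    rw [hr] at hlt
    have hni := hi.not_isInner hT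
    rw [← ediv, (D j).isInner_add_mul] at hni
    refine Finset.mem_coe.2 (Finset.mem_image.2 ⟨⟨j, r⟩, Finset.mem_sigma.2 ⟨Finset.mem_univ _,
      Finset.mem_filter.2 ⟨Finset.mem_range.2 (by exact_mod_cast hlt), hni⟩⟩, ?_⟩)
    simp only [hF, Prod.mk.injEq, true_and]
    conv_rhs => rw [← ediv]
    exact ((D j).junctionArc_add_mul _ _).symm

/-- The turnings of the runs of all cells add up to `2πk`, since the turnings of the inner junction
arcs cancel in pairs. -/
lemma sum_runTurn (hD : IsCellSystem D) :
    ∑ x : Junction D, x.dec.runTurn x.idx = 2 * Real.pi * k := by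
  classical
  have h1 : ∑ x : Junction D, ((D x.cell).junctionTurn x.idx + (D x.cell).runTurn x.idx)
      = 2 * Real.pi * k := by
    rw [sum_junction fun j i => (D j).junctionTurn i + (D j).runTurn i, innerJunctions,
      Finset.sum_sigma, Finset.sum_congr rfl fun j _ =>
        (D j).sum_junctionTurn_add_runTurn hD.isOpen]
    simp [mul_comm]
  have h2 : ∑ x : Junction D, x.dec.junctionTurn x.idx = 0 := by
    obtain ⟨pr, hpr, h⟩ := hD.exists_partner_map
    have h3 := Equiv.sum_comp (Function.Involutive.toPerm pr hpr)
      fun x : Junction D => x.dec.junctionTurn x.idx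
    have h4 : ∑ x : Junction D, (pr x).dec.junctionTurn (pr x).idx
      = -∑ x : Junction D, x.dec.junctionTurn x.idx := by
      rw [← Finset.sum_neg_distrib]
      exact Finset.sum_congr rfl fun x _ => h x
    change ∑ x : Junction D, (pr x).dec.junctionTurn (pr x).idx = _ at h3
    rw [h4] at h3
    linarith
  rw [Finset.sum_add_distrib] at h1
  change ∑ x : Junction D, x.dec.junctionTurn x.idx + ∑ x : Junction D, x.dec.runTurn x.idx = _
    at h1
  rw [h2, zero_add] at h1
  exact h1

lemma sum_runWeight (hD : IsCellSystem D) :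
    ∑ x : Junction D, runWeight x = 2 * Real.pi * k - Real.pi * (innerJunctions D).card
      + 2 * Real.pi / 3 * ((innerJunctions D).card - (borderJunctions D).card) := by
  classical
  have h1 : ∑ x : Junction D, (if x.dec.IsInner (x.idx + 1) then (0 : ℝ) else 1)
      = (borderJunctions D).card := by
    have h := sum_junction (D := D) fun j i => if (D j).IsInner (i + 1) then (0 : ℝ) else 1
    refine h.trans ?_
    rw [innerJunctions, Finset.sum_sigma, borderJunctions, Finset.card_sigma, Nat.cast_sum]
    exact Finset.sum_congr rfl fun j _ => sum_not_succ (D j).isInner_add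
      fun i => ArcDecomposition.isInner_of_not_isInner_succ hD.isOpen
  have h2 : (Fintype.card (Junction D) : ℝ) = (innerJunctions D).card := by
    rw [Fintype.card_coe]
  unfold runWeight
  rw [Finset.sum_add_distrib, Finset.sum_sub_distrib, sum_runTurn hD, ← Finset.mul_sum,
    Finset.sum_sub_distrib, h1, Finset.sum_const, Finset.sum_const, Finset.card_univ,
    nsmul_eq_mul, nsmul_eq_mul, h2]
  ring

/-- The number of junction arcs of a cell system. -/
theorem sum_numJunction_add_ncard_outerEdges_add_six_le (hD : IsCellSystem D) (hk : 1 ≤ k) :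
    (∑ j, (D j).numJunction) + (outerEdges D).ncard + 6 ≤ 6 * k := by
  have h1 := two_pi_le_sum_runWeight hD hk
  rw [sum_runWeight hD] at h1
  have h2 : (innerJunctions D).card + 2 * (borderJunctions D).card + 6 ≤ (6 * k : ℝ) := by
    refine le_of_mul_le_mul_left ?_ (by have := Real.pi_pos; positivity : 0 < Real.pi / 3)
    linarith
  have h3 : (innerJunctions D).card + 2 * (borderJunctions D).card + 6 ≤ 6 * k := by
    exact_mod_cast h2
  have h4 := card_innerJunctions_add_card_borderJunctions (D := D)
  have h5 := ncard_outerEdges_le (D := D) hD.isOpen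
  omega

/-! ### Positivity of the Cheeger constant -/

lemma perimeter_ne_zero {Ω : Set ℂ} (ho : IsOpen Ω) (hb : Bornology.IsBounded Ω)
    (h0 : MeasureTheory.volume Ω ≠ 0) (hfin : MeasureTheory.volume Ω ≠ ∞) : perimeter Ω ≠ 0 := by
  obtain ⟨R, hR, hΩ⟩ := hb.subset_ball_lt 0 (0 : ℂ)
  -- the test field is a truncation of a multiple of the identity
  let χ : ContDiffBump (0 : ℂ) := ⟨R, R + 1, hR, by linarith⟩
  have hR1 : 0 < R + 1 := by linarith
  set φ : ℂ → ℂ := fun z => ((R + 1)⁻¹ * χ z) • z with hφ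
  have hφ1 : ContDiff ℝ 1 φ := (contDiff_const.mul χ.contDiff).smul contDiff_id
  have hφ2 : HasCompactSupport φ := (χ.hasCompactSupport.mul_left (f := fun _ => (R + 1)⁻¹)).smul_right
  have hφ3 : ∀ z, ‖φ z‖ ≤ 1 := by
    intro z
    rcases le_or_gt (R + 1) ‖z‖ with h | h
    · have : χ z = 0 := χ.zero_of_le_dist (by rw [dist_zero_right]; exact h)
      simp [hφ, this]
    · simp only [hφ, norm_smul, norm_mul, norm_inv, Real.norm_of_nonneg hR1.le,
        Real.norm_of_nonneg χ.nonneg]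
      calc (R + 1)⁻¹ * χ z * ‖z‖ ≤ (R + 1)⁻¹ * 1 * (R + 1) := by
            gcongr
            exact χ.le_one
        _ = 1 := by field_simp
  have hdiv : ∀ z ∈ Ω, divergence φ z = 2 * (R + 1)⁻¹ := by
    intro z hz
    have h1 : φ =ᶠ[𝓝 z] fun z => (R + 1)⁻¹ • z := by
      filter_upwards [χ.eventuallyEq_one_of_mem_ball (hΩ hz)] with w hw
      simp [hφ, hw]
    have h2 : HasFDerivAt (fun z : ℂ => (R + 1)⁻¹ • z)
        ((R + 1)⁻¹ • ContinuousLinearMap.id ℝ ℂ) z :=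
      (hasFDerivAt_id (𝕜 := ℝ) z).const_smul (R + 1)⁻¹
    rw [divergence, h1.fderiv_eq, h2.fderiv]
    generalize (R + 1)⁻¹ = a
    simp
    ring
  have hint : ∫ z in Ω, divergence φ z = (MeasureTheory.volume Ω).toReal * (2 * (R + 1)⁻¹) := by
    rw [MeasureTheory.setIntegral_congr_fun ho.measurableSet hdiv]
    simp [MeasureTheory.measureReal_def]
  refine ne_of_gt (lt_of_lt_of_le ?_ (le_iSup₂_of_le φ ⟨hφ1, hφ2, hφ3⟩ le_rfl))
  rw [hint, ENNReal.ofReal_pos]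
  exact mul_pos (ENNReal.toReal_pos h0 hfin) (by positivity)

lemma cheeger_pos {Ω : Set ℂ} (h : IsCheegerOfItself Ω) (ho : IsOpen Ω)
    (hb : Bornology.IsBounded Ω) (hP : perimeter Ω ≠ ∞) : 0 < cheeger Ω := by
  obtain ⟨-, h0, h1, h2⟩ := h
  rw [cheeger, ← h2]
  exact ENNReal.toReal_pos (ENNReal.div_ne_zero.2 ⟨perimeter_ne_zero ho hb h0 h1, h1⟩)
    (ENNReal.div_ne_top hP h0)

/-! ### Optimal clusters -/

lemma HasClusterStructure.isCellSystem {p : ℝ} (hT : IsEquilateralTriangle T)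
    (hΩ : IsCluster T Ω) (hD : HasClusterStructure p T Ω D) : IsCellSystem D where
  isOpen := by
    obtain ⟨a, b, c, -, -, -, rfl⟩ := hT
    exact isOpen_interior
  convex := by
    obtain ⟨a, b, c, -, -, -, rfl⟩ := hT
    exact (convex_convexHull ℝ _).interior
  subset j := (hΩ.1 j).2.1
  disjoint j l hjl := Set.disjoint_iff_inter_eq_empty.2
    (((D j).isOpen.inter (D l).isOpen).eq_empty_of_measure_zero (hΩ.2 j l hjl))
  cheeger_pos j := cheeger_pos (hD.mem_classA j).2.1 (D j).isOpen (D j).isBounded (hΩ.1 j).2.2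
  shared j i hi := by
    obtain ⟨l, hl, h, -⟩ := hD.inner_shared j i hi
    exact ⟨l, hl, h⟩

end CheegerCluster

end

theorem mainTheorem6 (T : Set ℂ) (hT : CheegerCluster.IsEquilateralTriangle T)
    (k : ℕ) (hk : 1 ≤ k) (p : ℝ) (hp : 1 ≤ p) (Ω : Fin k → Set ℂ)
    (hΩ : CheegerCluster.IsOptimalCluster p T Ω)
    (D : ∀ j, CheegerCluster.ArcDecomposition T (Ω j))
    (hD : CheegerCluster.HasClusterStructure p T Ω D) :
    (∑ j, (D j).numJunction) + (CheegerCluster.outerEdges D).ncard + 6 ≤ 6 * k :=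
  CheegerCluster.sum_numJunction_add_ncard_outerEdges_add_six_le (hD.isCellSystem hT hΩ.1) hk
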